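/- A \emph{vertical plane} is a pair $(\mathcal P,\pi)$ where $\mathcal P$ is an oriented topological space homeomorphic to $\mathbb R^2$ and $\pi:\mathcal P\to\mathbb R$ is a locally trivial topological fibration; the fibers of $\pi$ are the vertical lines. For a closed one-dimensional topological submanifold $\mathcal C\subset\mathcal P$, a point $p\in\mathcal C$ is a \emph{topological critical point} if $p$ has no open neighbourhood in $\mathcal C$ that $\pi$ maps homeomorphically onto its image; $\Sigma_{\mathrm{top}}(\mathcal C)$ is the set of these points. A \emph{domain of weakly finite type} in $(\mathcal P,\pi)$ is a closed subset $\mathcal D\subset\mathcal P$ homeomorphic to a surface with non-empty boundary such that, $\mathcal C$ denoting this boundary, the restriction $\pi_{|\mathcal C}:\mathcal C\to\mathbb R$ is proper and $\Sigma_{\mathrm{top}}(\mathcal C)$ is finite. It is \emph{generic} if no two topological critical points of $\mathcal C$ lie on the same vertical line. Let $\sim_{\mathcal D}$ be the equivalence relation on $\mathcal P$ whose classes are the connected components of the sets $\pi^{-1}(x_0)\cap\mathcal D$ ($x_0\in\mathbb R$) and the single points of $\mathcal P\setminus\mathcal D$; let $\rho:\mathcal P\to\tilde{\mathcal P}=\mathcal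 P/{\sim_{\mathcal D}}$ be the quotient map and $\tilde{\mathcal D}=\rho(\mathcal D)$, with the topology induced from the quotient topology of $\tilde{\mathcal P}$. A \emph{critical segment} is a connected component of a fiber of $\pi_{|\mathcal D}$ containing a point of $\Sigma_{\mathrm{top}}(\mathcal C)$. A \emph{band} is the closure of a connected component of the complement in $\mathcal D$ of the union of the critical segments. The vertices of $\tilde{\mathcal D}$ are the points of $\rho(\Sigma_{\mathrm{top}}(\mathcal C))$ and its edges are the images under $\rho$ of the bands. A \emph{Poincaré--Reeb graph} of a generic domain $\mathcal D$ of weakly finite type is the image $G=s(\tilde{\mathcal D})\subset\mathcal P$ of a continuous section $s:\tilde{\mathcal D}\to\mathcal D$ of $\rho_{|\mathcal D}$, its vertices and edges being the images under $s$ of the vertices and edges of $\tilde{\mathcal D}$. A \emph{transversal graph} in $(\mathcal P,\pi)$ is a closed subset $G\subset\mathcal P$ partitioned into finitely many points, called vertices, and finitely many subsets homeomorphic to open segments of $\mathbb R$, called open edges, such that: (1) each edge, that is, the closure $\overline E$ of an open edge $E$, is homeomorphic to a closed (bounded or unbounded) interval of $\mathbb R$, and $\overline E\setminus E$ consists of $0$,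 $1$ or $2$ vertices; (2) the restriction of $\pi$ to each edge is a homeomorphism onto its image; (3) $\pi_{|G}:G\to\mathbb R$ is proper. It is \emph{generic} if each vertex has valency $1$ or $3$ and distinct vertices lie on distinct vertical lines. It is a \emph{generic transversal binary tree} if it is generic and is moreover a tree, i.e. connected and without cycles (unbounded edges, which have fewer than two end vertices, being allowed). \textbf{Proposition.} Let $\mathcal D$ be a simply connected generic domain of weakly finite type in a vertical plane $(\mathcal P,\pi)$. Then $\mathcal D$ has a Poincaré--Reeb graph, and every Poincaré--Reeb graph of $\mathcal D$, with its vertices and edges, is a generic transversal binary tree in $(\mathcal P,\pi)$. -/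

import Mathlib

open Set Topology

namespace PoincareReeb

universe u

variable {P : Type u} [TopologicalSpace P]

/-- `(P, π)` is a vertical plane: `P` is homeomorphic to the real plane and `π : P → ℝ` is a
locally trivial topological fibration. -/
structure IsVerticalPlane (π : P → ℝ) : Prop where
  homeomorph_plane : Nonempty (P ≃ₜ ℝ × ℝ)
  locally_trivial : ∃ (F : Type u) (_ : TopologicalSpace F),
    ∀ x : ℝ, ∃ e : Bundle.Trivialization F π, x ∈ e.baseSet

/-- `D` is a topological surface, possibly with boundary: each of its points has an open
neighbourhood in `D` homeomorphic to an open subset of the closed half-plane `{x | 0 ≤ x 0}`.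
(For subsets of a vertical plane, the Hausdorff property and second countability are automatic.) -/
def IsSurface (D : Set P) : Prop :=
  ∀ p : D, ∃ e : OpenPartialHomeomorph D (EuclideanHalfSpace 2), p ∈ e.source

/-- The boundary of the surface `D`: the points that some chart sends to the boundary line
`{x | x 0 = 0}` of the half-plane. -/
def surfaceBoundary (D : Set P) : Set P :=
  {p | ∃ (hp : p ∈ D) (e : OpenPartialHomeomorph D (EuclideanHalfSpace 2)),
    (⟨p, hp⟩ : D) ∈ e.source ∧ (e ⟨p, hp⟩).val 0 = 0}

/-- The topological critical set of the curve `C`: the points of `C` having no open neighbourhood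
in `C` that `π` maps homeomorphically onto its image. -/
def topCrit (π : P → ℝ) (C : Set P) : Set P :=
  {p ∈ C | ¬ ∃ U : Set P, IsOpen U ∧ p ∈ U ∧ IsEmbedding ((C ∩ U).domRestrict π)}

/-- Domains of weakly finite type in `(P, π)`. -/
structure IsWeaklyFiniteType (π : P → ℝ) (D : Set P) : Prop where
  isClosed : IsClosed D
  isSurface : IsSurface D
  boundary_nonempty : (surfaceBoundary D).Nonempty
  proper_boundary : IsProperMap ((surfaceBoundary D).domRestrict π)
  finite_topCrit : (topCrit π (surfaceBoundary D)).Finite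

/-- A domain is generic if no two topological critical points of its boundary lie on the same
vertical line. -/
def IsGenericDomain (π : P → ℝ) (D : Set P) : Prop :=
  InjOn π (topCrit π (surfaceBoundary D))

/-- The connected component of `p` in the fiber of `π` restricted to `D` through `p`
(empty if `p ∉ D`). -/
def fiberComponent (π : P → ℝ) (D : Set P) (p : P) : Set P :=
  connectedComponentIn (D ∩ π ⁻¹' {π p}) p

/-- Vertical equivalence relative to `D`. -/
def vertRel (π : P → ℝ) (D : Set P) (p q : P) : Prop :=
  π p = π q ∧ (q ∈ fiberComponent π D p ∨ (p = q ∧ p ∉ D))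

theorem fiberComponent_eq {π : P → ℝ} {D : Set P} {p q : P} (h : q ∈ fiberComponent π D p) :
    fiberComponent π D q = fiberComponent π D p := by
  have hq : q ∈ D ∩ π ⁻¹' {π p} := connectedComponentIn_subset _ _ h
  have hπ : π q = π p := hq.2
  unfold fiberComponent at h ⊢
  rw [hπ]
  exact (connectedComponentIn_eq h).symm

theorem mem_of_mem_fiberComponent {π : P → ℝ} {D : Set P} {p q : P}
    (h : q ∈ fiberComponent π D p) : p ∈ D ∧ q ∈ D :=
  ⟨(connectedComponentIn_nonempty_iff.1 ⟨q, h⟩).1, (connectedComponentIn_subset _ _ h).1⟩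

theorem self_mem_fiberComponent {π : P → ℝ} {D : Set P} {p : P} (hp : p ∈ D) :
    p ∈ fiberComponent π D p :=
  mem_connectedComponentIn ⟨hp, rfl⟩

theorem vertRel_equivalence (π : P → ℝ) (D : Set P) : Equivalence (vertRel π D) where
  refl p := by
    refine ⟨rfl, ?_⟩
    by_cases hp : p ∈ D
    · exact Or.inl (self_mem_fiberComponent hp)
    · exact Or.inr ⟨rfl, hp⟩
  symm := by
    rintro p q ⟨h, h' | ⟨rfl, hp⟩⟩
    · refine ⟨h.symm, Or.inl ?_⟩
      rw [fiberComponent_eq h']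
      exact self_mem_fiberComponent (mem_of_mem_fiberComponent h').1
    · exact ⟨rfl, Or.inr ⟨rfl, hp⟩⟩
  trans := by
    rintro p q r ⟨h, h' | ⟨rfl, hp⟩⟩ ⟨k, k' | ⟨rfl, hq⟩⟩
    · exact ⟨h.trans k, Or.inl (fiberComponent_eq h' ▸ k')⟩
    · exact absurd (mem_of_mem_fiberComponent h').2 hq
    · exact absurd (mem_of_mem_fiberComponent k').1 hp
    · exact ⟨rfl, Or.inr ⟨rfl, hp⟩⟩

/-- Vertical equivalence as a setoid. -/
def vertSetoid (π : P → ℝ) (D : Set P) : Setoid P := ⟨vertRel π D, vertRel_equivalence π D⟩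

/-- The `D`-collapse of `P`, with the quotient topology. -/
abbrev Collapse (π : P → ℝ) (D : Set P) : Type u := Quotient (vertSetoid π D)

/-- The collapsing map relative to `D`. -/
def collapseMap (π : P → ℝ) (D : Set P) : P → Collapse π D := Quotient.mk (vertSetoid π D)

/-- The Poincaré–Reeb set of `D`, a subset of the collapse. -/
def prSet (π : P → ℝ) (D : Set P) : Set (Collapse π D) := collapseMap π D '' D

/-- The critical segments of `D`: the connected components of the fibers of `π` restricted to `D`
that contain a topological critical point of the boundary. -/
def criticalSegments (π : P → ℝ) (D : Set P) : Set (Set P) :=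
  {S | ∃ p ∈ topCrit π (surfaceBoundary D), S = fiberComponent π D p}

/-- The bands of `D`: the closures of the connected components of the complement in `D` of the
union of the critical segments. -/
def bands (π : P → ℝ) (D : Set P) : Set (Set P) :=
  {R | ∃ p ∈ D \ ⋃₀ criticalSegments π D,
    R = closure (connectedComponentIn (D \ ⋃₀ criticalSegments π D) p)}

/-- The vertices of the Poincaré–Reeb set. -/
def prVertices (π : P → ℝ) (D : Set P) : Set (Collapse π D) :=
  collapseMap π D '' topCrit π (surfaceBoundary D)

/-- The edges of the Poincaré–Reeb set. -/
def prEdges (π : P → ℝ) (D : Set P) : Set (Set (Collapse π D)) :=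
  {e | ∃ R ∈ bands π D, e = collapseMap π D '' R}

/-- A continuous section of the collapsing map from `D` to its Poincaré–Reeb set. -/
structure IsPRSection (π : P → ℝ) (D : Set P) (s : prSet π D → P) : Prop where
  continuous : Continuous s
  mem : ∀ x, s x ∈ D
  section_eq : ∀ x, collapseMap π D (s x) = x

/-- The image under a section `s` of the part of `A` lying in the Poincaré–Reeb set. -/
def sectionImage {π : P → ℝ} {D : Set P} (s : prSet π D → P) (A : Set (Collapse π D)) : Set P :=
  s '' (Subtype.val ⁻¹' A)

/-- The vertices of the Poincaré–Reeb graph in the source given by `s`. -/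
def sourceVertices {π : P → ℝ} {D : Set P} (s : prSet π D → P) : Set P :=
  sectionImage s (prVertices π D)

/-- The edges of the Poincaré–Reeb graph in the source given by `s`. -/
def sourceEdges {π : P → ℝ} {D : Set P} (s : prSet π D → P) : Set (Set P) :=
  sectionImage s '' prEdges π D

/-- `G`, with set of vertices `V` and set of (closed) edges `E`, is a transversal graph in
`(P, π)`. The open edge corresponding to an edge `e` is `e \ V`; it has `e` as its closure, so that
`closure (e \ V) \ (e \ V) = e ∩ V`. A closed segment of `ℝ` may be bounded or not: a closed
interval. -/
structure IsTransversalGraph (π : P → ℝ) (G V : Set P) (E : Set (Set P)) : Prop where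
  isClosed : IsClosed G
  finite_vertices : V.Finite
  finite_edges : E.Finite
  /-- `G` is partitioned into the vertices and the open edges -/
  union_eq : G = V ∪ ⋃ e ∈ E, e \ V
  disjoint_openEdges : E.PairwiseDisjoint (fun e => e \ V)
  openEdge_homeomorph : ∀ e ∈ E, Nonempty (↥(e \ V) ≃ₜ ℝ)
  closure_openEdge : ∀ e ∈ E, closure (e \ V) = e
  edge_homeomorph : ∀ e ∈ E, ∃ I : Set ℝ, IsClosed I ∧ I.OrdConnected ∧ Nonempty (e ≃ₜ I)
  edge_endpoints : ∀ e ∈ E, (e ∩ V).encard ≤ 2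
  /-- topological transversality to the vertical lines -/
  transversal : ∀ e ∈ E, IsEmbedding (e.domRestrict π)
  proper : IsProperMap (G.domRestrict π)

/-- The valency of `v`: the number of edges that contain it (the edges of a transversal graph are
not loops). -/
noncomputable def valency (E : Set (Set P)) (v : P) : ℕ := {e ∈ E | v ∈ e}.ncard

/-- Generic transversal graphs: the vertices have valency `1` or `3`, and distinct vertices lie on
distinct vertical lines. -/
structure IsGenericTransversalGraph (π : P → ℝ) (G V : Set P) (E : Set (Set P)) : Prop
    extends IsTransversalGraph π G V E where
  valency_eq : ∀ v ∈ V, valency E v = 1 ∨ valency E v = 3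
  injOn_vertices : InjOn π V

/-- The incidence graph of a graph with vertices `V` and edges `E`: its nodes are the vertices and
the edges, a vertex being joined to each edge containing it. It is the first subdivision of the
given graph, in which an edge with fewer than two ends is kept as a node. -/
def incidenceGraph (V : Set P) (E : Set (Set P)) : SimpleGraph (V ⊕ E) :=
  SimpleGraph.fromRel fun a b =>
    match a, b with
    | Sum.inl v, Sum.inr e => (v : P) ∈ (e : Set P)
    | _, _ => False

/-- A transversal graph is a generic transversal binary tree if it is generic (so each vertex has
valency `1` or `3`) and is a tree. To account for multiple edges and for edges with fewer than two
ends, being a tree (connected and without cycles) is tested on the incidence graph. -/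
structure IsGenericTransversalBinaryTree (π : P → ℝ) (G V : Set P) (E : Set (Set P)) : Prop
    extends IsGenericTransversalGraph π G V E where
  isTree : (incidenceGraph V E).IsTree

end PoincareReeb

namespace PoincareReeb
open Metric Filter

/-! The argument has a planar half and a one-dimensional half, both resting on a single tool:
continuous logarithms of nonvanishing functions. An odd function on the circle has no logarithm,
whereas logarithms persist under homotopy. This gives invariance of domain in the plane
(`closedBall_image_mem_nhds`), and with it the plane coordinates of a vertical plane
(`IsVerticalPlane.exists_homeomorph`) and the equality of the boundary of the surface with its
frontier (`surfaceBoundary_eq_frontier`).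

In coordinates, the boundary is locally an arc. Where it is not critical it is a graph over the
abscissa, with the domain on one side. At a critical point it folds, with the domain either between
the two branches or outside them (`PlanarDomain.endPoint_or_splitPoint`). A vertical segment of the
domain therefore persists nearby, except at a critical point, where it is born or dies (valency 1)
or is cut into two (valency 3); genericity forbids two such events on one line. The quotient is thus
a one-dimensional complex, proper over the line and locally injected into it off the vertices
(`IsVertCollapse.isBranchedLine`). Properness survives unbounded vertical segments because every
class meets the boundary or a fixed horizontal line.

A section exists because its possible ordinates over a class form an interval: local choices are
averaged by a partition of unity (`IsVertCollapse.exists_section`). Off the vertices each component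
of the quotient projects homeomorphically onto an open interval, which gives the edges and all the
conditions on a transversal graph.

The incidence graph is connected because the quotient is. For the absence of cycles, map one edge
once around the unit circle and everything else to 1. A section makes the quotient a retract of the
simply connected domain, so this map has a logarithm. The logarithm is constant along every other
edge and jumps by 2πi along the given one, so it is a potential showing that the edge is a bridge
(`IsBranchedLine.exists_separating`). Finally any section is a closed embedding over the line, and
carries this structure into the plane. -/

/-- The function `f` has a continuous logarithm. -/
def HasLog {A : Type*} [TopologicalSpace A] (f : A → ℂ) : Prop :=
  ∃ g : A → ℂ, Continuous g ∧ ∀ a, Complex.exp (g a) = f a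

/-! ### Continuous logarithms of nonvanishing functions -/

section Log

variable {A B : Type*} [TopologicalSpace A] [TopologicalSpace B]

theorem HasLog.comp {f : A → ℂ} (h : HasLog f) {u : B → A} (hu : Continuous u) :
    HasLog (f ∘ u) := by
  obtain ⟨g, hg, h⟩ := h
  exact ⟨g ∘ u, hg.comp hu, fun a => h _⟩

theorem hasLog_const {c : ℂ} (hc : c ≠ 0) : HasLog (fun _ : A => c) :=
  ⟨fun _ => Complex.log c, continuous_const, fun _ => Complex.exp_log hc⟩

/-- The direction of a nonvanishing complex function. -/
noncomputable def direction (f : A → ℂ) (hf : Continuous f) (h0 : ∀ a, f a ≠ 0) : C(A, Circle) where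
  toFun a := ⟨f a / ‖f a‖, by
    have := norm_ne_zero_iff.2 (h0 a)
    simp [Submonoid.unitSphere, this]⟩
  continuous_toFun := by
    refine Continuous.subtype_mk (hf.div (Complex.continuous_ofReal.comp hf.norm) fun a => ?_) _
    simpa using h0 a

theorem hasLog_of_direction {f : A → ℂ} (hf : Continuous f) (h0 : ∀ a, f a ≠ 0) {θ : A → ℝ}
    (hθ : Continuous θ) (h : ∀ a, Circle.exp (θ a) = direction f hf h0 a) : HasLog f := by
  refine ⟨fun a => (Real.log ‖f a‖ : ℝ) + (θ a : ℝ) * Complex.I, ?_, fun a => ?_⟩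
  · have : Continuous fun a => Real.log ‖f a‖ :=
      hf.norm.log fun a => norm_ne_zero_iff.2 (h0 a)
    fun_prop
  · have h1 := congrArg Subtype.val (h a)
    have h2 : Complex.exp (θ a * Complex.I) = f a / ‖f a‖ := by
      rw [← Circle.coe_exp]; exact h1
    have h3 := norm_pos_iff.2 (h0 a)
    rw [Complex.exp_add, h2, ← Complex.ofReal_exp, Real.exp_log h3]
    have : (‖f a‖ : ℂ) ≠ 0 := by exact_mod_cast h3.ne'
    field_simp

theorem circleExp_im_eq_direction {f : A → ℂ} (hf : Continuous f) (h0 : ∀ a, f a ≠ 0) {a : A}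
    {z : ℂ} (h : Complex.exp z = f a) : Circle.exp z.im = direction f hf h0 a := by
  apply Subtype.ext
  change (Circle.exp z.im : ℂ) = f a / ‖f a‖
  rw [Circle.coe_exp, ← h, Complex.norm_exp, Complex.ofReal_exp, ← Complex.exp_sub]
  congr 1
  apply Complex.ext <;> simp

/-- The direction of `H` lifts through the covering of the circle by the line, starting from the
imaginary part of the given logarithm. The modulus has a real logarithm in any case. -/
theorem HasLog.of_homotopy {H : unitInterval × A → ℂ} (hH : Continuous H) (h0 : ∀ p, H p ≠ 0)
    (h : HasLog fun a => H (0, a)) : HasLog fun a => H (1, a) := by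
  obtain ⟨g, hg, h⟩ := h
  let L := Circle.isCoveringMap_exp.liftHomotopy (direction H hH h0)
    ⟨fun a => (g a).im, Complex.continuous_im.comp hg⟩
    (fun a => (circleExp_im_eq_direction hH h0 (a := (0, a)) (h a)).symm)
  have hL : ∀ p, Circle.exp (L p) = direction H hH h0 p := fun p =>
    congrFun (Circle.isCoveringMap_exp.liftHomotopy_lifts (direction H hH h0)
      ⟨fun a => (g a).im, Complex.continuous_im.comp hg⟩ _) p
  have h1 : HasLog H := hasLog_of_direction hH h0 L.continuous hL
  exact h1.comp (u := fun a => ((1 : unitInterval), a)) (by fun_prop)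

theorem hasLog_of_simplyConnected [SimplyConnectedSpace A] [LocallyPathConnectedSpace A]
    {f : A → ℂ} (hf : Continuous f) (h0 : ∀ a, f a ≠ 0) : HasLog f := by
  obtain ⟨a₀⟩ : Nonempty A := inferInstance
  obtain ⟨θ, hθ⟩ : ∃ θ : ℝ, Circle.exp θ = direction f hf h0 a₀ := ⟨_, Circle.exp_arg _⟩
  obtain ⟨F, ⟨-, hF⟩, -⟩ :=
    Circle.isCoveringMap_exp.existsUnique_continuousMap_lifts (direction f hf h0) a₀ θ hθ
  exact hasLog_of_direction hf h0 F.continuous fun a => congrFun hF a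

/-- Scaling contracts the space to the origin, so `f` is homotopic to a constant. -/
theorem hasLog_of_module {E : Type*} [TopologicalSpace E] [AddCommGroup E] [Module ℝ E]
    [ContinuousSMul ℝ E] {f : E → ℂ} (hf : Continuous f) (h0 : ∀ a, f a ≠ 0) : HasLog f := by
  have := HasLog.of_homotopy (H := fun p : unitInterval × E => f ((p.1 : ℝ) • p.2))
    (by fun_prop) (fun _ => h0 _) (by simpa using hasLog_const (h0 0))
  simpa using this

/-- Two logarithms of one number differ by an element of the discrete group 2πiℤ, so a continuous
choice on a connected set cannot move. -/
theorem eq_of_exp_eq {S : Set A} (hS : IsPreconnected S) {g : A → ℂ} (hg : ContinuousOn g S)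
    {c : ℂ} (h : ∀ a ∈ S, Complex.exp (g a) = c) {a b : A} (ha : a ∈ S) (hb : b ∈ S) :
    g a = g b := by
  have key : ∀ x ∈ S, ∃ n : ℤ, g x = g b + n * (2 * Real.pi * Complex.I) := fun x hx =>
    Complex.exp_eq_exp_iff_exists_int.1 ((h x hx).trans (h b hb).symm)
  have him : ContinuousOn (fun x => (g x - g b).im) S :=
    Complex.continuous_im.comp_continuousOn (hg.sub continuousOn_const)
  have := hS.constant_of_mapsTo (T := (AddSubgroup.zmultiples (2 * Real.pi) : Set ℝ)) 
    ⟨(inferInstance : DiscreteTopology (AddSubgroup.zmultiples (2 * Real.pi)))⟩ him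
    (fun x hx => by
      obtain ⟨n, hn⟩ := key x hx
      exact ⟨n, by simp [hn]⟩) ha hb
  obtain ⟨n, hn⟩ := key a ha
  have h0 : (n : ℝ) * (2 * Real.pi) = 0 := by simpa [hn] using this
  have : (n : ℝ) = 0 := by
    rcases mul_eq_zero.1 h0 with h | h
    · exact h
    · exact absurd h (by positivity)
  have : n = 0 := by exact_mod_cast this
  simpa [this] using hn

/-- For a logarithm `g`, the difference `g (-y) - g y` is a logarithm of -1, hence constant on the
circle. Exchanging `y` and `-y` changes its sign, so it vanishes, and exp 0 is not -1. -/
theorem not_hasLog_of_odd {f : sphere (0 : ℂ) 1 → ℂ} (hf : ∀ x, f (-x) = -f x) : ¬ HasLog f := by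
  rintro ⟨g, hg, h⟩
  have hc : IsPreconnected (univ : Set (sphere (0 : ℂ) 1)) := by
    have : IsPreconnected (sphere (0 : ℂ) 1) := isPreconnected_sphere (by simp) 0 1
    have := isPreconnected_iff_preconnectedSpace.1 this
    exact isPreconnected_univ
  have x : sphere (0 : ℂ) 1 := ⟨1, by simp⟩
  have h1 : ∀ y, Complex.exp (g (-y) - g y) = -1 := fun y => by
    have : f y ≠ 0 := by rw [← h y]; exact Complex.exp_ne_zero _
    rw [Complex.exp_sub, h, h, hf, neg_div, div_self this]
  have h2 := eq_of_exp_eq hc (g := fun y => g (-y) - g y) (by fun_prop) (fun y _ => h1 y)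
    (mem_univ x) (mem_univ (-x))
  simp only [neg_neg] at h2
  have h3 : g (-x) - g x = 0 := by linear_combination h2 / 2
  have := h1 x
  rw [h3, Complex.exp_zero] at this
  norm_num at this

end Log

/-! ### Invariance of domain in the plane -/

/-- On the circle `f x - f 0` is homotopic to the odd function `f x - f (-x)`, so it has no
logarithm. If the image missed a point `w` close to `f 0`, then `f x - w` would have one, by
shrinking the circle inside the disc, and `w` could then be moved to `f 0` without meeting the image
of the circle. -/
theorem closedBall_image_mem_nhds_unit {f : ℂ → ℂ} (hf : ContinuousOn f (closedBall 0 1))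
    (hi : InjOn f (closedBall 0 1)) : f '' closedBall 0 1 ∈ 𝓝 (f 0) := by
  have hS : ∀ x : sphere (0 : ℂ) 1, ‖(x : ℂ)‖ = 1 := fun x => by simp
  have hmem : ∀ (t : ℝ) (x : sphere (0 : ℂ) 1), |t| ≤ 1 → (t : ℂ) * x ∈ closedBall (0 : ℂ) 1 := by
    intro t x ht; simpa [hS x] using ht
  have hmem1 : ∀ x : sphere (0 : ℂ) 1, (x : ℂ) ∈ closedBall (0 : ℂ) 1 := fun x => by
    simp [hS x]
  have hfs : Continuous fun x : sphere (0 : ℂ) 1 => f x :=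
    hf.comp_continuous continuous_subtype_val hmem1
  have hI : ∀ t : unitInterval, |(t : ℝ)| ≤ 1 := fun t => abs_le.2 ⟨by linarith [t.2.1], t.2.2⟩
  have hneg : ¬ HasLog fun x : sphere (0 : ℂ) 1 => f x - f 0 := by
    intro hlog
    have hodd : ¬ HasLog fun x : sphere (0 : ℂ) 1 => f x - f (-x) :=
      not_hasLog_of_odd fun x => by simp
    apply hodd
    -- Injectivity keeps `f x - f (-t x)` away from zero: `x = -t x` is impossible for `t ≥ 0`.
    have := HasLog.of_homotopy
      (H := fun p : unitInterval × sphere (0 : ℂ) 1 => f p.2 - f (((-p.1 : ℝ) : ℂ) * p.2))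
      ((hfs.comp continuous_snd).sub (hf.comp_continuous (by fun_prop)
        fun p => hmem _ _ (by rw [abs_neg]; exact hI _))) ?_ (by simpa using hlog)
    · simpa using this
    · rintro ⟨t, x⟩ h0
      have h1 := hi (hmem1 x) (hmem (-t) x (by rw [abs_neg]; exact hI _)) (sub_eq_zero.1 h0)
      have h2 : (1 + (t : ℂ)) * x = 0 := by push_cast at h1; linear_combination h1
      have h3 : (x : ℂ) ≠ 0 := norm_ne_zero_iff.1 (by rw [hS x]; norm_num)
      have h4 : (1 + (t : ℂ)) = 0 := (mul_eq_zero.1 h2).resolve_right h3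
      have h5 : (1 + (t : ℝ)) = 0 := by exact_mod_cast h4
      linarith [t.2.1]
  obtain ⟨δ, hδ, hδS⟩ : ∃ δ > 0, ∀ x : sphere (0 : ℂ) 1, δ ≤ ‖f x - f 0‖ := by
    have hne : Nonempty (sphere (0 : ℂ) 1) := ⟨⟨1, by simp⟩⟩
    obtain ⟨x, -, hx⟩ := isCompact_univ.exists_isMinOn univ_nonempty
      (f := fun x : sphere (0 : ℂ) 1 => ‖f x - f 0‖) (hfs.sub continuous_const).norm.continuousOn
    refine ⟨_, norm_pos_iff.2 (sub_ne_zero.2 fun h => ?_), fun y => hx (mem_univ y)⟩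
    have := hi (hmem1 x) (by simp) h
    have h1 := hS x
    rw [this] at h1
    simp at h1
  refine mem_of_superset (ball_mem_nhds _ hδ) fun w hw => ?_
  by_contra hwim
  apply hneg
  have hlog1 : HasLog fun x : sphere (0 : ℂ) 1 => f x - w := by
    have := HasLog.of_homotopy
      (H := fun p : unitInterval × sphere (0 : ℂ) 1 => f (((p.1 : ℝ) : ℂ) * p.2) - w)
      ((hf.comp_continuous (by fun_prop) fun p => hmem _ _ (hI _)).sub continuous_const)
      (fun p h => hwim ⟨_, hmem _ p.2 (hI p.1), sub_eq_zero.1 h⟩)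
      (by simpa using hasLog_const
            (sub_ne_zero.2 fun h => hwim ⟨0, by simp, h⟩ : f 0 - w ≠ 0))
    simpa using this
  have := HasLog.of_homotopy
    (H := fun p : unitInterval × sphere (0 : ℂ) 1 => f p.2 - (w + ((p.1 : ℝ) : ℂ) * (f 0 - w)))
    (by have := hfs.comp (continuous_snd : Continuous fun p : unitInterval × sphere (0 : ℂ) 1 => p.2)
        exact this.sub (by fun_prop)) ?_ (by simpa using hlog1)
  · simpa using this
  · rintro ⟨t, x⟩ h0
    have h1 : f x - f 0 = (1 - (t : ℂ)) * (w - f 0) := by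
      simp only at h0; linear_combination h0
    have h2 := hδS x
    rw [h1, norm_mul] at h2
    have h3 : ‖(1 - (t : ℂ))‖ ≤ 1 := by
      rw [← Complex.ofReal_one, ← Complex.ofReal_sub, Complex.norm_real, Real.norm_eq_abs]
      exact abs_le.2 ⟨by linarith [t.2.2], by linarith [t.2.1]⟩
    have h4 : ‖w - f 0‖ < δ := by simpa [dist_eq_norm] using hw
    nlinarith [norm_nonneg (w - f 0), norm_nonneg (1 - (t : ℂ))]

/-- Invariance of domain in the complex plane. -/
theorem closedBall_image_mem_nhds {f : ℂ → ℂ} {p : ℂ} {r : ℝ} (hr : 0 < r)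
    (hf : ContinuousOn f (closedBall p r)) (hi : InjOn f (closedBall p r)) :
    f '' closedBall p r ∈ 𝓝 (f p) := by
  have hm : MapsTo (fun z : ℂ => p + r * z) (closedBall 0 1) (closedBall p r) := fun z hz => by
    have : ‖z‖ ≤ 1 := by simpa using hz
    simp [abs_of_pos hr]; nlinarith
  have h := closedBall_image_mem_nhds_unit (f := fun z => f (p + r * z))
    (hf.comp (by fun_prop) hm) (fun z hz w hw h => by
      have := hi (hm hz) (hm hw) h
      have hr' : (r : ℂ) ≠ 0 := by exact_mod_cast hr.ne'
      exact mul_left_cancel₀ hr' (add_left_cancel this))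
  simp only [mul_zero, add_zero] at h
  refine mem_of_superset h ?_
  rintro _ ⟨z, hz, rfl⟩
  exact ⟨_, hm hz, rfl⟩

theorem isOpenMap_of_injective {f : ℂ → ℂ} (hf : Continuous f) (hi : Function.Injective f) :
    IsOpenMap f := by
  rw [isOpenMap_iff_nhds_le]
  intro p s hs
  obtain ⟨r, hr, hrs⟩ := nhds_basis_closedBall.mem_iff.1 (mem_map.1 hs)
  exact mem_of_superset (closedBall_image_mem_nhds hr hf.continuousOn hi.injOn)
    (image_subset_iff.2 hrs)


/-! ### Global triviality of vertical planes -/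

section Trivial
variable {P F : Type*} [TopologicalSpace P] [TopologicalSpace F] {π : P → ℝ}

/-- A supremum argument. Agreement with `e₀` to the left of `a` is carried along so that successive
extensions are compatible and can be assembled into a global trivialization. -/
theorem exists_trivialization_extend_right
    (hloc : ∀ x, ∃ e : Bundle.Trivialization F π, x ∈ e.baseSet)
    {a₀ a : ℝ} (b : ℝ) (haa : a₀ ≤ a) (e₀ : Bundle.Trivialization F π)
    (h₀ : Icc a₀ a ⊆ e₀.baseSet) :
    ∃ e : Bundle.Trivialization F π, Icc a₀ b ⊆ e.baseSet ∧ ∀ p, π p ≤ a → e p = e₀ p := by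
  rcases lt_or_ge b a with hba | hab
  · exact ⟨e₀, (Icc_subset_Icc_right hba.le).trans h₀, fun _ _ => rfl⟩
  set s : Set ℝ := {x ∈ Icc a b | ∃ e : Bundle.Trivialization F π, Icc a₀ x ⊆ e.baseSet ∧
    ∀ p, π p ≤ a → e p = e₀ p}
  have ha : a ∈ s := ⟨left_mem_Icc.2 hab, e₀, h₀, fun _ _ => rfl⟩
  have hsb : b ∈ upperBounds s := fun x hx => hx.1.2
  set c := sSup s
  have hsc : IsLUB s c := isLUB_csSup ⟨a, ha⟩ ⟨b, hsb⟩
  have hc : c ∈ Icc a b := ⟨hsc.1 ha, hsc.2 hsb⟩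
  obtain ⟨ec, hec⟩ := hloc c
  obtain ⟨ε, hε, hεs⟩ := Metric.isOpen_iff.1 ec.open_baseSet c hec
  obtain ⟨d, ⟨hdab, ed, hed, hed'⟩, hd⟩ : ∃ d ∈ s, d ∈ Ioc (c - ε) c :=
    hsc.exists_between (by linarith)
  have hdc : ∀ x, d ≤ x → x < c + ε → x ∈ ec.baseSet := fun x h1 h2 =>
    hεs (by rw [mem_ball, Real.dist_eq, abs_lt]; constructor <;> linarith [hd.1])
  have hmem : ∀ x, x ∈ Icc a b → x < c + ε → x ∈ s := by
    intro x hx hxc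
    -- The old trivialization is kept up to level `d` and continued by the local one around the
    -- supremum `c`. Since `a ≤ d`, nothing changes to the left of `a`.
    refine ⟨hx, ed.piecewiseLe ec d (hed ⟨haa.trans hdab.1, le_rfl⟩)
      (hdc d le_rfl (by linarith [hd.2])),
      subset_ite.2 ⟨fun y hy => hed ⟨hy.1.1, hy.2⟩, fun y hy => ?_⟩, fun p hp => ?_⟩
    · have : d < y := not_le.1 hy.2
      exact hdc y this.le (by linarith [hy.1.2])
    · rw [← hed' p hp]
      exact if_pos (show π p ≤ d from hp.trans hdab.1)
  have hcb : c = b := by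
    by_contra hne
    have hlt : c < b := lt_of_le_of_ne hc.2 hne
    have hm := hmem (min b (c + ε / 2)) ⟨le_min hab (by linarith [hc.1]), min_le_left _ _⟩
      (by have := min_le_right b (c + ε / 2); linarith)
    have := hsc.1 hm
    rcases min_le_iff.1 this with h | h <;> linarith
  obtain ⟨-, e, he, he'⟩ := hmem b ⟨hab, le_rfl⟩ (by linarith)
  exact ⟨e, he, he'⟩

/-- After an extension to the right, a trivialization over the left interval is corrected by the
coordinate change on the fibre over `-r`, so that the two agree there and can be glued. -/
theorem exists_trivialization_extend
    (hloc : ∀ x, ∃ e : Bundle.Trivialization F π, x ∈ e.baseSet)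
    {r r' : ℝ} (hr : 0 ≤ r) (hrr : r ≤ r') (e₀ : Bundle.Trivialization F π)
    (h₀ : Icc (-r) r ⊆ e₀.baseSet) :
    ∃ e : Bundle.Trivialization F π, Icc (-r') r' ⊆ e.baseSet ∧ ∀ p, |π p| ≤ r → e p = e₀ p := by
  obtain ⟨e₁, h₁, h₁'⟩ := exists_trivialization_extend_right hloc r' (by linarith) e₀ h₀
  obtain ⟨e₂, h₂⟩ := hloc (-r')
  obtain ⟨e₃, h₃, -⟩ := exists_trivialization_extend_right (a := -r') hloc (-r) le_rfl e₂
    (by simpa using h₂)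
  have m₁ : -r ∈ e₁.baseSet := h₁ ⟨le_rfl, by linarith⟩
  have m₃ : -r ∈ e₃.baseSet := h₃ ⟨by linarith, le_rfl⟩
  have heq : ∀ p, π p = -r →
      e₃.transFiberHomeomorph (e₃.coordChangeHomeomorph e₁ m₃ m₁) p = e₁ p := by
    intro p hp
    have m₁' : π p ∈ e₁.baseSet := hp ▸ m₁
    have m₃' : π p ∈ e₃.baseSet := hp ▸ m₃
    rw [Bundle.Trivialization.transFiberHomeomorph_apply]
    ext1
    · exact ((e₃.coe_fst (e₃.mem_source.2 m₃')).trans (e₁.coe_fst (e₁.mem_source.2 m₁')).symm)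
    · have := e₃.coordChange_apply_snd e₁ m₃'
      rw [hp] at this
      exact this
  refine ⟨(e₃.transFiberHomeomorph (e₃.coordChangeHomeomorph e₁ m₃ m₁)).piecewiseLeOfEq e₁ (-r)
    m₃ m₁ heq, subset_ite.2 ⟨fun y hy => h₃ ⟨hy.1.1, hy.2⟩, fun y hy => ?_⟩, fun p hp => ?_⟩
  · have : -r < y := not_le.1 hy.2
    exact h₁ ⟨this.le, hy.1.2⟩
  · rw [abs_le] at hp
    rw [← h₁' p hp.2]
    rcases eq_or_lt_of_le hp.1 with h | h
    · exact (if_pos (show π p ≤ -r from h.ge)).trans (heq p h.symm)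
    · exact if_neg (show ¬ π p ≤ -r from not_le.2 h)

/-- Trivializations over the intervals [-n, n], each extending the previous one, have a limit: at
`p` use the one of index `⌈|π p|⌉₊`, or equally any later one. Continuity is then local. -/
theorem exists_homeomorph_prod (hloc : ∀ x, ∃ e : Bundle.Trivialization F π, x ∈ e.baseSet) :
    ∃ Φ : P ≃ₜ ℝ × F, ∀ p, (Φ p).1 = π p := by
  choose ext hext using fun (n : ℕ)
    (e : {e : Bundle.Trivialization F π // Icc (-(n : ℝ)) n ⊆ e.baseSet}) =>
      exists_trivialization_extend hloc (r' := (n + 1 : ℕ)) (Nat.cast_nonneg n)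
        (by push_cast; linarith) e.1 e.2
  obtain ⟨e₀, h₀⟩ := hloc 0
  let T : ∀ n : ℕ, {e : Bundle.Trivialization F π // Icc (-(n : ℝ)) n ⊆ e.baseSet} := fun n =>
    Nat.rec ⟨e₀, by simpa using h₀⟩ (fun n e => ⟨ext n e, (hext n e).1⟩) n
  have hT1 : ∀ (n : ℕ) p, |π p| ≤ n → (T (n + 1)).1 p = (T n).1 p := fun n p hp => (hext n (T n)).2 p hp
  have hT : ∀ (m n : ℕ) p, n ≤ m → |π p| ≤ n → (T m).1 p = (T n).1 p := by
    intro m n p hnm hp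
    induction m, hnm using Nat.le_induction with
    | base => rfl
    | succ m hnm ih =>
      rw [hT1 m p (hp.trans (by exact_mod_cast hnm)), ih]
  have hsrc : ∀ (n : ℕ) p, |π p| ≤ n → p ∈ (T n).1.source := fun n p hp => by
    rw [Bundle.Trivialization.mem_source]; exact (T n).2 (abs_le.1 hp)
  have htgt : ∀ (n : ℕ) (z : ℝ × F), |z.1| ≤ n → z ∈ (T n).1.target := fun n z hz => by
    rw [Bundle.Trivialization.mem_target]; exact (T n).2 (abs_le.1 hz)
  have hceil : ∀ x : ℝ, |x| ≤ (⌈|x|⌉₊ : ℝ) := fun x => Nat.le_ceil _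
  have hfst : ∀ (n : ℕ) p, |π p| ≤ n → ((T n).1 p).1 = π p := fun n p hp =>
    (T n).1.coe_fst (hsrc n p hp)
  have hpi : Continuous π := by
    rw [continuous_iff_continuousAt]
    intro p
    obtain ⟨e, he⟩ := hloc (π p)
    exact e.continuousAt_proj (e.mem_source.2 he)
  let f : P → ℝ × F := fun p => (T ⌈|π p|⌉₊).1 p
  let g : ℝ × F → P := fun z => (T ⌈|z.1|⌉₊).1.toOpenPartialHomeomorph.symm z
  have hf : ∀ (n : ℕ) p, |π p| ≤ n → f p = (T n).1 p := fun n p hp =>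
    (hT n _ p (Nat.ceil_le.2 hp) (hceil _)).symm
  have hgπ : ∀ (n : ℕ) (z : ℝ × F), |z.1| ≤ n →
      π ((T n).1.toOpenPartialHomeomorph.symm z) = z.1 := fun n z hz =>
    (T n).1.proj_symm_apply (htgt n z hz)
  have hg : ∀ (n : ℕ) (z : ℝ × F), |z.1| ≤ n →
      g z = (T n).1.toOpenPartialHomeomorph.symm z := by
    intro n z hz
    have h1 := hgπ _ z (hceil z.1)
    have h2 : (T n).1 (g z) = z := by
      rw [hT n ⌈|z.1|⌉₊ (g z) (Nat.ceil_le.2 hz) (by rw [h1]; exact hceil _)]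
      exact (T _).1.apply_symm_apply (htgt _ z (hceil _))
    have h3 : g z ∈ (T n).1.source := hsrc n _ (by rw [h1]; exact hz)
    exact ((T n).1.toOpenPartialHomeomorph.left_inv h3).symm.trans (congrArg _ h2)
  have hev : ∀ x : ℝ, ∃ n : ℕ, |x| < n := fun x => exists_nat_gt _
  refine ⟨{ toFun := f, invFun := g, left_inv := ?_, right_inv := ?_,
            continuous_toFun := ?_, continuous_invFun := ?_ }, fun p => hfst _ p (hceil _)⟩
  · intro p
    have h1 : (f p).1 = π p := hfst _ p (hceil _)
    rw [hg ⌈|π p|⌉₊ (f p) (by rw [h1]; exact hceil _)]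
    exact (T _).1.toOpenPartialHomeomorph.left_inv (hsrc _ p (hceil _))
  · intro z
    have h1 : π (g z) = z.1 := hgπ _ z (hceil _)
    rw [hf ⌈|z.1|⌉₊ (g z) (by rw [h1]; exact hceil _)]
    exact (T _).1.apply_symm_apply (htgt _ z (hceil _))
  · rw [continuous_iff_continuousAt]
    intro p
    obtain ⟨n, hn⟩ := hev (π p)
    refine ((T n).1.toOpenPartialHomeomorph.continuousAt (hsrc n p hn.le)).congr ?_
    filter_upwards [(hpi.abs.tendsto p).eventually (gt_mem_nhds hn)] with q hq
    exact (hf n q hq.le).symm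
  · rw [continuous_iff_continuousAt]
    intro z
    obtain ⟨n, hn⟩ := hev z.1
    refine ((T n).1.toOpenPartialHomeomorph.continuousAt_symm (htgt n z hn.le)).congr ?_
    filter_upwards [(continuous_fst.abs.tendsto z).eventually (gt_mem_nhds hn)] with q hq
    exact (hg n q hq.le).symm

end Trivial

/-! ### A space whose product with the line is the plane is a line -/

/-- A bounded open interval is carried to the line by an affine map followed by the tangent. The
general case is first made bounded by the arctangent. -/
theorem nonempty_homeomorph_real_of_isOpen {I : Set ℝ} (ho : IsOpen I) (hc : I.OrdConnected)
    (hne : I.Nonempty) : Nonempty (I ≃ₜ ℝ) := by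
  have hbdd : ∀ J : Set ℝ, IsOpen J → J.OrdConnected → J.Nonempty → BddAbove J → BddBelow J →
      Nonempty (J ≃ₜ ℝ) := by
    intro J hJo hJc hJne ha hb
    have hJ : J = Ioo (sInf J) (sSup J) := by
      apply Subset.antisymm
      · intro x hx
        obtain ⟨ε, hε, hεJ⟩ := Metric.isOpen_iff.1 hJo x hx
        have h1 : x - ε / 2 ∈ J := hεJ (by rw [mem_ball, Real.dist_eq, abs_lt]; constructor <;> linarith)
        have h2 : x + ε / 2 ∈ J := hεJ (by rw [mem_ball, Real.dist_eq, abs_lt]; constructor <;> linarith)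
        exact ⟨by linarith [csInf_le hb h1], by linarith [le_csSup ha h2]⟩
      · intro x hx
        obtain ⟨y, hy, hyx⟩ := exists_lt_of_csInf_lt hJne hx.1
        obtain ⟨z, hz, hxz⟩ := exists_lt_of_lt_csSup hJne hx.2
        exact hJc.out hy hz ⟨hyx.le, hxz.le⟩
    have hlt : sInf J < sSup J := by
      obtain ⟨x, hx⟩ := hJne
      rw [hJ] at hx
      exact hx.1.trans hx.2
    rw [hJ]
    set a := sInf J
    set b := sSup J
    have hba : 0 < b - a := sub_pos.2 hlt
    let k := Real.pi / (b - a)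
    have hk : 0 < k := div_pos Real.pi_pos hba
    let A : ℝ ≃ₜ ℝ := affineHomeomorph k (-(Real.pi / 2) - k * a) hk.ne'
    have hA : A '' Ioo a b = Ioo (-(Real.pi / 2)) (Real.pi / 2) := by
      have : k * (b - a) = Real.pi := by simp only [k]; field_simp
      change (fun x => k * x + (-(Real.pi / 2) - k * a)) '' Ioo a b = _
      rw [image_affine_Ioo hk]
      congr 1 <;> linarith
    exact ⟨(A.image _).trans ((Homeomorph.setCongr hA).trans Real.tanOrderIso.toHomeomorph)⟩
  let E := Real.tanOrderIso.toHomeomorph.symm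
  let f : ℝ → ℝ := fun x => (E x : ℝ)
  have hf : Topology.IsOpenEmbedding f := isOpen_Ioo.isOpenEmbedding_subtypeVal.comp E.isOpenEmbedding
  have e : I ≃ₜ f '' I := hf.isEmbedding.homeomorphImage I
  have hsub : f '' I ⊆ Ioo (-(Real.pi / 2)) (Real.pi / 2) := by
    rintro _ ⟨x, -, rfl⟩; exact (E x).2
  obtain ⟨e'⟩ := hbdd (f '' I) (hf.isOpenMap _ ho)
    ((hc.isPreconnected.image f hf.continuous.continuousOn).ordConnected) (hne.image f)
    (bddAbove_Ioo.mono hsub) (bddBelow_Ioo.mono hsub)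
  exact ⟨e.trans e'⟩

section Order

variable {F : Type*} [TopologicalSpace F]

/-- Connectedness makes the order dense, so by Cantor's theorem a countable dense subset is ordered
like the rationals of (0, 1). Dedekind cuts extend this isomorphism to `F`. Only openness of the
rays is used, so the topology may a priori be finer than the order topology. -/
theorem exists_continuous_injective_of_linearOrder [LinearOrder F] [PreconnectedSpace F]
    [TopologicalSpace.SeparableSpace F] (hlt : ∀ a : F, IsOpen (Iio a))
    (hgt : ∀ a : F, IsOpen (Ioi a)) : ∃ h : F → ℝ, Continuous h ∧ Function.Injective h := by
  rcases subsingleton_or_nontrivial F with hF | hF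
  · exact ⟨fun _ => 0, continuous_const, Function.injective_of_subsingleton _⟩
  have hdense : ∀ a b : F, a < b → (Ioo a b).Nonempty := by
    intro a b hab
    by_contra he
    have hcl : IsClopen (Iio b) := by
      refine ⟨⟨?_⟩, hlt b⟩
      convert hgt a using 1
      ext x
      simp only [mem_compl_iff, mem_Iio, not_lt, mem_Ioi]
      exact ⟨fun h => hab.trans_le h, fun h => not_lt.1 fun h' => he ⟨x, h, h'⟩⟩
    rcases isClopen_iff.1 hcl with h | h
    · exact (h ▸ (show a ∈ Iio b from hab) : a ∈ (∅ : Set F))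
    · exact lt_irrefl b (h ▸ mem_univ b : b ∈ Iio b)
  obtain ⟨S, hSc, hSd⟩ := TopologicalSpace.exists_countable_dense F
  have hS : ∀ a b : F, a < b → ∃ x ∈ S, a < x ∧ x < b := fun a b hab => by
    obtain ⟨x, hx, hxS⟩ := hSd.inter_open_nonempty _ ((hgt a).inter (hlt b)) (hdense a b hab)
    exact ⟨x, hxS, hx⟩
  -- Possible extremities of `F` are discarded, since Cantor's theorem needs an order without end
  -- points.
  let Q := {x : F // x ∈ S ∧ (∃ y, y < x) ∧ ∃ y, x < y}
  have hQ : ∀ a b : F, a < b → ∃ x : Q, a < x.1 ∧ x.1 < b := fun a b hab => by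
    obtain ⟨x, hx, h1, h2⟩ := hS a b hab
    exact ⟨⟨x, hx, ⟨a, h1⟩, ⟨b, h2⟩⟩, h1, h2⟩
  have : Countable Q := (hSc.mono (s₁ := {x : F | x ∈ S ∧ (∃ y, y < x) ∧ ∃ y, x < y}) fun x hx => hx.1).to_subtype
  have : DenselyOrdered Q := ⟨fun a b hab => hQ a.1 b.1 hab⟩
  have : NoMinOrder Q := ⟨fun a => by
    obtain ⟨y, hy⟩ := a.2.2.1
    obtain ⟨x, -, hx⟩ := hQ y a.1 hy
    exact ⟨x, hx⟩⟩
  have : NoMaxOrder Q := ⟨fun a => by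
    obtain ⟨y, hy⟩ := a.2.2.2
    obtain ⟨x, hx, -⟩ := hQ a.1 y hy
    exact ⟨x, hx⟩⟩
  have : Nonempty Q := by
    obtain ⟨a, b, hab⟩ := exists_pair_lt F
    exact (hQ a b hab).nonempty
  have : Nonempty (Ioo (0 : ℚ) 1) := ⟨⟨1 / 2, by norm_num, by norm_num⟩⟩
  obtain ⟨j⟩ := Order.iso_of_countable_dense Q (Ioo (0 : ℚ) 1)
  let J : Q → ℝ := fun q => ((j q : ℚ) : ℝ)
  have hJ : ∀ {p q}, p < q → J p < J q := fun h => by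
    have : ((j _ : ℚ)) < (j _ : ℚ) := j.lt_iff_lt.2 h
    exact Rat.cast_lt.2 this
  have hJ0 : ∀ q, 0 < J q := fun q => by exact Rat.cast_pos.2 (j q).2.1
  have hJ1 : ∀ q, J q < 1 := fun q => by 
    show ((j q : ℚ) : ℝ) < 1
    exact_mod_cast (j q).2.2
  have hJs : ∀ a b : ℝ, 0 ≤ a → b ≤ 1 → a < b → ∃ q, a < J q ∧ J q < b := by
    intro a b ha hb hab
    obtain ⟨r, h1, h2⟩ := exists_rat_btwn hab
    have hr : r ∈ Ioo (0 : ℚ) 1 := ⟨by exact_mod_cast ha.trans_lt h1, by exact_mod_cast h2.trans_le hb⟩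
    refine ⟨j.symm ⟨r, hr⟩, ?_⟩
    simpa [J] using ⟨h1, h2⟩
  -- The value 0 keeps the set nonempty when `c` is a least element of `F`.
  let h : F → ℝ := fun c => sSup (insert 0 (J '' {q | q.1 ≤ c}))
  have hbdd : ∀ c, BddAbove (insert 0 (J '' {q : Q | q.1 ≤ c})) := fun c => by
    refine ⟨1, ?_⟩
    rintro _ (rfl | ⟨q, -, rfl⟩)
    exacts [zero_le_one, (hJ1 q).le]
  have h_le : ∀ c (q : Q), q.1 ≤ c → J q ≤ h c := fun c q hq =>
    le_csSup (hbdd c) (mem_insert_of_mem _ ⟨q, hq, rfl⟩)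
  have hle : ∀ c (q : Q), c ≤ q.1 → h c ≤ J q := fun c q hq => by
    refine csSup_le (insert_nonempty _ _) ?_
    rintro _ (rfl | ⟨p, hp, rfl⟩)
    · exact (hJ0 q).le
    · rcases eq_or_lt_of_le (show p ≤ q from (show p.1 ≤ c from hp).trans hq) with rfl | hpq
      · exact le_rfl
      · exact (hJ hpq).le
  have h0 : ∀ c, 0 ≤ h c := fun c => le_csSup (hbdd c) (mem_insert _ _)
  have h1 : ∀ c, h c ≤ 1 := fun c => by
    refine csSup_le (insert_nonempty _ _) ?_
    rintro _ (rfl | ⟨p, hp, rfl⟩)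
    exacts [zero_le_one, (hJ1 p).le]
  have hmono : StrictMono h := fun a b hab => by
    obtain ⟨p, hap, hpb⟩ := hQ a b hab
    obtain ⟨q, hpq, hqb⟩ := hQ p.1 b hpb
    exact ((hle a p hap.le).trans_lt (hJ hpq)).trans_le (h_le b q hqb.le)
  refine ⟨h, ?_, hmono.injective⟩
  rw [continuous_iff_continuousAt]
  intro c
  refine tendsto_order.2 ⟨fun r hr => ?_, fun r hr => ?_⟩
  · rcases lt_or_ge r 0 with hr0 | hr0
    · exact Eventually.of_forall fun x => hr0.trans_le (h0 x)
    · obtain ⟨q, h2, h3⟩ := hJs r (h c) hr0 (h1 c) hr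
      have hqc : q.1 < c := lt_of_not_ge fun hcq => (hle c q hcq).not_gt h3
      filter_upwards [(hgt q.1).mem_nhds hqc] with x hx
      exact h2.trans_le (h_le x q (le_of_lt hx))
  · rcases lt_or_ge 1 r with hr0 | hr0
    · exact Eventually.of_forall fun x => (h1 x).trans_lt hr0
    · obtain ⟨q, h2, h3⟩ := hJs (h c) r (h0 c) hr0 hr
      have hqc : c < q.1 := lt_of_not_ge fun hcq => (h_le c q hcq).not_gt h2
      filter_upwards [(hlt q.1).mem_nhds hqc] with x hx
      exact (hle x q (le_of_lt hx)).trans_lt h3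

/-- A continuous sign that is antisymmetric off the diagonal of a connected space orders it. -/
theorem exists_linearOrder_of_antisymm [T1Space F] [PreconnectedSpace F] {w : {p : F × F // p.1 ≠ p.2} → ℝ}
    (hw : Continuous w) (h0 : ∀ p, w p ≠ 0)
    (ha : ∀ (a b : F) (h : a ≠ b), w ⟨(b, a), h.symm⟩ = -w ⟨(a, b), h⟩) :
    ∃ _ : LinearOrder F, (∀ a : F, IsOpen (Iio a)) ∧ ∀ a : F, IsOpen (Ioi a) := by
  classical
  let r : F → F → Prop := fun a b => ∃ h : a ≠ b, 0 < w ⟨(a, b), h⟩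
  have htri : ∀ a b, a ≠ b → r a b ∨ r b a := fun a b h => by
    rcases lt_or_gt_of_ne (h0 ⟨(a, b), h⟩) with h' | h'
    · exact Or.inr ⟨h.symm, by rw [ha a b h]; linarith⟩
    · exact Or.inl ⟨h, h'⟩
  have hasy : ∀ a b, r a b → ¬ r b a := by
    rintro a b ⟨h, h'⟩ ⟨k, k'⟩
    rw [ha a b h] at k'
    linarith
  have hopen : ∀ a (U : Set ℝ), IsOpen U → IsOpen {b | ∃ h : a ≠ b, w ⟨(a, b), h⟩ ∈ U} := by
    intro a U hU
    have hc : Continuous fun b : {b // a ≠ b} => w ⟨(a, b.1), b.2⟩ :=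
      hw.comp (Continuous.subtype_mk (by fun_prop) _)
    have ho : IsOpen {b | a ≠ b} := by
      simpa [compl_def, eq_comm] using (isClosed_singleton (x := a)).isOpen_compl
    convert ho.isOpenMap_subtype_val _ (hU.preimage hc) using 1
    ext b
    simp
  have hR : ∀ a, IsOpen {b | r a b} := fun a => hopen a (Ioi 0) isOpen_Ioi
  have hL : ∀ a, IsOpen {b | r b a} := fun a => by
    convert hopen a (Iio 0) isOpen_Iio using 1
    ext b
    constructor
    · rintro ⟨h, h'⟩
      exact ⟨h.symm, by rw [mem_Iio, ha b a h]; linarith⟩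
    · rintro ⟨h, h'⟩
      exact ⟨h.symm, by rw [ha a b h]; linarith [mem_Iio.1 h']⟩
  have htrans : ∀ a b c, r a b → r b c → r a c := by
    intro a b c hab hbc
    -- Transitivity: `g` retracts `F` onto the points above `b`. It is continuous because that set
    -- has no frontier point other than `b`, and it never takes the value `a`. So `w (a, g x)` keeps
    -- a constant sign on the connected space `F`, in particular between `x = b` and `x = c`.
    let g : F → F := fun x => if r b x then x else b
    have hg : Continuous g := by
      refine Continuous.if (fun x hx => ?_) continuous_id continuous_const
      by_contra hxb
      have hx1 : ¬ r b x := by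
        have := (hR b).frontier_eq ▸ hx
        exact this.2
      have hx2 : r x b := (htri b x (Ne.symm hxb)).resolve_left hx1
      obtain ⟨y, hy1, hy2⟩ := mem_closure_iff.1 (frontier_subset_closure hx) _ (hL b) hx2
      exact hasy _ _ hy1 hy2
    have hga : ∀ x, a ≠ g x := by
      intro x hx
      by_cases h : r b x
      · simp only [g, h, if_true] at hx
        exact hasy _ _ hab (hx ▸ h)
      · simp only [g, h, if_false] at hx
        exact hab.1 hx
    have hc : Continuous fun x => w ⟨(a, g x), hga x⟩ :=
      hw.comp (Continuous.subtype_mk (by fun_prop) _)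
    have hgb : g b = b := by simp [g]
    have hgc : g c = c := by simp [g, hbc]
    have hac : a ≠ c := fun h => hasy _ _ hab (h ▸ hbc)
    refine ⟨hac, ?_⟩
    by_contra hneg
    have h1 : w ⟨(a, g c), hga c⟩ ≤ 0 := by simpa only [hgc] using not_lt.1 hneg
    have h2 : 0 ≤ w ⟨(a, g b), hga b⟩ := by simpa only [hgb] using hab.2.le
    obtain ⟨x, hx⟩ := intermediate_value_univ c b hc ⟨h1, h2⟩
    exact h0 _ hx
  have : IsStrictTotalOrder F r :=
    { trichotomous := fun a b h1 h2 => by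
        by_contra h
        rcases htri a b h with h' | h'
        exacts [h1 h', h2 h']
      irrefl := fun a h => h.1 rfl
      trans := htrans }
  exact ⟨linearOrderOfSTO r, hL, hR⟩

end Order

/-- Disjoint horizontal lines in the plane are naturally ordered, one being above the other. The
order is read off from a logarithm of the vector joining a point of the first to a point of the
second: exchanging the points turns the vector by an odd multiple of π, whose sign is `w`. -/
theorem exists_antisymm_of_homeomorph {F : Type*} [TopologicalSpace F] (Φ : ℝ × F ≃ₜ ℂ) :
    ∃ w : {p : F × F // p.1 ≠ p.2} → ℝ, Continuous w ∧ (∀ p, w p ≠ 0) ∧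
      ∀ (a b : F) (h : a ≠ b), w ⟨(b, a), h.symm⟩ = -w ⟨(a, b), h⟩ := by
  -- Pairs on distinct lines, or on one line with the second point to the right. Sliding the second
  -- point to the right stays in this set and ends in the image of `κ`, where the joining vector is
  -- defined for all pairs, that is, on a copy of the contractible space ℂ × ℂ.
  let Ω : Set ((ℝ × F) × (ℝ × F)) := {q | q.1.2 ≠ q.2.2 ∨ q.1.1 < q.2.1}
  let Z : (ℝ × F) × (ℝ × F) → ℂ := fun q => Φ q.2 - Φ q.1
  have hZ : Continuous Z := by fun_prop
  have hZ0 : ∀ q, q.1 ≠ q.2 → Z q ≠ 0 := fun q hq h =>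
    hq (Φ.injective (sub_eq_zero.1 h)).symm
  let κ : (ℝ × F) × (ℝ × F) → (ℝ × F) × (ℝ × F) :=
    fun q => (q.1, (q.1.1 + |q.2.1 - q.1.1| + 1, q.2.2))
  have hκ : Continuous κ := by fun_prop
  have hlogκ : HasLog (Z ∘ κ) := by
    let Ψ := Φ.prodCongr Φ
    have h1 : HasLog (Z ∘ κ ∘ Ψ.symm) :=
      hasLog_of_module (by fun_prop) fun z => hZ0 _ fun h => by
        have := congrArg Prod.fst h
        simp only [κ, Function.comp] at this
        linarith [abs_nonneg ((Ψ.symm z).2.1 - (Ψ.symm z).1.1)]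
    have := h1.comp (u := Ψ) Ψ.continuous
    convert this using 1
    ext q
    simp
  have hlog : HasLog fun q : Ω => Z q.1 := by
    have := HasLog.of_homotopy (A := Ω) (H := fun p : unitInterval × Ω => Z (p.2.1.1,
        ((1 - (p.1 : ℝ)) * (p.2.1.1.1 + |p.2.1.2.1 - p.2.1.1.1| + 1) + p.1 * p.2.1.2.1,
          p.2.1.2.2))) (hZ.comp (by fun_prop)) ?_ ?_
    · simpa using this
    · rintro ⟨t, ⟨q, hq⟩⟩
      apply hZ0
      intro h
      rcases hq with hq | hq
      · have h1 := congrArg Prod.snd h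
        exact hq h1
      · have h1 := congrArg Prod.fst h
        simp only at h1
        rw [abs_of_pos (by linarith)] at h1
        nlinarith [t.2.1, t.2.2]
    · have := hlogκ.comp (u := fun q : Ω => q.1) continuous_subtype_val
      simpa [κ, Function.comp_def] using this
  obtain ⟨l, hl, hlZ⟩ := hlog
  let i : {p : F × F // p.1 ≠ p.2} → Ω := fun p => ⟨((0, p.1.1), (0, p.1.2)), Or.inl p.2⟩
  let i' : {p : F × F // p.1 ≠ p.2} → Ω := fun p => ⟨((0, p.1.2), (0, p.1.1)), Or.inl p.2.symm⟩
  have hi : Continuous i := Continuous.subtype_mk (by fun_prop) _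
  have hi' : Continuous i' := Continuous.subtype_mk (by fun_prop) _
  refine ⟨fun p => (l (i p) - l (i' p)).im, by fun_prop, fun p h => ?_, fun a b h => ?_⟩
  · have h1 : Complex.exp (l (i p) - l (i' p)) = -1 := by
      have h2 : Z (i' p).1 ≠ 0 := hZ0 _ fun h => p.2 (congrArg Prod.snd h).symm
      rw [Complex.exp_sub, hlZ, hlZ, div_eq_iff h2]
      simp only [Z, i, i']
      ring
    have h2 := congrArg Complex.re h1
    simp only at h
    rw [Complex.exp_re, h, Real.cos_zero] at h2
    have := Real.exp_pos (l (i p) - l (i' p)).re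
    have h3 : (-1 : ℂ).re = -1 := by simp
    rw [mul_one, h3] at h2
    linarith
  · simp only [i, i', Complex.sub_im]
    ring

/-- The order gives a continuous injection `h` of `F` into the line. The product of `h` with the
identity is an injection of the plane into itself, hence open by invariance of domain. Therefore `h`
is open, and `F` is an open interval. -/
theorem nonempty_homeomorph_real_of_prod {F : Type*} [TopologicalSpace F] (Φ : ℝ × F ≃ₜ ℂ) :
    Nonempty (F ≃ₜ ℝ) := by
  have hι : IsEmbedding fun f : F => Φ (0, f) :=
    Φ.isEmbedding.comp (isEmbedding_prodMkRight 0)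
  have : T2Space F := hι.t2Space
  have hρ : Function.Surjective fun z : ℂ => (Φ.symm z).2 := fun f => ⟨Φ (0, f), by simp⟩
  have hρc : Continuous fun z : ℂ => (Φ.symm z).2 := by fun_prop
  have : PreconnectedSpace F := hρ.denseRange.preconnectedSpace hρc
  have : TopologicalSpace.SeparableSpace F := hρ.denseRange.separableSpace hρc
  obtain ⟨w, hw, h0, ha⟩ := exists_antisymm_of_homeomorph Φ
  obtain ⟨_, hlt, hgt⟩ := exists_linearOrder_of_antisymm hw h0 ha
  obtain ⟨h, hc, hi⟩ := exists_continuous_injective_of_linearOrder hlt hgt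
  let E : ℝ × ℝ ≃ₜ ℂ := Complex.equivRealProdCLM.symm.toHomeomorph
  let f : ℂ → ℂ := fun z => E ((Φ.symm z).1, h (Φ.symm z).2)
  have hf : IsOpenMap f := by
    refine isOpenMap_of_injective (by fun_prop) fun z w hzw => ?_
    have h1 := E.injective hzw
    rw [Prod.mk.injEq] at h1
    exact Φ.symm.injective (Prod.ext h1.1 (hi h1.2))
  have hopen : IsOpenMap h := by
    intro U hU
    have h1 : IsOpen ((fun z : ℂ => (Φ.symm z).2) ⁻¹' U) := hU.preimage hρc
    have h2 := (E.symm.isOpenMap _ (hf _ h1)).preimage (Continuous.prodMk_right (0 : ℝ))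
    convert h2 using 1
    ext y
    constructor
    · rintro ⟨u, hu, rfl⟩
      exact ⟨_, ⟨Φ (0, u), by simpa using hu, rfl⟩, by simp [f]⟩
    · rintro ⟨_, ⟨z, hz, rfl⟩, hy⟩
      simp only [f, Homeomorph.symm_apply_apply, Prod.mk.injEq] at hy
      exact ⟨_, hz, hy.2⟩
  obtain ⟨e⟩ := nonempty_homeomorph_real_of_isOpen hopen.isOpen_range
    (isPreconnected_range hc).ordConnected (by
      obtain ⟨f⟩ : Nonempty F := ⟨(Φ.symm 0).2⟩
      exact ⟨_, mem_range_self f⟩)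
  exact ⟨((IsOpenEmbedding.of_continuous_injective_isOpenMap hc hi hopen).isEmbedding.toHomeomorph).trans e⟩

theorem IsVerticalPlane.exists_homeomorph {P : Type*} [TopologicalSpace P] {π : P → ℝ}
    (h : IsVerticalPlane π) : ∃ Ψ : P ≃ₜ ℝ × ℝ, ∀ p, (Ψ p).1 = π p := by
  obtain ⟨⟨A⟩, F, _, hF⟩ := h
  obtain ⟨Φ, hΦ⟩ := exists_homeomorph_prod hF
  obtain ⟨e⟩ := nonempty_homeomorph_real_of_prod
    (Φ.symm.trans (A.trans Complex.equivRealProdCLM.symm.toHomeomorph))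
  exact ⟨Φ.trans ((Homeomorph.refl ℝ).prodCongr e), hΦ⟩


/-! ### The boundary of a surface in the plane -/

section Surface

variable {P : Type*} [TopologicalSpace P] {D : Set P}

/-- The point of the half-plane with coordinates `max x 0` and `y`. -/
noncomputable def halfPoint (x y : ℝ) : EuclideanHalfSpace 2 :=
  ⟨!₂[max x 0, y], by simp⟩

theorem continuous_halfPoint : Continuous fun z : ℝ × ℝ => halfPoint z.1 z.2 := by
  refine Continuous.subtype_mk ?_ _
  refine (PiLp.continuous_toLp 2 _).comp (continuous_pi fun i => ?_)
  fin_cases i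
  · exact continuous_fst.max continuous_const
  · exact continuous_snd

theorem halfPoint_eq (x : EuclideanHalfSpace 2) : halfPoint (x.1 0) (x.1 1) = x := by
  apply Subtype.ext
  ext i
  have := x.2
  fin_cases i <;> simp [halfPoint, this]

theorem halfPoint_eq_of_zero {x : EuclideanHalfSpace 2} (h : x.1 0 = 0) :
    halfPoint 0 (x.1 1) = x :=
  (congrArg (halfPoint · (x.1 1)) h.symm).trans (halfPoint_eq x)

@[simp] theorem halfPoint_zero (x y : ℝ) : (halfPoint x y).1 0 = max x 0 := by simp [halfPoint]
@[simp] theorem halfPoint_one (x y : ℝ) : (halfPoint x y).1 1 = y := by simp [halfPoint]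

theorem continuous_coord (i : Fin 2) : Continuous fun x : EuclideanHalfSpace 2 => x.1 i := by
  fun_prop

/-- The inverse chart embeds a small disc of the open half-plane, and by invariance of domain its
image is a neighbourhood in the ambient plane. -/
theorem mem_nhds_of_chart_pos (A : P ≃ₜ ℂ) (e : OpenPartialHomeomorph D (EuclideanHalfSpace 2))
    {p : D} (hp : p ∈ e.source) (h0 : 0 < (e p).1 0) : D ∈ 𝓝 (p : P) := by
  let i : ℂ → EuclideanHalfSpace 2 := fun z => halfPoint z.re z.im
  have hi : Continuous i := continuous_halfPoint.comp (by fun_prop : Continuous fun z : ℂ => (z.re, z.im))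
  let z₀ : ℂ := ⟨(e p).1 0, (e p).1 1⟩
  have hz₀ : i z₀ = e p := halfPoint_eq _
  have hV : i ⁻¹' e.target ∩ {z : ℂ | 0 < z.re} ∈ 𝓝 z₀ := by
    refine IsOpen.mem_nhds ((e.open_target.preimage hi).inter
      (isOpen_lt continuous_const Complex.continuous_re)) ⟨?_, h0⟩
    rw [mem_preimage, hz₀]
    exact e.map_source hp
  obtain ⟨r, hr, hrV⟩ := nhds_basis_closedBall.mem_iff.1 hV
  let f : ℂ → ℂ := fun z => A (e.symm (i z) : D)
  have hf : ContinuousOn f (closedBall z₀ r) := by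
    refine A.continuous.comp_continuousOn (continuous_subtype_val.comp_continuousOn ?_)
    exact e.continuousOn_symm.comp hi.continuousOn fun z hz => (hrV hz).1
  have hfi : InjOn f (closedBall z₀ r) := by
    intro z hz w hw h
    have h1 := e.symm.injOn (hrV hz).1 (hrV hw).1 (Subtype.ext (A.injective h))
    have h2 := congrArg (fun x => x.1 0) h1
    have h3 := congrArg (fun x => x.1 1) h1
    have h4 : 0 < z.re := (hrV hz).2
    have h5 : 0 < w.re := (hrV hw).2
    simp only [i, halfPoint_zero, halfPoint_one, max_eq_left h4.le, max_eq_left h5.le] at h2 h3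
    exact Complex.ext h2 h3
  have h := closedBall_image_mem_nhds hr hf hfi
  have h1 : f z₀ = A p := by simp only [f, hz₀, e.left_inv hp]
  rw [h1] at h
  refine mem_of_superset (A.continuous.continuousAt.preimage_mem_nhds h) ?_
  rintro q ⟨z, -, hz⟩
  rw [← A.injective hz]
  exact Subtype.coe_prop _

/-- Were `D` a neighbourhood of `p`, a small circle around `p` would lie in the chart. A half-disc
minus a point of its diameter is star-shaped about an inner point, so the circle would contract in
`D` minus `p`. The odd function `u ↦ r u` would then have a logarithm. -/
theorem notMem_nhds_of_chart_zero (A : P ≃ₜ ℂ)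
    (e : OpenPartialHomeomorph D (EuclideanHalfSpace 2)) {p : D} (hp : p ∈ e.source)
    (h0 : (e p).1 0 = 0) : D ∉ 𝓝 (p : P) := by
  intro hD
  set x := e p with hx
  obtain ⟨O, hO, hOe⟩ := isOpen_induced_iff.1 e.open_target
  obtain ⟨ρ, hρ, hρO⟩ := Metric.isOpen_iff.1 hO x.1
    (show x ∈ Subtype.val ⁻¹' O from hOe ▸ e.map_source hp)
  set B : Set (EuclideanHalfSpace 2) := Subtype.val ⁻¹' ball x.1 ρ with hB
  have hρt : B ⊆ e.target := hOe ▸ preimage_mono hρO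
  have hBn : B ∈ 𝓝 x := continuous_subtype_val.continuousAt.preimage_mem_nhds (ball_mem_nhds _ hρ)
  have hnhds : {q : P | ∃ h : q ∈ D, (⟨q, h⟩ : D) ∈ e.source ∧ e ⟨q, h⟩ ∈ B} ∈ 𝓝 (p : P) := by
    have h1 : e.source ∩ e ⁻¹' B ∈ 𝓝 p :=
      inter_mem (e.open_source.mem_nhds hp)
        ((e.continuousAt hp).preimage_mem_nhds hBn)
    rw [nhds_subtype_eq_comap, mem_comap] at h1
    obtain ⟨t, ht, hts⟩ := h1
    filter_upwards [hD, ht] with q hq hqt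
    exact ⟨hq, hts (show (⟨q, hq⟩ : D) ∈ Subtype.val ⁻¹' t from hqt)⟩
  have hA : A.symm ⁻¹' {q : P | ∃ h : q ∈ D, (⟨q, h⟩ : D) ∈ e.source ∧ e ⟨q, h⟩ ∈ B} ∈
      𝓝 (A p) := by
    refine A.symm.continuous.continuousAt.preimage_mem_nhds ?_
    simpa using hnhds
  obtain ⟨r, hr, hrA⟩ := nhds_basis_closedBall.mem_iff.1 hA
  have hS : ∀ u : sphere (0 : ℂ) 1, A p + r * (u : ℂ) ∈ closedBall (A p : ℂ) r := fun u => by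
    simp [abs_of_pos hr]
  have hS0 : ∀ u : sphere (0 : ℂ) 1, (u : ℂ) ≠ 0 := fun u => by
    have : ‖(u : ℂ)‖ = 1 := by simp
    exact norm_ne_zero_iff.1 (by rw [this]; norm_num)
  choose hw hws hwb using fun u : sphere (0 : ℂ) 1 => hrA (hS u)
  let w : sphere (0 : ℂ) 1 → D := fun u => ⟨A.symm (A p + r * (u : ℂ)), hw u⟩
  have hwc : Continuous w := Continuous.subtype_mk (by fun_prop) _
  have hew : Continuous fun u => e (w u) := e.continuousOn.comp_continuous hwc hws
  have hexw : ∀ u, e (w u) ≠ x := fun u h => by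
    have h1 := congrArg Subtype.val (e.injOn (hws u) hp h)
    have h2 : A p + r * (u : ℂ) = A p := (A.apply_symm_apply _).symm.trans (congrArg A h1)
    have h3 : (r : ℂ) * u = 0 := by linear_combination h2
    rcases mul_eq_zero.1 h3 with h | h
    · exact hr.ne' (by exact_mod_cast h)
    · exact hS0 u h
  -- The centre of the contraction, at height `ρ / 2` above the boundary point `x`. A segment from
  -- `x'` reaches the boundary line only at its other end, so it avoids `x` unless it ends there.
  let x' : EuclideanHalfSpace 2 := halfPoint (ρ / 2) (x.1 1)
  have hx'0 : x'.1 0 = ρ / 2 := by simp [x', (half_pos hρ).le]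
  have hx' : x' ∈ B := by
    have : dist x'.1 x.1 = ρ / 2 := by
      rw [EuclideanSpace.dist_eq]
      simp [hx'0, h0, Fin.sum_univ_two, x', (half_pos hρ).le, Real.dist_eq]
    rw [hB, mem_preimage, mem_ball, this]; linarith
  let c : unitInterval × sphere (0 : ℂ) 1 → EuclideanHalfSpace 2 := fun q =>
    ⟨(q.1 : ℝ) • (e (w q.2)).1 + (1 - (q.1 : ℝ)) • x'.1, by
      have h1 := (e (w q.2)).2
      have h2 := x'.2
      have h3 := q.1.2.1
      have h4 := q.1.2.2
      simp only [PiLp.add_apply, PiLp.smul_apply, smul_eq_mul]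
      exact add_nonneg (mul_nonneg h3 h1) (mul_nonneg (by linarith) h2)⟩
  have hc : Continuous c := by
    refine Continuous.subtype_mk ?_ _
    have : Continuous fun q : unitInterval × sphere (0 : ℂ) 1 => (e (w q.2)).1 :=
      continuous_subtype_val.comp (hew.comp continuous_snd)
    fun_prop
  have hcb : ∀ q, c q ∈ e.target := fun q => hρt <| by
    have h1 := (convex_ball x.1 ρ) (show (e (w q.2)).1 ∈ ball x.1 ρ from hwb q.2)
      (show x'.1 ∈ ball x.1 ρ from hx') q.1.2.1 (by linarith [q.1.2.2] : 0 ≤ 1 - (q.1 : ℝ)) (by ring)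
    exact h1
  have hcx : ∀ q, c q ≠ x := fun q h => by
    have h1 := congrArg (fun y => y.1 0) h
    simp only [c, PiLp.add_apply, PiLp.smul_apply, smul_eq_mul, hx'0, h0] at h1
    have h2 : 0 ≤ (q.1 : ℝ) * (e (w q.2)).1 0 := mul_nonneg q.1.2.1 (e (w q.2)).2
    have h3 : (1 - (q.1 : ℝ)) * (ρ / 2) = 0 :=
      le_antisymm (by linarith) (mul_nonneg (by linarith [q.1.2.2]) (by positivity))
    have h4 : (q.1 : ℝ) = 1 := by
      rcases mul_eq_zero.1 h3 with h | h <;> linarith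
    apply hexw q.2
    apply Subtype.ext
    have h5 := congrArg Subtype.val h
    simpa [c, h4] using h5
  have hlog := HasLog.of_homotopy (H := fun q => A (e.symm (c q) : D) - A p)
    ((A.continuous.comp (continuous_subtype_val.comp
      (e.continuousOn_symm.comp_continuous hc hcb))).sub continuous_const)
    (fun q h => by
      have h1 := Subtype.ext (A.injective (sub_eq_zero.1 h))
      apply hcx q
      rw [← e.right_inv (hcb q), h1])
    (by
      have h1 : ∀ u, c (0, u) = x' := fun u => Subtype.ext (by simp [c])
      simp only [h1]
      refine hasLog_const fun h => ?_
      have h2 := Subtype.ext (A.injective (sub_eq_zero.1 h))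
      apply hcx (0, ⟨1, by simp⟩)
      rw [h1, ← e.right_inv (hρt hx'), h2])
  refine not_hasLog_of_odd (fun u => ?_) hlog
  have h1 : ∀ u, c (1, u) = e (w u) := fun u => Subtype.ext (by simp [c])
  have h2 : ∀ u, A (e.symm (c (1, u)) : D) - A p = r * u := fun u => by
    have h3 : e.symm (c (1, u)) = w u := (congrArg e.symm (h1 u)).trans (e.left_inv (hws u))
    rw [h3]
    simp [w]
  rw [h2, h2]
  simp

theorem surfaceBoundary_eq_frontier (A : P ≃ₜ ℂ) (hc : IsClosed D) (hD : IsSurface D) :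
    surfaceBoundary D = frontier D := by
  ext p
  rw [hc.frontier_eq]
  constructor
  · rintro ⟨hp, e, he, h0⟩
    exact ⟨hp, fun h => notMem_nhds_of_chart_zero A e he h0 (mem_interior_iff_mem_nhds.1 h)⟩
  · rintro ⟨hp, h⟩
    obtain ⟨e, he⟩ := hD ⟨p, hp⟩
    refine ⟨hp, e, he, ?_⟩
    rcases (e ⟨p, hp⟩).2.eq_or_lt with h0 | h0
    · exact h0.symm
    · exact absurd (mem_interior_iff_mem_nhds.2 (mem_nhds_of_chart_pos A e he h0)) h

/-- In a chart, any point is a limit of points pushed off the boundary line, which are interior by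
invariance of domain. -/
theorem subset_closure_interior (A : P ≃ₜ ℂ) (hD : IsSurface D) : D ⊆ closure (interior D) := by
  intro p hp
  obtain ⟨e, he⟩ := hD ⟨p, hp⟩
  set x := e ⟨p, hp⟩ with hx
  let c : ℝ → EuclideanHalfSpace 2 := fun t => halfPoint (x.1 0 + t) (x.1 1)
  have hc : Continuous c :=
    continuous_halfPoint.comp (by fun_prop : Continuous fun t : ℝ => (x.1 0 + t, x.1 1))
  have hc0 : c 0 = x := by simp only [c, add_zero, halfPoint_eq]
  have ht : ∀ᶠ t in 𝓝 (0 : ℝ), c t ∈ e.target :=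
    hc.continuousAt.preimage_mem_nhds (e.open_target.mem_nhds (by rw [hc0]; exact e.map_source he))
  have hlim : Tendsto (fun t => (e.symm (c t) : P)) (𝓝[>] (0 : ℝ)) (𝓝 p) := by
    have h1 : ContinuousAt (fun t => (e.symm (c t) : P)) 0 := by
      refine continuous_subtype_val.continuousAt.comp ?_
      refine ContinuousAt.comp (g := e.symm) ?_ hc.continuousAt
      exact e.continuousAt_symm (by rw [hc0]; exact e.map_source he)
    have h2 : (e.symm (c 0) : P) = p := by rw [hc0, hx, e.left_inv he]
    have := h1.tendsto
    rw [h2] at this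
    exact this.mono_left nhdsWithin_le_nhds
  refine mem_closure_of_tendsto hlim ?_
  filter_upwards [nhdsWithin_le_nhds ht, self_mem_nhdsWithin] with t htt ht0
  refine mem_interior_iff_mem_nhds.2 (mem_nhds_of_chart_pos A e (e.map_target htt) ?_)
  rw [e.right_inv htt]
  simp only [c, halfPoint_zero]
  exact lt_max_of_lt_left (add_pos_of_nonneg_of_pos x.2 ht0)

/-- `C` is near each of its points an open arc. -/
def IsLocallyArc (C : Set P) : Prop :=
  ∀ p ∈ C, ∃ (r : ℝ) (γ : ℝ → P), 0 < r ∧ γ 0 = p ∧ ContinuousOn γ (Ioo (-r) r) ∧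
    InjOn γ (Ioo (-r) r) ∧ ∀ V ⊆ Ioo (-r) r, IsOpen V → ∃ O, IsOpen O ∧ γ '' V = C ∩ O

/-- The arc is the boundary line of a chart. It fills the frontier nearby because being a boundary
point does not depend on the chart. -/
theorem isLocallyArc_frontier (A : P ≃ₜ ℂ) (hc : IsClosed D) (hD : IsSurface D) :
    IsLocallyArc (frontier D) := by
  rw [← surfaceBoundary_eq_frontier A hc hD]
  rintro p ⟨hp, e, he, h0⟩
  set x := e ⟨p, hp⟩ with hx
  let c : ℝ → EuclideanHalfSpace 2 := fun t => halfPoint 0 (x.1 1 + t)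
  have hcc : Continuous c :=
    continuous_halfPoint.comp (by fun_prop : Continuous fun t : ℝ => ((0 : ℝ), x.1 1 + t))
  have hc0 : c 0 = x := by simp only [c, add_zero]; exact halfPoint_eq_of_zero h0
  have ht : c ⁻¹' e.target ∈ 𝓝 (0 : ℝ) :=
    hcc.continuousAt.preimage_mem_nhds (e.open_target.mem_nhds (by rw [hc0]; exact e.map_source he))
  obtain ⟨r, hr, hrt⟩ := Metric.mem_nhds_iff.1 ht
  rw [Real.ball_eq_Ioo, zero_sub, zero_add] at hrt
  refine ⟨r, fun t => e.symm (c t), hr, by simp only [hc0, hx, e.left_inv he], ?_, ?_, ?_⟩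
  · exact continuous_subtype_val.comp_continuousOn (e.continuousOn_symm.comp hcc.continuousOn hrt)
  · intro s hs t ht h
    have h1 := e.symm.injOn (hrt hs) (hrt ht) (Subtype.ext h)
    simpa [c] using congrArg (fun y => y.1 1) h1
  · intro V hVr hV
    have ho : IsOpen (e.source ∩ e ⁻¹' {y | y.1 1 - x.1 1 ∈ V}) :=
      e.isOpen_inter_preimage (hV.preimage ((continuous_coord 1).sub continuous_const))
    obtain ⟨O, hO, hOe⟩ := isOpen_induced_iff.1 ho
    refine ⟨O, hO, ?_⟩
    ext q
    constructor
    · rintro ⟨t, htV, rfl⟩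
      have h1 := hrt (hVr htV)
      refine ⟨⟨Subtype.coe_prop _, e, e.map_target h1, ?_⟩, ?_⟩
      · rw [Subtype.coe_eta, e.right_inv h1]; simp [c]
      · have : e.symm (c t) ∈ Subtype.val ⁻¹' O := by
          rw [hOe]
          refine ⟨e.map_target h1, ?_⟩
          rw [mem_preimage, e.right_inv h1]
          simpa [c] using htV
        exact this
    · rintro ⟨hq, hqO⟩
      obtain ⟨hqD, e', he', h0'⟩ := id hq
      have h1 : (⟨q, hqD⟩ : D) ∈ e.source ∩ e ⁻¹' {y | y.1 1 - x.1 1 ∈ V} := hOe ▸ hqO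
      have h2 : (e ⟨q, hqD⟩).1 0 = 0 := by
        rcases (e ⟨q, hqD⟩).2.eq_or_lt with h | h
        · exact h.symm
        · exact absurd (mem_nhds_of_chart_pos A e h1.1 h)
            (notMem_nhds_of_chart_zero A e' he' h0')
      refine ⟨_, h1.2, ?_⟩
      have h3 : c ((e ⟨q, hqD⟩).1 1 - x.1 1) = e ⟨q, hqD⟩ := by
        simp only [c]
        rw [add_sub_cancel, halfPoint_eq_of_zero h2]
      simp only [h3, e.left_inv h1.1]

end Surface


/-! ### Local form of a planar domain at its boundary points -/

/-- As in Rolle's theorem, equal values produce an interior extremum, near which a locally injective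
continuous function would have to be strictly monotone. -/
theorem ne_of_locally_injOn {h : ℝ → ℝ} {s t : ℝ} (hst : s < t) (hc : ContinuousOn h (Icc s t))
    (hi : ∀ c ∈ Ioo s t, ∃ U ∈ 𝓝 c, InjOn h U) : h s ≠ h t := by
  intro heq
  obtain ⟨c, hc', hext⟩ := exists_isLocalExtr_Ioo hst hc heq
  obtain ⟨U, hU, hUi⟩ := hi c hc'
  have hev : ∀ᶠ x in 𝓝 c, x ∈ U ∩ Ioo s t := inter_mem hU (Ioo_mem_nhds hc'.1 hc'.2)
  have key : ∀ k : ℝ → ℝ, ContinuousOn k (Icc s t) → InjOn k U → ¬ IsLocalMax k c := by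
    intro k hk hki hmax
    obtain ⟨ε, hε, hεU⟩ := nhds_basis_closedBall.mem_iff.1 (inter_mem hev hmax)
    rw [Real.closedBall_eq_Icc] at hεU
    have hle : c - ε ≤ c + ε := by linarith
    have h1 := ContinuousOn.strictMonoOn_of_injOn_Icc' hle
      (hk.mono fun x hx => Ioo_subset_Icc_self (hεU hx).1.2) (hki.mono fun x hx => (hεU hx).1.1)
    rcases h1 with h1 | h1
    · have h2 := h1 ⟨by linarith, by linarith⟩ ⟨hle, le_rfl⟩ (by linarith : c < c + ε)
      exact (show k (c + ε) ≤ k c from (hεU ⟨hle, le_rfl⟩).2).not_gt h2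
    · have h2 := h1 ⟨le_rfl, hle⟩ ⟨by linarith, by linarith⟩ (by linarith : c - ε < c)
      exact (show k (c - ε) ≤ k c from (hεU ⟨le_rfl, hle⟩).2).not_gt h2
  rcases hext with hmin | hmax
  · exact key (fun x => -h x) hc.neg (fun x hx y hy hxy => hUi hx hy (neg_injective hxy)) hmin.neg
  · exact key h hc hUi hmax

theorem injOn_of_locally_injOn {h : ℝ → ℝ} {J : Set ℝ} [hJ : J.OrdConnected]
    (hc : ContinuousOn h J) (hi : ∀ c ∈ interior J, ∃ U ∈ 𝓝 c, InjOn h U) : InjOn h J := by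
  have key : ∀ s ∈ J, ∀ t ∈ J, s < t → h s ≠ h t := fun s hs t ht hst =>
    ne_of_locally_injOn hst (hc.mono (hJ.out hs ht)) fun c hc' =>
      hi c (mem_interior.2 ⟨_, Ioo_subset_Icc_self.trans (hJ.out hs ht), isOpen_Ioo, hc'⟩)
  intro s hs t ht hst
  rcases lt_trichotomy s t with h' | h' | h'
  · exact absurd hst (key s hs t ht h')
  · exact h'
  · exact absurd hst.symm (key t ht s hs h')

/-- An arc on which the abscissa `h` is injective is a graph: `h` is a quotient map from the compact
`I` onto its image, so `y` descends. -/
theorem exists_continuousOn_comp_eq {I : Set ℝ} (hI : IsCompact I) {h y : ℝ → ℝ}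
    (hc : ContinuousOn h I) (hi : InjOn h I) (hy : ContinuousOn y I) :
    ∃ F : ℝ → ℝ, ContinuousOn F (h '' I) ∧ ∀ t ∈ I, F (h t) = y t := by
  let F : ℝ → ℝ := y ∘ Function.invFunOn h I
  have hF : ∀ t ∈ I, F (h t) = y t := fun t ht => by
    simp only [F, Function.comp, hi.leftInvOn_invFunOn ht]
  refine ⟨F, ?_, hF⟩
  have : CompactSpace I := isCompact_iff_compactSpace.1 hI
  let h' : I → h '' I := fun t => ⟨h t, mem_image_of_mem h t.2⟩
  have hh' : Continuous h' := Continuous.subtype_mk (continuousOn_iff_continuous_domRestrict.1 hc) _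
  have hs : Function.Surjective h' := by
    rintro ⟨_, t, ht, rfl⟩; exact ⟨⟨t, ht⟩, rfl⟩
  have hq := hh'.isClosedMap.isQuotientMap hh' hs
  rw [continuousOn_iff_continuous_domRestrict, hq.continuous_iff]
  have h1 : (h '' I).domRestrict F ∘ h' = I.domRestrict y := funext fun t => hF t t.2
  rw [h1]
  exact continuousOn_iff_continuous_domRestrict.1 hy

/-! ### Critical points and local injectivity -/

section Crit

variable {P : Type*} [TopologicalSpace P] {π : P → ℝ} {C : Set P}

/-- Local injectivity is enough for a local embedding, because a continuous injection of a compact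
arc into the line is closed. -/
theorem notMem_topCrit_iff (hπ : Continuous π) (hC : IsLocallyArc C) {p : P} (hp : p ∈ C) :
    p ∉ topCrit π C ↔ ∃ U ∈ 𝓝 p, InjOn π (C ∩ U) := by
  have h1 : p ∉ topCrit π C ↔ ∃ U, IsOpen U ∧ p ∈ U ∧ IsEmbedding ((C ∩ U).domRestrict π) := by
    simp only [topCrit, mem_ofPred_eq, hp, true_and, not_not]
  rw [h1]
  constructor
  · rintro ⟨U, hU, hpU, he⟩
    exact ⟨U, hU.mem_nhds hpU, injOn_iff_injective.2 he.injective⟩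
  · rintro ⟨U, hU, hi⟩
    obtain ⟨r, γ, hr, rfl, hγc, hγi, hγo⟩ := hC p hp
    have hγ0 : γ ⁻¹' U ∈ 𝓝 (0 : ℝ) :=
      (hγc.continuousAt (Ioo_mem_nhds (by linarith) hr)).preimage_mem_nhds hU
    obtain ⟨ε, hε, hεU⟩ := nhds_basis_closedBall.mem_iff.1
      (inter_mem hγ0 (Ioo_mem_nhds (by linarith : -r < 0) hr))
    rw [Real.closedBall_eq_Icc, zero_sub, zero_add] at hεU
    obtain ⟨O, hO, hOe⟩ := hγo (Ioo (-ε) ε)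
      (fun x hx => (hεU (Ioo_subset_Icc_self hx)).2) isOpen_Ioo
    have hmem : γ 0 ∈ C ∩ O := hOe ▸ mem_image_of_mem γ (show (0 : ℝ) ∈ Ioo (-ε) ε from ⟨by linarith, hε⟩)
    refine ⟨O, hO, hmem.2, ?_⟩
    have hγC : γ '' Icc (-ε) ε ⊆ C := by
      obtain ⟨O', -, hO'⟩ := hγo (Ioo (-r) r) Subset.rfl isOpen_Ioo
      rintro _ ⟨t, ht, rfl⟩
      exact (hO' ▸ mem_image_of_mem γ (hεU ht).2 : γ t ∈ C ∩ O').1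
    have hcpt : IsCompact (γ '' Icc (-ε) ε) :=
      isCompact_Icc.image_of_continuousOn (hγc.mono fun x hx => (hεU hx).2)
    have : CompactSpace (γ '' Icc (-ε) ε) := isCompact_iff_compactSpace.1 hcpt
    have hinj : InjOn π (γ '' Icc (-ε) ε) := hi.mono fun q hq => by
      refine ⟨hγC hq, ?_⟩
      obtain ⟨t, ht, rfl⟩ := hq
      exact (hεU ht).1
    have hemb : IsEmbedding ((γ '' Icc (-ε) ε).domRestrict π) :=
      ((hπ.comp continuous_subtype_val).isClosedEmbedding (injOn_iff_injective.1 hinj)).isEmbedding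
    have hsub : C ∩ O ⊆ γ '' Icc (-ε) ε := hOe ▸ image_mono Ioo_subset_Icc_self
    exact hemb.comp (IsEmbedding.inclusion hsub)

end Crit

/-- The topological properties of a domain of weakly finite type in the plane `ℝ × ℝ`, whose
boundary has `T` as its set of topological critical points. -/
structure PlanarDomain (K T : Set (ℝ × ℝ)) : Prop where
  isClosed : IsClosed K
  subset_closure : K ⊆ closure (interior K)
  proper : IsProperMap ((frontier K).domRestrict Prod.fst)
  arc : IsLocallyArc (frontier K)
  finite : T.Finite
  subset : T ⊆ frontier K
  notMem_iff : ∀ p ∈ frontier K, p ∉ T ↔ ∃ U ∈ 𝓝 p, InjOn Prod.fst (frontier K ∩ U)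
  injOn : InjOn Prod.fst T

/-- Near `p` the set `K` lies on one side of the graph of a continuous function. -/
def IsGraphPoint (K : Set (ℝ × ℝ)) (p : ℝ × ℝ) : Prop :=
  ∃ (δ ε s : ℝ) (F : ℝ → ℝ), 0 < δ ∧ 0 < ε ∧ (s = 1 ∨ s = -1) ∧
    ContinuousOn F (Ioo (p.1 - δ) (p.1 + δ)) ∧ F p.1 = p.2 ∧
    ∀ x y, |x - p.1| < δ → |F x - p.2| < ε ∧ (|y - p.2| < ε → ((x, y) ∈ K ↔ 0 ≤ s * (y - F x)))

/-- The boundary of `K` has near `p` two branches `f` and `g`, on one side of `p`. -/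
def HasFold (K : Set (ℝ × ℝ)) (p : ℝ × ℝ) (Q : (t y a b : ℝ) → Prop) : Prop :=
  ∃ (δ ε σ : ℝ) (f g : ℝ → ℝ), 0 < δ ∧ 0 < ε ∧ (σ = 1 ∨ σ = -1) ∧
    ContinuousOn f (Ico 0 δ) ∧ ContinuousOn g (Ico 0 δ) ∧ f 0 = p.2 ∧ g 0 = p.2 ∧
    (∀ t ∈ Ioo 0 δ, f t < g t) ∧ (∀ t ∈ Ico 0 δ, |f t - p.2| < ε ∧ |g t - p.2| < ε) ∧
    ∀ t y, |t| < δ → |y - p.2| < ε → ((p.1 + σ * t, y) ∈ K ↔ Q t y (f t) (g t))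

/-- Near `p` the set `K` is the region between two branches of its boundary. -/
def IsEndPoint (K : Set (ℝ × ℝ)) (p : ℝ × ℝ) : Prop :=
  HasFold K p fun t y a b => 0 ≤ t ∧ a ≤ y ∧ y ≤ b

/-- Near `p` the set `K` is the region outside of two branches of its boundary. -/
def IsSplitPoint (K : Set (ℝ × ℝ)) (p : ℝ × ℝ) : Prop :=
  HasFold K p fun t y a b => ¬ (0 < t ∧ a < y ∧ y < b)

/-- A connected set cannot leave `K` without crossing its frontier. This decides which of the
regions cut out by the boundary belong to the domain. -/
theorem subset_or_disjoint_of_frontier {X : Type*} [TopologicalSpace X] {S K : Set X}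
    (hS : IsPreconnected S) (h : Disjoint S (frontier K)) : S ⊆ K ∨ Disjoint S K := by
  by_contra hne
  rw [not_or, not_subset, not_disjoint_iff] at hne
  obtain ⟨⟨a, ha, haK⟩, b, hb, hbK⟩ := hne
  have hcov : S ⊆ interior K ∪ (closure K)ᶜ := fun x hx => by
    by_cases hxK : x ∈ closure K
    · left
      by_contra hxi
      exact disjoint_left.1 h hx ⟨hxK, hxi⟩
    · exact Or.inr hxK
  obtain ⟨x, -, hx1, hx2⟩ := hS _ _ isOpen_interior isClosed_closure.isOpen_compl hcov
    ⟨b, hb, (hcov hb).resolve_right fun h' => h' (subset_closure hbK)⟩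
    ⟨a, ha, (hcov ha).resolve_left fun h' => haK (interior_subset h')⟩
  exact hx2 (subset_closure (interior_subset hx1))

/-- The region between the graph and the edge `y₀ + s ε` of the box is the image of `J` × (0, 1) by
linear interpolation; `ε - s * (G x - y₀)` is its height over `x`. -/
theorem isPreconnected_side {J : Set ℝ} (hJ : IsPreconnected J) {G : ℝ → ℝ} (hG : ContinuousOn G J)
    {y₀ ε s : ℝ} (hs : s = 1 ∨ s = -1) (hGε : ∀ x ∈ J, |G x - y₀| < ε) :
    IsPreconnected {z : ℝ × ℝ | z.1 ∈ J ∧ |z.2 - y₀| < ε ∧ 0 < s * (z.2 - G z.1)} := by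
  have hpre : IsPreconnected (J ×ˢ Ioo (0 : ℝ) 1) := hJ.prod isPreconnected_Ioo
  have hGc : ContinuousOn (fun z : ℝ × ℝ => G z.1) (J ×ˢ Ioo (0 : ℝ) 1) :=
    hG.comp continuousOn_fst fun z hz => hz.1
  have := hpre.image (fun z : ℝ × ℝ => (z.1, G z.1 + s * z.2 * (ε - s * (G z.1 - y₀))))
    (continuousOn_fst.prodMk (hGc.add ((continuousOn_const.mul continuousOn_snd).mul
      (continuousOn_const.sub (continuousOn_const.mul (hGc.sub continuousOn_const))))))
  convert this using 1
  ext ⟨x, y⟩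
  simp only [mem_ofPred_eq, mem_image, Prod.exists, mem_prod, mem_Ioo, Prod.mk.injEq]
  constructor
  · rintro ⟨hx, hy, hxy⟩
    have h1 := abs_lt.1 (hGε x hx)
    have h2 := abs_lt.1 hy
    have hpos : 0 < ε - s * (G x - y₀) := by rcases hs with rfl | rfl <;> linarith
    refine ⟨x, s * (y - G x) / (ε - s * (G x - y₀)), ⟨hx, div_pos hxy hpos, ?_⟩, rfl, ?_⟩
    · rw [div_lt_one hpos]
      rcases hs with rfl | rfl <;> linarith
    · have : s * s = 1 := by rcases hs with rfl | rfl <;> norm_num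
      field_simp
      linear_combination (y - G x) * this
  · rintro ⟨x, t, ⟨hx, ht0, ht1⟩, rfl, rfl⟩
    have h1 := abs_lt.1 (hGε x hx)
    have hpos : 0 < ε - s * (G x - y₀) := by rcases hs with rfl | rfl <;> linarith
    have h3 : 0 < t * (ε - s * (G x - y₀)) := mul_pos ht0 hpos
    have h4 : t * (ε - s * (G x - y₀)) < ε - s * (G x - y₀) := by nlinarith
    refine ⟨hx, ?_, ?_⟩
    · rw [abs_lt]
      rcases hs with rfl | rfl <;> constructor <;> nlinarith
    · rcases hs with rfl | rfl <;> nlinarith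

namespace PlanarDomain

variable {K T : Set (ℝ × ℝ)}

theorem not_mem_nhds_of_frontier {p : ℝ × ℝ} (hp : p ∈ frontier K) : K ∉ 𝓝 p :=
  fun h => hp.2 (mem_interior_iff_mem_nhds.2 h)

theorem box_mem_nhds (p : ℝ × ℝ) {δ ε : ℝ} (hδ : 0 < δ) (hε : 0 < ε) :
    {z : ℝ × ℝ | |z.1 - p.1| < δ ∧ |z.2 - p.2| < ε} ∈ 𝓝 p := by
  have h1 : IsOpen {z : ℝ × ℝ | |z.1 - p.1| < δ} := isOpen_lt (by fun_prop) continuous_const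
  have h2 : IsOpen {z : ℝ × ℝ | |z.2 - p.2| < ε} := isOpen_lt (by fun_prop) continuous_const
  exact (h1.inter h2).mem_nhds ⟨by simpa using hδ, by simpa using hε⟩

theorem exists_interior_mem_of_nhds (h : PlanarDomain K T) {p : ℝ × ℝ} (hp : p ∈ frontier K)
    {U : Set (ℝ × ℝ)} (hU : U ∈ 𝓝 p) : ∃ q ∈ U, q ∈ K ∧ q ∉ frontier K := by
  obtain ⟨q, hqU, hq⟩ := mem_closure_iff_nhds.1 (h.subset_closure (h.isClosed.frontier_subset hp)) U hU
  exact ⟨q, hqU, interior_subset hq, fun h' => h'.2 hq⟩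

/-- The abscissa is injective on a boundary arc at `p`, so the boundary is a graph in a small box.
Each side of it is contained in `K` or disjoint from `K`. Both inside would make `p` interior, and
both outside would contradict the density of the interior of `K`. -/
theorem isGraphPoint (h : PlanarDomain K T) {p : ℝ × ℝ} (hp : p ∈ frontier K) (hpT : p ∉ T) :
    IsGraphPoint K p := by
  obtain ⟨U, hU, hUi⟩ := (h.notMem_iff p hp).1 hpT
  obtain ⟨r, γ, hr, rfl, hγc, hγi, hγo⟩ := h.arc p hp
  have hγC : ∀ t ∈ Ioo (-r) r, γ t ∈ frontier K := fun t ht => by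
    obtain ⟨O', -, hO'⟩ := hγo (Ioo (-r) r) Subset.rfl isOpen_Ioo
    exact (hO' ▸ mem_image_of_mem γ ht : γ t ∈ frontier K ∩ O').1
  have hγ0 : γ ⁻¹' U ∈ 𝓝 (0 : ℝ) :=
    (hγc.continuousAt (Ioo_mem_nhds (by linarith) hr)).preimage_mem_nhds hU
  obtain ⟨ρ, hρ, hρU⟩ := nhds_basis_closedBall.mem_iff.1
    (inter_mem hγ0 (Ioo_mem_nhds (by linarith : -r < 0) hr))
  rw [Real.closedBall_eq_Icc, zero_sub, zero_add] at hρU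
  set I := Icc (-ρ) ρ
  have hIr : I ⊆ Ioo (-r) r := fun t ht => (hρU ht).2
  let k : ℝ → ℝ := fun t => (γ t).1
  have hk : ContinuousOn k I := continuous_fst.comp_continuousOn (hγc.mono hIr)
  have hki : InjOn k I := fun s hs t ht hst =>
    hγi (hIr hs) (hIr ht) (hUi ⟨hγC s (hIr hs), (hρU hs).1⟩ ⟨hγC t (hIr ht), (hρU ht).1⟩ hst)
  obtain ⟨F, hF, hFk⟩ := exists_continuousOn_comp_eq isCompact_Icc hk hki
    (continuous_snd.comp_continuousOn (hγc.mono hIr) : ContinuousOn (fun t => (γ t).2) I)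
  obtain ⟨O, hO, hOe⟩ := hγo (Ioo (-ρ) ρ) (Ioo_subset_Icc_self.trans hIr) isOpen_Ioo
  have h0I : (0 : ℝ) ∈ Ioo (-ρ) ρ := ⟨by linarith, hρ⟩
  have h0O : γ 0 ∈ frontier K ∩ O := hOe ▸ mem_image_of_mem γ h0I
  have hkn : k '' Ioo (-ρ) ρ ∈ 𝓝 (γ 0).1 := by
    have h1 := ContinuousOn.strictMonoOn_of_injOn_Icc' (by linarith : -ρ ≤ ρ) hk hki
    have h0 : (0 : ℝ) ∈ I := Ioo_subset_Icc_self h0I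
    have hl : -ρ ∈ I := ⟨le_rfl, by linarith⟩
    have hr' : ρ ∈ I := ⟨by linarith, le_rfl⟩
    rcases h1 with h1 | h1
    · exact mem_of_superset (Ioo_mem_nhds (h1 hl h0 (by linarith)) (h1 h0 hr' hρ))
        (intermediate_value_Ioo (by linarith) hk)
    · exact mem_of_superset (Ioo_mem_nhds (h1 h0 hr' hρ) (h1 hl h0 (by linarith)))
        (intermediate_value_Ioo' (by linarith) hk)
  have hkI : k '' Ioo (-ρ) ρ ⊆ k '' I := image_mono Ioo_subset_Icc_self
  have hF0 : F (γ 0).1 = (γ 0).2 := hFk 0 (Ioo_subset_Icc_self h0I)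
  obtain ⟨ε, hε, hεO⟩ := Metric.isOpen_iff.1 hO _ h0O.2
  have hFc : ContinuousAt F (γ 0).1 := hF.continuousAt (mem_of_superset hkn hkI)
  have hFε : {x | |F x - (γ 0).2| < ε} ∈ 𝓝 (γ 0).1 := by
    have := hFc.preimage_mem_nhds (ball_mem_nhds (F (γ 0).1) hε)
    rw [hF0] at this
    filter_upwards [this] with x hx
    simpa [Real.dist_eq] using hx
  obtain ⟨δ', hδ', hδ'k⟩ := Metric.mem_nhds_iff.1 (inter_mem hkn hFε)
  obtain ⟨δ, hδ, hδδ', hδε⟩ : ∃ δ > 0, δ ≤ δ' ∧ δ ≤ ε :=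
    ⟨min δ' ε, lt_min hδ' hε, min_le_left _ _, min_le_right _ _⟩
  set p := γ 0
  have hmem : ∀ x, |x - p.1| < δ → x ∈ k '' Ioo (-ρ) ρ ∧ |F x - p.2| < ε := fun x hx =>
    hδ'k (by rw [mem_ball, Real.dist_eq]; linarith)
  have hbox : ∀ x y, |x - p.1| < δ → |y - p.2| < ε → ((x, y) ∈ frontier K ↔ y = F x) := by
    intro x y hx hy
    constructor
    · intro hxy
      have hO : (x, y) ∈ O := hεO (by
        rw [mem_ball, Prod.dist_eq, Real.dist_eq, Real.dist_eq]
        exact max_lt (by linarith) hy)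
      obtain ⟨t, ht, htxy⟩ : (x, y) ∈ γ '' Ioo (-ρ) ρ := hOe ▸ ⟨hxy, hO⟩
      have h1 := hFk t (Ioo_subset_Icc_self ht)
      simp only [k, Function.comp, htxy] at h1
      exact h1.symm
    · rintro rfl
      obtain ⟨t, ht, rfl⟩ := (hmem x hx).1
      have h1 := hFk t (Ioo_subset_Icc_self ht)
      rw [h1]
      exact hγC t (hIr (Ioo_subset_Icc_self ht))
  have hJ : ∀ x, x ∈ Ioo (p.1 - δ) (p.1 + δ) ↔ |x - p.1| < δ := fun x => by
    rw [abs_lt, mem_Ioo]; constructor <;> rintro ⟨h1, h2⟩ <;> constructor <;> linarith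
  have hFJ : ContinuousOn F (Ioo (p.1 - δ) (p.1 + δ)) :=
    hF.mono fun x hx => hkI (hmem x ((hJ x).1 hx)).1
  have hside : ∀ s : ℝ, s = 1 ∨ s = -1 →
      let S := {z : ℝ × ℝ | z.1 ∈ Ioo (p.1 - δ) (p.1 + δ) ∧ |z.2 - p.2| < ε ∧
        0 < s * (z.2 - F z.1)}
      S ⊆ K ∨ Disjoint S K := by
    intro s hs S
    refine subset_or_disjoint_of_frontier
      (isPreconnected_side isPreconnected_Ioo hFJ hs fun x hx => (hmem x ((hJ x).1 hx)).2) ?_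
    rw [disjoint_left]
    rintro ⟨x, y⟩ ⟨h1, h2, h3⟩ h4
    have := (hbox x y ((hJ x).1 h1) h2).1 h4
    simp [this] at h3
  have hgraph : ∀ x, |x - p.1| < δ → (x, F x) ∈ K := fun x hx =>
    h.isClosed.frontier_subset ((hbox x (F x) hx (hmem x hx).2).2 rfl)
  have main : ∀ s : ℝ, s = 1 ∨ s = -1 →
      {z : ℝ × ℝ | z.1 ∈ Ioo (p.1 - δ) (p.1 + δ) ∧ |z.2 - p.2| < ε ∧ 0 < s * (z.2 - F z.1)} ⊆ K →
      Disjoint {z : ℝ × ℝ | z.1 ∈ Ioo (p.1 - δ) (p.1 + δ) ∧ |z.2 - p.2| < ε ∧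
        0 < -s * (z.2 - F z.1)} K → IsGraphPoint K p := by
    intro s hs hsub hdis
    refine ⟨δ, ε, s, F, hδ, hε, hs, hFJ, hF0, fun x y hx => ⟨(hmem x hx).2, fun hy => ?_⟩⟩
    constructor
    · intro hxy
      by_contra hneg
      exact disjoint_left.1 hdis ⟨(hJ x).2 hx, hy, by linarith⟩ hxy
    · intro hxy
      rcases hxy.eq_or_lt with h0 | h0
      · have : y = F x := by
          rcases hs with rfl | rfl <;> linarith
        exact this ▸ hgraph x hx
      · exact hsub ⟨(hJ x).2 hx, hy, h0⟩
  have hB := box_mem_nhds p hδ hε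
  rcases hside 1 (Or.inl rfl) with h1 | h1 <;> rcases hside (-1) (Or.inr rfl) with h2 | h2
  · refine absurd (mem_of_superset hB ?_) (not_mem_nhds_of_frontier hp)
    rintro ⟨x, y⟩ ⟨hx, hy⟩
    rcases lt_trichotomy y (F x) with h3 | h3 | h3
    · exact h2 ⟨(hJ x).2 hx, hy, by linarith⟩
    · exact h3 ▸ hgraph x hx
    · exact h1 ⟨(hJ x).2 hx, hy, by linarith⟩
  · exact main 1 (Or.inl rfl) h1 h2
  · exact main (-1) (Or.inr rfl) h2 (by simpa using h1)
  · obtain ⟨⟨x, y⟩, ⟨hx, hy⟩, hqK, hqC⟩ := h.exists_interior_mem_of_nhds hp hB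
    rcases lt_trichotomy y (F x) with h3 | h3 | h3
    · exact absurd hqK (disjoint_left.1 h2 ⟨(hJ x).2 hx, hy, by linarith⟩)
    · exact absurd ((hbox x y hx hy).2 h3) hqC
    · exact absurd hqK (disjoint_left.1 h1 ⟨(hJ x).2 hx, hy, by linarith⟩)

end PlanarDomain
namespace PlanarDomain

variable {K T : Set (ℝ × ℝ)}

/-- Two branches issued from `p` on the same side cut a small box into two connected regions,
between and outside them. As at a graph point, exactly one of the two lies in `K`. -/
theorem endPoint_or_splitPoint_of_branches (h : PlanarDomain K T) {p : ℝ × ℝ}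
    (hp : p ∈ frontier K) {σ δ₀ : ℝ} (hσ : σ = 1 ∨ σ = -1) (hδ₀ : 0 < δ₀) {f g : ℝ → ℝ}
    (hf : ContinuousOn f (Ico 0 δ₀)) (hg : ContinuousOn g (Ico 0 δ₀)) (hf0 : f 0 = p.2)
    (hg0 : g 0 = p.2) (hfg : ∀ t ∈ Ioo 0 δ₀, f t < g t) {O : Set (ℝ × ℝ)} (hO : IsOpen O)
    (hpO : p ∈ O) (hC : ∀ t y, |t| < δ₀ → (p.1 + σ * t, y) ∈ O →
      ((p.1 + σ * t, y) ∈ frontier K ↔ 0 ≤ t ∧ (y = f t ∨ y = g t))) :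
    IsEndPoint K p ∨ IsSplitPoint K p := by
  obtain ⟨ε, hε, hεO⟩ := Metric.isOpen_iff.1 hO p hpO
  have hnear : ∀ k : ℝ → ℝ, ContinuousOn k (Ico 0 δ₀) → k 0 = p.2 →
      ∃ δ > 0, δ ≤ δ₀ ∧ ∀ t ∈ Ico 0 δ, |k t - p.2| < ε := by
    intro k hk hk0
    obtain ⟨δ, hδ, hδk⟩ := Metric.continuousOn_iff.1 hk 0 ⟨le_rfl, hδ₀⟩ ε hε
    refine ⟨min δ δ₀, lt_min hδ hδ₀, min_le_right _ _, fun t ht => ?_⟩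
    have := hδk t ⟨ht.1, ht.2.trans_le (min_le_right _ _)⟩ (by
      rw [Real.dist_eq, sub_zero, abs_of_nonneg ht.1]; exact ht.2.trans_le (min_le_left _ _))
    rwa [hk0, Real.dist_eq] at this
  obtain ⟨δ₁, hδ₁, hδ₁₀, hδ₁f⟩ := hnear f hf hf0
  obtain ⟨δ₂, hδ₂, hδ₂₀, hδ₂g⟩ := hnear g hg hg0
  obtain ⟨δ, hδ, hδδ₁, hδδ₂, hδε⟩ : ∃ δ > 0, δ ≤ δ₁ ∧ δ ≤ δ₂ ∧ δ ≤ ε :=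
    ⟨min (min δ₁ δ₂) ε, lt_min (lt_min hδ₁ hδ₂) hε, (min_le_left _ _).trans (min_le_left _ _),
      (min_le_left _ _).trans (min_le_right _ _), min_le_right _ _⟩
  have hfε : ∀ t ∈ Ico 0 δ, |f t - p.2| < ε := fun t ht => hδ₁f t ⟨ht.1, by linarith [ht.2]⟩
  have hgε : ∀ t ∈ Ico 0 δ, |g t - p.2| < ε := fun t ht => hδ₂g t ⟨ht.1, by linarith [ht.2]⟩
  have hsub : Ico 0 δ ⊆ Ico 0 δ₀ := fun t ht => ⟨ht.1, by linarith [ht.2]⟩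
  have hfg' : ∀ t ∈ Ioo 0 δ, f t < g t := fun t ht => hfg t ⟨ht.1, by linarith [ht.2]⟩
  have hσσ : σ * σ = 1 := by rcases hσ with rfl | rfl <;> norm_num
  have hσa : |σ| = 1 := by rcases hσ with rfl | rfl <;> norm_num
  have hbox : ∀ t y, |t| < δ → |y - p.2| < ε →
      ((p.1 + σ * t, y) ∈ frontier K ↔ 0 ≤ t ∧ (y = f t ∨ y = g t)) := by
    intro t y ht hy
    refine hC t y (by linarith) (hεO ?_)
    rw [mem_ball, Prod.dist_eq, Real.dist_eq, Real.dist_eq]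
    refine max_lt ?_ hy
    simp only [add_sub_cancel_left, abs_mul, hσa, one_mul]
    linarith
  let j : ℝ × ℝ → ℝ × ℝ := fun z => (p.1 + σ * z.1, z.2)
  have hj : Continuous j := by fun_prop
  have key : ∀ S : Set (ℝ × ℝ), IsPreconnected S →
      (∀ t y, (t, y) ∈ S → |t| < δ ∧ |y - p.2| < ε ∧ ¬ (0 ≤ t ∧ (y = f t ∨ y = g t))) →
      (∀ t y, (t, y) ∈ S → (p.1 + σ * t, y) ∈ K) ∨ (∀ t y, (t, y) ∈ S → (p.1 + σ * t, y) ∉ K) := by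
    intro S hS hSb
    have h1 := subset_or_disjoint_of_frontier (K := K) (hS.image j hj.continuousOn) (by
      rw [disjoint_left]
      rintro _ ⟨⟨t, y⟩, hty, rfl⟩ hfr
      obtain ⟨h1, h2, h3⟩ := hSb t y hty
      exact h3 ((hbox t y h1 h2).1 hfr))
    refine h1.imp (fun h1 t y hty => h1 (mem_image_of_mem j hty)) fun h1 t y hty => ?_
    exact disjoint_left.1 h1 (mem_image_of_mem j hty)
  have hmax : ∀ k : ℝ → ℝ, ContinuousOn k (Ico 0 δ₀) →
      ContinuousOn (fun t => k (max t 0)) (Ioo (-δ) δ) := fun k hk =>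
    hk.comp (by fun_prop) fun t ht => hsub ⟨le_max_right _ _, max_lt ht.2 hδ⟩
  have hIco : ∀ t ∈ Ioo (-δ) δ, max t 0 ∈ Ico 0 δ := fun t ht =>
    ⟨le_max_right _ _, max_lt ht.2 hδ⟩
  have hIn := key {z | z.1 ∈ Ioo 0 δ ∧ f z.1 < z.2 ∧ z.2 < g z.1} (by
      have hpre : IsPreconnected (Ioo 0 δ ×ˢ Ioo (0 : ℝ) 1) := isPreconnected_Ioo.prod isPreconnected_Ioo
      have hc : ∀ k : ℝ → ℝ, ContinuousOn k (Ico 0 δ₀) →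
          ContinuousOn (fun z : ℝ × ℝ => k z.1) (Ioo 0 δ ×ˢ Ioo (0 : ℝ) 1) := fun k hk =>
        hk.comp continuousOn_fst fun z hz => hsub ⟨hz.1.1.le, hz.1.2⟩
      have := hpre.image (fun z : ℝ × ℝ => (z.1, f z.1 + z.2 * (g z.1 - f z.1)))
        (continuousOn_fst.prodMk ((hc f hf).add (continuousOn_snd.mul ((hc g hg).sub (hc f hf)))))
      convert this using 1
      ext ⟨t, y⟩
      simp only [mem_ofPred_eq, mem_image, Prod.exists, mem_prod, Prod.mk.injEq]
      constructor
      · rintro ⟨ht, h1, h2⟩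
        have h3 : 0 < g t - f t := by linarith
        refine ⟨t, (y - f t) / (g t - f t), ⟨ht, div_pos (by linarith) h3, ?_⟩, rfl, ?_⟩
        · rw [div_lt_one h3]; linarith
        · field_simp; ring
      · rintro ⟨t, u, ⟨ht, hu0, hu1⟩, rfl, rfl⟩
        have h3 : 0 < g t - f t := by linarith [hfg' t ht]
        exact ⟨ht, by nlinarith, by nlinarith⟩)
    (by
      rintro t y ⟨ht, h1, h2⟩
      have h3 := abs_lt.1 (hfε t ⟨ht.1.le, ht.2⟩)
      have h4 := abs_lt.1 (hgε t ⟨ht.1.le, ht.2⟩)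
      refine ⟨by rw [abs_of_pos ht.1]; exact ht.2,
        abs_lt.2 ⟨by linarith, by linarith⟩, ?_⟩
      rintro ⟨-, rfl | rfl⟩
      exacts [lt_irrefl _ h1, lt_irrefl _ h2])
  -- The outer region is the overlapping union of the part above `g`, the part with `t < 0`, and the
  -- part below `f`. The branches are prolonged by constants to negative `t` through `max t 0`.
  have hOut := key
    ({z | z.1 ∈ Ioo (-δ) δ ∧ |z.2 - p.2| < ε ∧ 0 < (1 : ℝ) * (z.2 - g (max z.1 0))} ∪
      Ioo (-δ) 0 ×ˢ Ioo (p.2 - ε) (p.2 + ε) ∪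
      {z | z.1 ∈ Ioo (-δ) δ ∧ |z.2 - p.2| < ε ∧ 0 < (-1 : ℝ) * (z.2 - f (max z.1 0))})
    (by
      have m0 : max (-(δ / 2)) 0 = 0 := max_eq_right (by linarith)
      have e1 : |ε / 2| < ε := by rw [abs_of_pos (by linarith)]; linarith
      refine IsPreconnected.union (-(δ / 2), p.2 - ε / 2) ?_ ?_ (IsPreconnected.union (-(δ / 2), p.2 + ε / 2) ?_ ?_
        (isPreconnected_side (G := fun t => g (max t 0)) isPreconnected_Ioo (hmax g hg) (Or.inl rfl)
          fun t ht => hgε _ (hIco t ht)) (isPreconnected_Ioo.prod isPreconnected_Ioo))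
        (isPreconnected_side (G := fun t => f (max t 0)) isPreconnected_Ioo (hmax f hf) (Or.inr rfl)
          fun t ht => hfε _ (hIco t ht))
      · right
        exact ⟨⟨by linarith, by linarith⟩, by constructor <;> linarith⟩
      · refine ⟨⟨by linarith, by linarith⟩, by simpa using e1, ?_⟩
        simp only [m0, hf0]; linarith
      · refine ⟨⟨by linarith, by linarith⟩, by simpa using e1, ?_⟩
        simp only [m0, hg0]; linarith
      · exact ⟨⟨by linarith, by linarith⟩, by constructor <;> linarith⟩)
    (by
      have hle : ∀ t, 0 ≤ t → t < δ → f t ≤ g t := fun t h0 h1 => by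
        rcases h0.eq_or_lt with rfl | h0
        · rw [hf0, hg0]
        · exact (hfg' t ⟨h0, h1⟩).le
      rintro t y ((⟨ht, hy, h1⟩ | ⟨ht, hy⟩) | ⟨ht, hy, h1⟩)
      · refine ⟨abs_lt.2 ht, hy, ?_⟩
        rintro ⟨h0, h2⟩
        simp only [max_eq_left h0] at h1
        have := hle t h0 ht.2
        rcases h2 with rfl | rfl <;> linarith
      · refine ⟨abs_lt.2 ⟨ht.1, by linarith [ht.2]⟩,
          abs_lt.2 ⟨by linarith [hy.1], by linarith [hy.2]⟩, ?_⟩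
        rintro ⟨h0, -⟩
        exact absurd ht.2 (not_lt.2 h0)
      · refine ⟨abs_lt.2 ht, hy, ?_⟩
        rintro ⟨h0, h2⟩
        simp only [max_eq_left h0] at h1
        have := hle t h0 ht.2
        rcases h2 with rfl | rfl <;> linarith)
  have memOut : ∀ t y, |t| < δ → |y - p.2| < ε → (0 ≤ t → y < f t ∨ g t < y) → (t, y) ∈
      ({z | z.1 ∈ Ioo (-δ) δ ∧ |z.2 - p.2| < ε ∧ 0 < (1 : ℝ) * (z.2 - g (max z.1 0))} ∪
      Ioo (-δ) 0 ×ˢ Ioo (p.2 - ε) (p.2 + ε) ∪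
      {z | z.1 ∈ Ioo (-δ) δ ∧ |z.2 - p.2| < ε ∧ 0 < (-1 : ℝ) * (z.2 - f (max z.1 0))} :
        Set (ℝ × ℝ)) := by
    intro t y ht hy hor
    have ht' := abs_lt.1 ht
    have hy' := abs_lt.1 hy
    rcases lt_or_ge t 0 with h0 | h0
    · exact Or.inl (Or.inr ⟨⟨ht'.1, h0⟩, by linarith, by linarith⟩)
    · rcases hor h0 with h1 | h1
      · refine Or.inr ⟨ht', hy, ?_⟩
        simp only [max_eq_left h0]; linarith
      · refine Or.inl (Or.inl ⟨ht', hy, ?_⟩)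
        simp only [max_eq_left h0]; linarith
  have hcurve : ∀ t y, |t| < δ → |y - p.2| < ε → 0 ≤ t → (y = f t ∨ y = g t) →
      (p.1 + σ * t, y) ∈ K := fun t y ht hy h0 h1 =>
    h.isClosed.frontier_subset ((hbox t y ht hy).2 ⟨h0, h1⟩)
  have htri : ∀ t y, |t| < δ → |y - p.2| < ε →
      (0 ≤ t ∧ (y = f t ∨ y = g t)) ∨ (t ∈ Ioo 0 δ ∧ f t < y ∧ y < g t) ∨
        (0 ≤ t → y < f t ∨ g t < y) := by
    intro t y ht hy
    by_cases h3 : 0 ≤ t → y < f t ∨ g t < y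
    · exact Or.inr (Or.inr h3)
    · push Not at h3
      obtain ⟨h0, h1, h2⟩ := h3
      rcases h1.eq_or_lt with h1 | h1
      · exact Or.inl ⟨h0, Or.inl h1.symm⟩
      rcases h2.eq_or_lt with h2 | h2
      · exact Or.inl ⟨h0, Or.inr h2⟩
      refine Or.inr (Or.inl ⟨⟨h0.lt_of_ne ?_, (abs_lt.1 ht).2⟩, h1, h2⟩)
      rintro rfl
      rw [hf0] at h1; rw [hg0] at h2
      exact lt_asymm h1 h2
  have hco : ∀ z : ℝ × ℝ, p.1 + σ * (σ * (z.1 - p.1)) = z.1 := fun z => by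
    rw [← mul_assoc, hσσ]; ring
  have hcoa : ∀ z : ℝ × ℝ, |σ * (z.1 - p.1)| = |z.1 - p.1| := fun z => by
    rw [abs_mul, hσa, one_mul]
  have hB := box_mem_nhds p hδ hε
  have hbd : ∀ t ∈ Ico 0 δ, |f t - p.2| < ε ∧ |g t - p.2| < ε := fun t ht => ⟨hfε t ht, hgε t ht⟩
  rcases hIn with hIn | hIn <;> rcases hOut with hOut | hOut
  · refine absurd (mem_of_superset hB ?_) (not_mem_nhds_of_frontier hp)
    rintro z ⟨hx, hy⟩
    have h1 : (p.1 + σ * (σ * (z.1 - p.1)), z.2) ∈ K := by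
      rw [← hcoa] at hx
      rcases htri _ z.2 hx hy with h1 | h1 | h1
      · exact hcurve _ _ hx hy h1.1 h1.2
      · exact hIn _ _ h1
      · exact hOut _ _ (memOut _ _ hx hy h1)
    rwa [hco] at h1
  · refine Or.inl ⟨δ, ε, σ, f, g, hδ, hε, hσ, hf.mono hsub, hg.mono hsub, hf0, hg0, hfg', hbd,
      fun t y ht hy => ⟨fun hK => ?_, ?_⟩⟩
    · by_contra hne
      refine hOut t y (memOut t y ht hy fun h0 => ?_) hK
      by_contra h1
      push Not at h1
      exact hne ⟨h0, h1.1, h1.2⟩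
    · rintro ⟨h0, h1, h2⟩
      rcases htri t y ht hy with h3 | h3 | h3
      · exact hcurve t y ht hy h3.1 h3.2
      · exact hIn _ _ h3
      · rcases h3 h0 with h3 | h3 <;> linarith
  · refine Or.inr ⟨δ, ε, σ, f, g, hδ, hε, hσ, hf.mono hsub, hg.mono hsub, hf0, hg0, hfg', hbd,
      fun t y ht hy => ⟨?_, fun hne => ?_⟩⟩
    · rintro hK ⟨h0, h1, h2⟩
      exact hIn t y ⟨⟨h0, (abs_lt.1 ht).2⟩, h1, h2⟩ hK
    · rcases htri t y ht hy with h3 | h3 | h3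
      · exact hcurve t y ht hy h3.1 h3.2
      · exact absurd ⟨h3.1.1, h3.2.1, h3.2.2⟩ hne
      · exact hOut _ _ (memOut _ _ ht hy h3)
  · obtain ⟨z, ⟨hx, hy⟩, hqK, hqC⟩ := h.exists_interior_mem_of_nhds hp hB
    rw [← hcoa] at hx
    have hz : (p.1 + σ * (σ * (z.1 - p.1)), z.2) = z := by rw [hco]
    rcases htri _ z.2 hx hy with h3 | h3 | h3
    · exact absurd (hz ▸ (hbox _ _ hx hy).2 h3) hqC
    · exact absurd (hz.symm ▸ hqK) (hIn _ _ h3)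
    · exact absurd (hz.symm ▸ hqK) (hOut _ _ (memOut _ _ hx hy h3))

/-- Since `T` is finite, `p` is the only critical point of a short arc, so the abscissa is strictly
monotone on both halves. Were the directions of variation the same, it would be injective and `p`
not critical. Hence the arc folds at `p`, and its halves are the two branches. -/
theorem endPoint_or_splitPoint (h : PlanarDomain K T) {p : ℝ × ℝ} (hpT : p ∈ T) :
    IsEndPoint K p ∨ IsSplitPoint K p := by
  have hp := h.subset hpT
  obtain ⟨r, γ, hr, rfl, hγc, hγi, hγo⟩ := h.arc p hp
  have hγC : ∀ t ∈ Ioo (-r) r, γ t ∈ frontier K := fun t ht => by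
    obtain ⟨O', -, hO'⟩ := hγo (Ioo (-r) r) Subset.rfl isOpen_Ioo
    exact (hO' ▸ mem_image_of_mem γ ht : γ t ∈ frontier K ∩ O').1
  have h0r : (0 : ℝ) ∈ Ioo (-r) r := ⟨by linarith, hr⟩
  have hU : (T \ {γ 0})ᶜ ∈ 𝓝 (γ 0) :=
    (h.finite.subset sdiff_subset).isClosed.isOpen_compl.mem_nhds fun h => h.2 rfl
  have hγ0 : γ ⁻¹' (T \ {γ 0})ᶜ ∈ 𝓝 (0 : ℝ) :=
    (hγc.continuousAt (Ioo_mem_nhds h0r.1 hr)).preimage_mem_nhds hU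
  obtain ⟨ρ, hρ, hρU⟩ := nhds_basis_closedBall.mem_iff.1 (inter_mem hγ0 (Ioo_mem_nhds h0r.1 hr))
  rw [Real.closedBall_eq_Icc, zero_sub, zero_add] at hρU
  have hIr : Icc (-ρ) ρ ⊆ Ioo (-r) r := fun t ht => (hρU ht).2
  let k : ℝ → ℝ := fun t => (γ t).1
  have hk : ContinuousOn k (Icc (-ρ) ρ) := continuous_fst.comp_continuousOn (hγc.mono hIr)
  have hloc : ∀ t ∈ Icc (-ρ) ρ, t ≠ 0 → ∃ U ∈ 𝓝 t, InjOn k U := by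
    intro t ht ht0
    have htT : γ t ∉ T := fun hT => (hρU ht).1 ⟨hT, fun h' => ht0 (hγi (hIr ht) h0r h')⟩
    obtain ⟨U, hU, hUi⟩ := (h.notMem_iff _ (hγC t (hIr ht))).1 htT
    have hn := Ioo_mem_nhds (hIr ht).1 (hIr ht).2
    exact ⟨_, inter_mem ((hγc.continuousAt hn).preimage_mem_nhds hU) hn, fun a ha b hb hab =>
      hγi ha.2 hb.2 (hUi ⟨hγC a ha.2, ha.1⟩ ⟨hγC b hb.2, hb.1⟩ hab)⟩
  have hR : Icc 0 ρ ⊆ Icc (-ρ) ρ := Icc_subset_Icc_left (by linarith)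
  have hL : Icc (-ρ) 0 ⊆ Icc (-ρ) ρ := Icc_subset_Icc_right (by linarith)
  have hRi : InjOn k (Icc 0 ρ) := injOn_of_locally_injOn (hk.mono hR) fun c hc => by
    rw [interior_Icc] at hc
    exact hloc c (hR (Ioo_subset_Icc_self hc)) hc.1.ne'
  have hLi : InjOn k (Icc (-ρ) 0) := injOn_of_locally_injOn (hk.mono hL) fun c hc => by
    rw [interior_Icc] at hc
    exact hloc c (hL (Ioo_subset_Icc_self hc)) hc.2.ne
  obtain ⟨O, hO, hOe⟩ := hγo (Ioo (-ρ) ρ) (Ioo_subset_Icc_self.trans hIr) isOpen_Ioo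
  have h0I : (0 : ℝ) ∈ Ioo (-ρ) ρ := ⟨by linarith, hρ⟩
  have h0O : γ 0 ∈ frontier K ∩ O := hOe ▸ mem_image_of_mem γ h0I
  have hninj : ¬ InjOn k (Icc (-ρ) ρ) := fun hki => by
    refine (h.notMem_iff _ hp).2 ⟨O, hO.mem_nhds h0O.2, ?_⟩ hpT
    rw [← hOe]
    rintro _ ⟨s, hs, rfl⟩ _ ⟨t, ht, rfl⟩ hst
    rw [hki (Ioo_subset_Icc_self hs) (Ioo_subset_Icc_self ht) hst]
  -- The sign `σ` tells on which side the fold opens. The normalized abscissa `H` grows away from 0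
  -- on both halves, so both become graphs over a common interval [0, δ).
  have main : ∀ σ : ℝ, σ = 1 ∨ σ = -1 → StrictMonoOn (fun t => σ * (k t - (γ 0).1)) (Icc 0 ρ) →
      StrictAntiOn (fun t => σ * (k t - (γ 0).1)) (Icc (-ρ) 0) →
      IsEndPoint K (γ 0) ∨ IsSplitPoint K (γ 0) := by
    intro σ hσ hm ha
    set H : ℝ → ℝ := fun t => σ * (k t - (γ 0).1) with hH
    have hσσ : σ * σ = 1 := by rcases hσ with rfl | rfl <;> norm_num
    have hkH : ∀ t, (γ t).1 = (γ 0).1 + σ * H t := fun t => by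
      simp only [hH, ← mul_assoc, hσσ, k]; ring
    have hH0 : H 0 = 0 := by simp [hH, k]
    have hHc : ContinuousOn H (Icc (-ρ) ρ) := continuousOn_const.mul (hk.sub continuousOn_const)
    have hyc : ContinuousOn (fun t => (γ t).2) (Icc (-ρ) ρ) :=
      continuous_snd.comp_continuousOn (hγc.mono hIr)
    obtain ⟨F₁, hF₁, hF₁H⟩ := exists_continuousOn_comp_eq isCompact_Icc (hHc.mono hR) hm.injOn
      (hyc.mono hR)
    obtain ⟨F₂, hF₂, hF₂H⟩ := exists_continuousOn_comp_eq isCompact_Icc (hHc.mono hL) ha.injOn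
      (hyc.mono hL)
    have e0R : (0 : ℝ) ∈ Icc 0 ρ := ⟨le_rfl, hρ.le⟩
    have e0L : (0 : ℝ) ∈ Icc (-ρ) 0 := ⟨by linarith, le_rfl⟩
    have h1pos : 0 < H ρ := hH0 ▸ hm e0R ⟨hρ.le, le_rfl⟩ hρ
    have h2pos : 0 < H (-ρ) := hH0 ▸ ha ⟨le_rfl, by linarith⟩ e0L (by linarith : -ρ < 0)
    obtain ⟨δ, hδ, hδ1, hδ2⟩ : ∃ δ > 0, δ ≤ H ρ ∧ δ ≤ H (-ρ) :=
      ⟨min (H ρ) (H (-ρ)), lt_min h1pos h2pos, min_le_left _ _, min_le_right _ _⟩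
    have him1 : Ico 0 δ ⊆ H '' Ico 0 ρ := fun u hu =>
      intermediate_value_Ico hρ.le (hHc.mono hR) ⟨by rw [hH0]; exact hu.1, hu.2.trans_le hδ1⟩
    have him2 : Ico 0 δ ⊆ H '' Ioc (-ρ) 0 := fun u hu =>
      intermediate_value_Ioc' (by linarith) (hHc.mono hL)
        ⟨by rw [hH0]; exact hu.1, hu.2.trans_le hδ2⟩
    have hF10 : F₁ 0 = (γ 0).2 := by simpa only [hH0] using hF₁H 0 e0R
    have hF20 : F₂ 0 = (γ 0).2 := by simpa only [hH0] using hF₂H 0 e0L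
    have hc1 : ContinuousOn F₁ (Ico 0 δ) := hF₁.mono (him1.trans (image_mono Ico_subset_Icc_self))
    have hc2 : ContinuousOn F₂ (Ico 0 δ) := hF₂.mono (him2.trans (image_mono Ioc_subset_Icc_self))
    have hcurve : ∀ t y, |t| < δ → ((γ 0).1 + σ * t, y) ∈ O →
        (((γ 0).1 + σ * t, y) ∈ frontier K ↔ 0 ≤ t ∧ (y = F₁ t ∨ y = F₂ t)) := by
      intro t y ht hyO
      constructor
      · intro hyC
        obtain ⟨s, hs, hsy⟩ : ((γ 0).1 + σ * t, y) ∈ γ '' Ioo (-ρ) ρ := hOe ▸ ⟨hyC, hyO⟩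
        have hHs : H s = t := by
          simp only [hH, k, hsy]
          linear_combination t * hσσ
        have hy : (γ s).2 = y := by rw [hsy]
        rcases le_total 0 s with h0 | h0
        · have hsm : s ∈ Icc 0 ρ := ⟨h0, hs.2.le⟩
          refine ⟨?_, Or.inl ?_⟩
          · rw [← hHs, ← hH0]; exact hm.monotoneOn e0R hsm h0
          · rw [← hHs, hF₁H s hsm, hy]
        · have hsm : s ∈ Icc (-ρ) 0 := ⟨hs.1.le, h0⟩
          refine ⟨?_, Or.inr ?_⟩
          · rw [← hHs, ← hH0]; exact ha.antitoneOn hsm e0L h0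
          · rw [← hHs, hF₂H s hsm, hy]
      · rintro ⟨h0, h1⟩
        have htI : t ∈ Ico 0 δ := ⟨h0, (abs_lt.1 ht).2⟩
        rcases h1 with rfl | rfl
        · obtain ⟨s, hs, rfl⟩ := him1 htI
          have hs' := Ico_subset_Icc_self hs
          rw [hF₁H s hs', ← hkH]
          exact hγC s (hIr (hR hs'))
        · obtain ⟨s, hs, rfl⟩ := him2 htI
          have hs' := Ioc_subset_Icc_self hs
          rw [hF₂H s hs', ← hkH]
          exact hγC s (hIr (hL hs'))
    have hne : ∀ t ∈ Ioo 0 δ, F₁ t ≠ F₂ t := by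
      intro t ht heq
      obtain ⟨s, hs, hst⟩ := him1 (Ioo_subset_Ico_self ht)
      obtain ⟨s', hs', hst'⟩ := him2 (Ioo_subset_Ico_self ht)
      have hs1 := Ico_subset_Icc_self hs
      have hs2 := Ioc_subset_Icc_self hs'
      have h1 : γ s = γ s' := by
        refine Prod.ext ?_ ?_
        · rw [hkH s, hkH s', hst, hst']
        · rw [← hF₁H s hs1, ← hF₂H s' hs2, hst, hst', heq]
      have h2 := hγi (hIr (hR hs1)) (hIr (hL hs2)) h1
      have h3 : s = 0 := le_antisymm (h2 ▸ hs'.2) hs.1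
      rw [h3, hH0] at hst
      exact ht.1.ne hst
    have hsign : (∀ t ∈ Ioo 0 δ, F₁ t < F₂ t) ∨ ∀ t ∈ Ioo 0 δ, F₂ t < F₁ t := by
      by_contra hcon
      push Not at hcon
      obtain ⟨⟨a, ha, ha'⟩, b, hb, hb'⟩ := hcon
      obtain ⟨c, hc, hc'⟩ := isPreconnected_Ioo.intermediate_value₂ hb ha
        (hc1.mono Ioo_subset_Ico_self) (hc2.mono Ioo_subset_Ico_self) hb' ha'
      exact hne c hc hc'
    rcases hsign with hs | hs
    · exact h.endPoint_or_splitPoint_of_branches hp hσ hδ hc1 hc2 hF10 hF20 hs hO h0O.2 hcurve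
    · exact h.endPoint_or_splitPoint_of_branches hp hσ hδ hc2 hc1 hF20 hF10 hs hO h0O.2
        fun t y ht hy => (hcurve t y ht hy).trans (and_congr_right fun _ => or_comm)
  have hg : IsGreatest (Icc (-ρ) 0) 0 := isGreatest_Icc (by linarith)
  have hl : IsLeast (Icc 0 ρ) 0 := isLeast_Icc hρ.le
  have hun : Icc (-ρ) 0 ∪ Icc 0 ρ = Icc (-ρ) ρ := Icc_union_Icc_eq_Icc (by linarith) hρ.le
  rcases ContinuousOn.strictMonoOn_of_injOn_Icc' hρ.le (hk.mono hR) hRi with h1 | h1 <;>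
  rcases ContinuousOn.strictMonoOn_of_injOn_Icc' (by linarith) (hk.mono hL) hLi with h2 | h2
  · exact absurd (hun ▸ (h2.union h1 hg hl)).injOn hninj
  · exact main 1 (Or.inl rfl) (fun a ha b hb hab => by linarith [h1 ha hb hab])
      (fun a ha b hb hab => by linarith [h2 ha hb hab])
  · exact main (-1) (Or.inr rfl) (fun a ha b hb hab => by linarith [h1 ha hb hab])
      (fun a ha b hb hab => by linarith [h2 ha hb hab])
  · exact absurd (hun ▸ (h2.union h1 hg hl)).injOn hninj

end PlanarDomain

/-! ### The quotient of a planar domain by its vertical segments -/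

/-- The map `r` identifies `X` with the quotient of `K` by the relation of belonging to a common
vertical segment contained in `K`, and `q` is the projection of the quotient to the line. -/
structure IsVertCollapse {X : Type*} [TopologicalSpace X] (K : Set (ℝ × ℝ)) (r : ℝ × ℝ → X)
    (q : X → ℝ) : Prop where
  continuousOn : ContinuousOn r K
  surj : ∀ z, ∃ a ∈ K, r a = z
  eq_iff : ∀ a ∈ K, ∀ b ∈ K, r a = r b ↔ a.1 = b.1 ∧ ∀ y ∈ uIcc a.2 b.2, (a.1, y) ∈ K
  isClosed_of : ∀ S : Set X, IsClosed {a | a ∈ K ∧ r a ∈ S} → IsClosed S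
  proj : ∀ a ∈ K, q (r a) = a.1

/-- The boundary of `K` together with a horizontal section. -/
def skeleton (K : Set (ℝ × ℝ)) : Set (ℝ × ℝ) := {a | a ∈ K ∧ (a ∈ frontier K ∨ a.2 = 0)}

namespace PlanarDomain
variable {K T : Set (ℝ × ℝ)}

/-- The skeleton serves as a substitute for `K` that is proper over the line: vertical segments of
`K` may be unbounded, but the frontier is proper and the horizontal axis adds at most one point for
each abscissa. -/
theorem isCompact_skeleton_inter (h : PlanarDomain K T) {M : Set ℝ} (hM : IsCompact M) :
    IsCompact (skeleton K ∩ Prod.fst ⁻¹' M) := by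
  have h1 : IsCompact (frontier K ∩ Prod.fst ⁻¹' M) := by
    have := (h.proper.isCompact_preimage hM).image continuous_subtype_val
    convert this using 1
    ext a
    simp [and_comm]
  have h2 : IsCompact (K ∩ M ×ˢ {(0 : ℝ)}) := (hM.prod isCompact_singleton).inter_left h.isClosed
  convert h1.union h2 using 1
  ext a
  have : a ∈ frontier K → a ∈ K := fun h' => h.isClosed.frontier_subset h'
  simp only [skeleton, mem_inter_iff, mem_ofPred_eq, mem_preimage, mem_union, mem_prod,
    mem_singleton_iff]
  tauto

theorem isClosed_skeleton (h : PlanarDomain K T) : IsClosed (skeleton K) :=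
  h.isClosed.inter (isClosed_frontier.union (isClosed_singleton.preimage continuous_snd))

/-- Move vertically from `a` towards the axis: either the axis is reached inside `K`, or the first
exit occurs at a frontier point. -/
theorem exists_skeleton (h : PlanarDomain K T) {a : ℝ × ℝ} (ha : a ∈ K) :
    ∃ b ∈ skeleton K, a.1 = b.1 ∧ ∀ y ∈ uIcc a.2 b.2, (a.1, y) ∈ K := by
  let m : ℝ → ℝ × ℝ := fun u => (a.1, a.2 + u * (0 - a.2))
  have hm : Continuous m := by fun_prop
  have hseg : ∀ u, 0 ≤ u → ∀ y ∈ uIcc a.2 (m u).2, ∃ v ∈ Icc 0 u, (a.1, y) = m v := by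
    intro u hu y hy
    rw [← segment_eq_uIcc, segment_eq_image'] at hy
    obtain ⟨θ, hθ, rfl⟩ := hy
    refine ⟨θ * u, ⟨mul_nonneg hθ.1 hu, by nlinarith [hθ.2]⟩, ?_⟩
    simp only [m, smul_eq_mul, Prod.mk.injEq, true_and]
    ring
  by_cases hall : ∀ u ∈ Icc (0 : ℝ) 1, m u ∈ K
  · refine ⟨m 1, ⟨hall 1 ⟨zero_le_one, le_rfl⟩, Or.inr (by simp [m])⟩, rfl, fun y hy => ?_⟩
    obtain ⟨v, hv, hyv⟩ := hseg 1 zero_le_one y hy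
    exact hyv ▸ hall v hv
  · push Not at hall
    obtain ⟨u₀, hu₀, hu₀K⟩ := hall
    let S := {u : ℝ | 0 ≤ u ∧ m u ∉ K}
    have hSne : S.Nonempty := ⟨u₀, hu₀.1, hu₀K⟩
    have hSb : BddBelow S := ⟨0, fun u hu => hu.1⟩
    set c := sInf S with hc
    have hc0 : 0 ≤ c := le_csInf hSne fun u hu => hu.1
    have hlt : ∀ u, 0 ≤ u → u < c → m u ∈ K := fun u h0 huc => by
      by_contra hne
      exact (csInf_le hSb ⟨h0, hne⟩).not_gt huc
    have hcK : m c ∈ K := by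
      rcases hc0.eq_or_lt with h0 | h0
      · rw [← h0]; simpa [m] using ha
      · refine h.isClosed.closure_subset ?_
        have : c ∈ closure (Ico 0 c) := by rw [closure_Ico h0.ne]; exact ⟨hc0, le_rfl⟩
        exact map_mem_closure hm this fun u hu => hlt u hu.1 hu.2
    have hcC : m c ∈ closure Kᶜ :=
      map_mem_closure hm (csInf_mem_closure hSne hSb) fun u hu => hu.2
    refine ⟨m c, ⟨hcK, Or.inl ?_⟩, rfl, fun y hy => ?_⟩
    · rw [frontier_eq_closure_inter_closure]; exact ⟨_root_.subset_closure hcK, hcC⟩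
    · obtain ⟨v, hv, hyv⟩ := hseg c hc0 y hy
      rw [hyv]
      rcases hv.2.eq_or_lt with h1 | h1
      · exact h1 ▸ hcK
      · exact hlt v hv.1 h1

end PlanarDomain

/-! ### Topology of the quotient -/

namespace IsVertCollapse

variable {K T : Set (ℝ × ℝ)} {X : Type*} [TopologicalSpace X] {r : ℝ × ℝ → X} {q : X → ℝ}

theorem exists_skeleton (hr : IsVertCollapse K r q) (h : PlanarDomain K T) (z : X) :
    ∃ b ∈ skeleton K, r b = z := by
  obtain ⟨a, ha, rfl⟩ := hr.surj z
  obtain ⟨b, hb, hab⟩ := h.exists_skeleton ha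
  exact ⟨b, hb, ((hr.eq_iff a ha b hb.1).2 hab).symm⟩

/-- Representatives in the skeleton of a sequence with convergent abscissas stay in a compact set,
so a subsequence converges. The vertical segments joining them to the given points pass to the limit
because `K` is closed. -/
theorem isClosed_image (hr : IsVertCollapse K r q) (h : PlanarDomain K T) {A : Set (ℝ × ℝ)}
    (hA : IsClosed A) (hAs : A ⊆ skeleton K) : IsClosed (r '' A) := by
  refine hr.isClosed_of _ (IsSeqClosed.isClosed ?_)
  intro a a₀ ha hlim
  have haK : a₀ ∈ K := h.isClosed.mem_of_tendsto hlim (Eventually.of_forall fun n => (ha n).1)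
  refine ⟨haK, ?_⟩
  choose b hbA hab using fun n => (ha n).2
  have hbK : ∀ n, b n ∈ K := fun n => (hAs (hbA n)).1
  have hrel := fun n => (hr.eq_iff (a n) (ha n).1 (b n) (hbK n)).1 (hab n).symm
  have hfst : Tendsto (fun n => (a n).1) atTop (𝓝 a₀.1) := (continuous_fst.tendsto _).comp hlim
  have hbd : IsCompact (insert a₀.1 (range fun n => (a n).1)) := hfst.isCompact_insert_range
  have hcpt : IsCompact (A ∩ (skeleton K ∩ Prod.fst ⁻¹' insert a₀.1 (range fun n => (a n).1))) :=
    (h.isCompact_skeleton_inter hbd).inter_left hA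
  obtain ⟨b₀, hb₀, φ, hφ, hbφ⟩ := hcpt.tendsto_subseq (x := b) fun n =>
    ⟨hbA n, hAs (hbA n), by
      rw [mem_preimage, ← (hrel n).1]; exact mem_insert_of_mem _ (mem_range_self n)⟩
  have haφ : Tendsto (a ∘ φ) atTop (𝓝 a₀) := hlim.comp hφ.tendsto_atTop
  refine ⟨b₀, hb₀.1, ((hr.eq_iff a₀ haK b₀ (hAs hb₀.1).1).2 ⟨?_, fun y hy => ?_⟩).symm⟩
  · refine tendsto_nhds_unique ((continuous_fst.tendsto _).comp haφ)
      (((continuous_fst.tendsto _).comp hbφ).congr fun n => ?_)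
    exact (hrel (φ n)).1.symm
  · rw [← segment_eq_uIcc, segment_eq_image'] at hy
    obtain ⟨θ, hθ, rfl⟩ := hy
    have h2 : Tendsto (fun n => ((a (φ n)).1, (a (φ n)).2 + θ • ((b (φ n)).2 - (a (φ n)).2))) atTop
        (𝓝 (a₀.1, a₀.2 + θ • (b₀.2 - a₀.2))) := by
      have ha2 := (continuous_snd.tendsto _).comp haφ
      have hb2 := (continuous_snd.tendsto _).comp hbφ
      exact ((continuous_fst.tendsto _).comp haφ).prodMk_nhds
        (ha2.add ((hb2.sub ha2).const_smul θ))
    refine h.isClosed.mem_of_tendsto h2 (Eventually.of_forall fun n => (hrel (φ n)).2 _ ?_)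
    rw [← segment_eq_uIcc, segment_eq_image']
    exact ⟨θ, hθ, rfl⟩

theorem continuous_proj (hr : IsVertCollapse K r q) (h : PlanarDomain K T) : Continuous q := by
  refine continuous_iff_isClosed.2 fun S hS => hr.isClosed_of _ ?_
  have : {a | a ∈ K ∧ r a ∈ q ⁻¹' S} = K ∩ Prod.fst ⁻¹' S := by
    ext a
    refine and_congr_right fun ha => ?_
    rw [mem_preimage, hr.proj a ha, mem_preimage]
  rw [this]
  exact h.isClosed.inter (hS.preimage continuous_fst)

theorem t1Space (hr : IsVertCollapse K r q) (h : PlanarDomain K T) : T1Space X where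
  t1 z := by
    obtain ⟨b, hb, rfl⟩ := hr.exists_skeleton h z
    simpa using hr.isClosed_image h (isClosed_singleton (x := b)) (singleton_subset_iff.2 hb)

theorem isClosedMap_skeleton (hr : IsVertCollapse K r q) (h : PlanarDomain K T) :
    IsClosedMap fun a : skeleton K => r a := by
  intro A hA
  have := hr.isClosed_image h (h.isClosed_skeleton.isClosedEmbedding_subtypeVal.isClosedMap A hA)
    (by rintro _ ⟨a, -, rfl⟩; exact a.2)
  rwa [image_image] at this

theorem continuous_skeleton (hr : IsVertCollapse K r q) :
    Continuous fun a : skeleton K => r a :=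
  hr.continuousOn.comp_continuous continuous_subtype_val fun a => a.2.1

theorem isProperMap_fst_skeleton (h : PlanarDomain K T) :
    IsProperMap fun a : skeleton K => (a : ℝ × ℝ).1 := by
  refine isProperMap_iff_isCompact_preimage.2 ⟨by fun_prop, fun M hM => ?_⟩
  rw [Subtype.isCompact_iff]
  convert h.isCompact_skeleton_inter hM using 1
  ext a
  simp [and_comm]

theorem isProperMap_proj (hr : IsVertCollapse K r q) (h : PlanarDomain K T) : IsProperMap q := by
  refine isProperMap_of_comp_of_surj hr.continuous_skeleton (hr.continuous_proj h) ?_ fun z => ?_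
  · have : (q ∘ fun a : skeleton K => r a) = fun a : skeleton K => (a : ℝ × ℝ).1 :=
      funext fun a => hr.proj a a.2.1
    rw [this]
    exact isProperMap_fst_skeleton h
  · obtain ⟨b, hb, hbz⟩ := hr.exists_skeleton h z
    exact ⟨⟨b, hb⟩, hbz⟩

theorem isCompact_fiber (hr : IsVertCollapse K r q) (h : PlanarDomain K T) (z : X) :
    IsCompact ((fun a : skeleton K => r a) ⁻¹' {z}) := by
  have := hr.t1Space h
  refine ((isProperMap_fst_skeleton h).isCompact_preimage (isCompact_singleton (x := q z))).of_isClosed_subset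
    (isClosed_singleton.preimage hr.continuous_skeleton) fun a ha => ?_
  rw [mem_preimage, mem_singleton_iff, ← (show r a = z from ha), hr.proj a a.2.1]

/-- The fibres over `z` and `w` in the skeleton are disjoint compact sets. As the skeleton maps onto
`X` by a closed map, disjoint neighbourhoods of them contain full preimages of neighbourhoods of `z`
and `w`. -/
theorem t2Space (hr : IsVertCollapse K r q) (h : PlanarDomain K T) : T2Space X := by
  refine t2Space_iff_disjoint_nhds.2 fun z w hzw => ?_
  obtain ⟨U, V, hU, hV, hzU, hwV, hUV⟩ :=
    SeparatedNhds.of_isCompact_isCompact (hr.isCompact_fiber h z) (hr.isCompact_fiber h w) <| by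
      rw [disjoint_left]
      exact fun a ha hb => hzw (ha.symm.trans hb)
  have h1 := (hr.isClosedMap_skeleton h).eventually_nhds_fiber (p := (· ∈ U)) z
    fun a ha => hU.mem_nhds (hzU ha)
  have h2 := (hr.isClosedMap_skeleton h).eventually_nhds_fiber (p := (· ∈ V)) w
    fun a ha => hV.mem_nhds (hwV ha)
  refine Filter.disjoint_iff.2 ⟨_, h1, _, h2, disjoint_left.2 fun x hx hx' => ?_⟩
  obtain ⟨b, hb, rfl⟩ := hr.exists_skeleton h x
  exact disjoint_left.1 hUV (hx ⟨b, hb⟩ rfl) (hx' ⟨b, hb⟩ rfl)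

theorem weaklyLocallyCompactSpace (hr : IsVertCollapse K r q) (h : PlanarDomain K T) :
    WeaklyLocallyCompactSpace X where
  exists_compact_mem_nhds z :=
    ⟨_, (hr.isProperMap_proj h).isCompact_preimage (isCompact_Icc (a := q z - 1) (b := q z + 1)),
      (hr.continuous_proj h).continuousAt.preimage_mem_nhds
        (Icc_mem_nhds (by linarith) (by linarith))⟩

theorem sigmaCompactSpace (hr : IsVertCollapse K r q) (h : PlanarDomain K T) :
    SigmaCompactSpace X where
  isSigmaCompact_univ := by
    refine ⟨fun n => q ⁻¹' Icc (-(n : ℝ)) n,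
      fun n => (hr.isProperMap_proj h).isCompact_preimage isCompact_Icc, ?_⟩
    refine eq_univ_of_forall fun z => ?_
    obtain ⟨n, hn⟩ := exists_nat_ge |q z|
    exact mem_iUnion.2 ⟨n, abs_le.1 hn⟩

end IsVertCollapse

/-! ### Vertical segments of a planar domain near a given one -/

/-- Near the vertical segment through `p` every point of `K` is joined vertically in `K` to one of
finitely many arcs issued from `p`. -/
structure IsPlanarStar (K : Set (ℝ × ℝ)) (p : ℝ × ℝ) (δ : ℝ) {n : ℕ} (side : Fin n → ℝ)
    (φ : Fin n → ℝ → ℝ) : Prop where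
  pos : 0 < δ
  side_eq : ∀ i, side i = 1 ∨ side i = -1
  continuousOn : ∀ i, ContinuousOn (φ i) (Ico 0 δ)
  start : ∀ i, φ i 0 = p.2
  mem : ∀ i, ∀ t ∈ Ico 0 δ, (p.1 + side i * t, φ i t) ∈ K
  sep : ∀ i j, i ≠ j → side i = side j → ∀ t ∈ Ioo 0 δ,
    ∃ y ∈ uIcc (φ i t) (φ j t), (p.1 + side i * t, y) ∉ K
  exhaust : ∀ a₀ : ℝ × ℝ, a₀.1 = p.1 → (∀ y ∈ uIcc a₀.2 p.2, (p.1, y) ∈ K) →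
    ∀ᶠ a in 𝓝 a₀, a ∈ K → ∃ i, ∃ t ∈ Ico 0 δ, a.1 = p.1 + side i * t ∧
      ∀ y ∈ uIcc a.2 (φ i t), (a.1, y) ∈ K

namespace PlanarDomain
variable {K T : Set (ℝ × ℝ)}

/-- A point of the complement of `K` near a graph point `p` is strictly on one side of the points
of `K` near a point `e₀` of the vertical segment through `p`. -/
theorem eventually_side {p : ℝ × ℝ} {δ ε s : ℝ} {F : ℝ → ℝ} (hδ : 0 < δ) (hε : 0 < ε)
    (hF0 : F p.1 = p.2)
    (hF : ∀ x y, |x - p.1| < δ → |F x - p.2| < ε ∧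
      (|y - p.2| < ε → ((x, y) ∈ K ↔ 0 ≤ s * (y - F x))))
    {e₀ : ℝ} (he : ∀ y ∈ uIcc p.2 e₀, (p.1, y) ∈ K) (hs : s = 1 ∨ s = -1) :
    ∀ᶠ w : ℝ × ℝ × ℝ in 𝓝 (p.1, e₀, p.2),
      (w.1, w.2.1) ∈ K → (w.1, w.2.2) ∉ K → 0 < s * (w.2.1 - w.2.2) := by
  have hx : ∀ᶠ w : ℝ × ℝ × ℝ in 𝓝 (p.1, e₀, p.2), |w.1 - p.1| < δ :=
    (isOpen_lt (by fun_prop) continuous_const : IsOpen {w : ℝ × ℝ × ℝ | |w.1 - p.1| < δ}).mem_nhds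
      (by simpa using hδ)
  have hy : ∀ᶠ w : ℝ × ℝ × ℝ in 𝓝 (p.1, e₀, p.2), |w.2.2 - p.2| < ε :=
    (isOpen_lt (by fun_prop) continuous_const : IsOpen {w : ℝ × ℝ × ℝ | |w.2.2 - p.2| < ε}).mem_nhds
      (by simpa using hε)
  rcases eq_or_ne e₀ p.2 with rfl | hne
  · have he' : ∀ᶠ w : ℝ × ℝ × ℝ in 𝓝 (p.1, p.2, p.2), |w.2.1 - p.2| < ε :=
      (isOpen_lt (by fun_prop) continuous_const :
        IsOpen {w : ℝ × ℝ × ℝ | |w.2.1 - p.2| < ε}).mem_nhds (by simpa using hε)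
    filter_upwards [hx, hy, he'] with w h1 h2 h3 h4 h5
    have h6 := ((hF w.1 w.2.1 h1).2 h3).1 h4
    have h7 := mt ((hF w.1 w.2.2 h1).2 h2).2 h5
    linarith
  · have hpos : 0 < s * (e₀ - p.2) := by
      have hd : 0 < |e₀ - p.2| := abs_pos.2 (sub_ne_zero.2 hne)
      -- A fraction of the segment towards `e₀` small enough to remain in the box: its end belongs
      -- to `K`, so `e₀` lies on the same side of `p` as `K`.
      set θ := min 1 (ε / (2 * |e₀ - p.2|)) with hθ
      have hθ0 : 0 < θ := lt_min one_pos (by positivity)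
      have hθd : θ * |e₀ - p.2| < ε := by
        have : θ ≤ ε / (2 * |e₀ - p.2|) := min_le_right _ _
        rw [le_div_iff₀ (by positivity)] at this
        linarith
      have hK : (p.1, p.2 + θ * (e₀ - p.2)) ∈ K := he _ (by
        rw [← segment_eq_uIcc, segment_eq_image']
        exact ⟨θ, ⟨hθ0.le, min_le_left _ _⟩, rfl⟩)
      have h1 := ((hF p.1 (p.2 + θ * (e₀ - p.2)) (by simpa using hδ)).2
        (by rw [add_sub_cancel_left, abs_mul, abs_of_pos hθ0]; exact hθd)).1 hK
      rw [hF0, add_sub_cancel_left] at h1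
      have h2 : s * (e₀ - p.2) ≠ 0 :=
        mul_ne_zero (by rcases hs with rfl | rfl <;> norm_num) (sub_ne_zero.2 hne)
      refine lt_of_le_of_ne ?_ h2.symm
      by_contra hneg
      push Not at hneg
      nlinarith
    have : ∀ᶠ w : ℝ × ℝ × ℝ in 𝓝 (p.1, e₀, p.2), 0 < s * (w.2.1 - w.2.2) :=
      (isOpen_lt continuous_const (by fun_prop) :
        IsOpen {w : ℝ × ℝ × ℝ | 0 < s * (w.2.1 - w.2.2)}).mem_nhds (by simpa using hpos)
    filter_upwards [this] with w h1 _ _ using h1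

/-- A vertical segment of `K` persists near each of its ends, as long as this is the case near its
critical points. -/
theorem eventually_vertical_segment (h : PlanarDomain K T) {a₀ : ℝ × ℝ} {F : ℝ → ℝ} {S : Set ℝ}
    (hF : ContinuousWithinAt F S a₀.1) (hseg : ∀ y ∈ uIcc a₀.2 (F a₀.1), (a₀.1, y) ∈ K)
    (hcrit : ∀ y₀ ∈ uIcc a₀.2 (F a₀.1), (a₀.1, y₀) ∈ T → ∀ᶠ w : (ℝ × ℝ) × ℝ in 𝓝 (a₀, y₀),
      w.1 ∈ K → w.1.1 ∈ S → w.2 ∈ uIcc w.1.2 (F w.1.1) → (w.1.1, w.2) ∈ K) :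
    ∀ᶠ a in 𝓝 a₀, a ∈ K → a.1 ∈ S → (a.1, F a.1) ∈ K →
      ∀ y ∈ uIcc a.2 (F a.1), (a.1, y) ∈ K := by
  have hFt : Tendsto (fun a : ℝ × ℝ => F a.1) (𝓝[Prod.fst ⁻¹' S] a₀) (𝓝 (F a₀.1)) :=
    hF.tendsto.comp (continuousWithinAt_fst.tendsto_nhdsWithin fun a ha => ha)
  set M := max |a₀.2| |F a₀.1| + 1
  have hM : ∀ᶠ a in 𝓝 a₀, a.1 ∈ S → |a.2| < M ∧ |F a.1| < M := by
    have h1 : ∀ᶠ a in 𝓝 a₀, |a.2| < M :=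
      (isOpen_lt (by fun_prop) continuous_const : IsOpen {a : ℝ × ℝ | |a.2| < M}).mem_nhds
        (show |a₀.2| < M from (le_max_left _ _).trans_lt (lt_add_one _))
    have h2 : ∀ᶠ a in 𝓝[Prod.fst ⁻¹' S] a₀, |F a.1| < M :=
      hFt.eventually ((isOpen_lt continuous_abs continuous_const).mem_nhds
        ((le_max_right _ _).trans_lt (lt_add_one _)))
    filter_upwards [h1, eventually_nhdsWithin_iff.1 h2] with a h3 h4 h5 using ⟨h3, h4 h5⟩
  -- By compactness it suffices to fill the segment near each ordinate `y₀`. There are four cases: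
  -- `y₀` off the limit segment, critical (the hypothesis), interior to `K`, or a graph point. The
  -- set `S` allows `F` to be a branch living on one side only.
  have hloc : ∀ y₀ ∈ Icc (-M) M, ∀ᶠ w : (ℝ × ℝ) × ℝ in 𝓝 (a₀, y₀), w.1 ∈ K → w.1.1 ∈ S →
      (w.1.1, F w.1.1) ∈ K → w.2 ∈ uIcc w.1.2 (F w.1.1) → (w.1.1, w.2) ∈ K := by
    intro y₀ _
    have hFw : Tendsto (fun w : (ℝ × ℝ) × ℝ => F w.1.1) (𝓝[{w | w.1.1 ∈ S}] (a₀, y₀))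
        (𝓝 (F a₀.1)) :=
      hFt.comp (continuousWithinAt_fst.tendsto_nhdsWithin fun w hw => hw)
    have hid : Tendsto (fun w : (ℝ × ℝ) × ℝ => w) (𝓝[{w | w.1.1 ∈ S}] (a₀, y₀)) (𝓝 (a₀, y₀)) :=
      tendsto_id'.2 nhdsWithin_le_nhds
    by_cases hy₀ : y₀ ∈ uIcc a₀.2 (F a₀.1)
    swap
    · have hopen : IsOpen {w : ℝ × ℝ × ℝ | w.2.2 ∉ uIcc w.1 w.2.1} := by
        have : {w : ℝ × ℝ × ℝ | w.2.2 ∉ uIcc w.1 w.2.1} =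
            ({w | min w.1 w.2.1 ≤ w.2.2} ∩ {w | w.2.2 ≤ max w.1 w.2.1})ᶜ := by
          ext w; simp only [uIcc, mem_Icc, mem_ofPred_eq, mem_compl_iff, mem_inter_iff]
        rw [this]
        exact ((isClosed_le (by fun_prop) (by fun_prop)).inter
          (isClosed_le (by fun_prop) (by fun_prop))).isOpen_compl
      have hev := (((continuous_snd.comp continuous_fst).tendsto _ |>.comp hid).prodMk_nhds
        (hFw.prodMk_nhds ((continuous_snd.tendsto _).comp hid))).eventually (hopen.mem_nhds hy₀)
      filter_upwards [eventually_nhdsWithin_iff.1 hev] with w h1 _ h2 _ h3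
      exact absurd h3 (h1 h2)
    by_cases hT : (a₀.1, y₀) ∈ T
    · filter_upwards [hcrit y₀ hy₀ hT] with w h1 h2 h3 _ h4 using h1 h2 h3 h4
    by_cases hfr : (a₀.1, y₀) ∈ frontier K
    swap
    · have hint : K ∈ 𝓝 (a₀.1, y₀) := by
        by_contra hne
        exact hfr ⟨_root_.subset_closure (hseg y₀ hy₀), fun hi => hne (mem_interior_iff_mem_nhds.1 hi)⟩
      have hc : Continuous fun w : (ℝ × ℝ) × ℝ => (w.1.1, w.2) := by fun_prop
      filter_upwards [hc.continuousAt.preimage_mem_nhds hint] with w h1 _ _ _ _ using h1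
    obtain ⟨δ, ε, s, G, hδ, hε, hs, -, hG0, hG⟩ := h.isGraphPoint hfr hT
    -- A point missing from `K` near a graph point has both ends of the segment strictly on the same
    -- side, so it cannot lie between them.
    have h1 := eventually_side (p := (a₀.1, y₀)) hδ hε hG0 hG (e₀ := a₀.2)
      (fun y hy => hseg y (uIcc_subset_uIcc hy₀ left_mem_uIcc hy)) hs
    have h2 := eventually_side (p := (a₀.1, y₀)) hδ hε hG0 hG (e₀ := F a₀.1)
      (fun y hy => hseg y (uIcc_subset_uIcc hy₀ right_mem_uIcc hy)) hs
    have c1 : Tendsto (fun w : (ℝ × ℝ) × ℝ => (w.1.1, w.1.2, w.2)) (𝓝[{w | w.1.1 ∈ S}] (a₀, y₀))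
        (𝓝 (a₀.1, a₀.2, y₀)) :=
      ((by fun_prop : Continuous fun w : (ℝ × ℝ) × ℝ => (w.1.1, w.1.2, w.2)).tendsto (a₀, y₀)).comp hid
    have c2 : Tendsto (fun w : (ℝ × ℝ) × ℝ => (w.1.1, F w.1.1, w.2))
        (𝓝[{w | w.1.1 ∈ S}] (a₀, y₀)) (𝓝 (a₀.1, F a₀.1, y₀)) :=
      (((continuous_fst.comp continuous_fst).tendsto _).comp hid).prodMk_nhds
        (hFw.prodMk_nhds ((continuous_snd.tendsto _).comp hid))
    filter_upwards [eventually_nhdsWithin_iff.1 (c1.eventually h1),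
      eventually_nhdsWithin_iff.1 (c2.eventually h2)] with w h3 h4 h5 h6 h7 h8
    by_contra h9
    have h10 := h3 h6 h5 h9
    have h11 := h4 h6 h7 h9
    rw [mem_uIcc] at h8
    rcases hs with rfl | rfl <;> rcases h8 with h8 | h8 <;> linarith [h8.1, h8.2]
  have := isCompact_Icc.eventually_forall_of_forall_eventually (x₀ := a₀) (K := Icc (-M) M)
    (P := fun a y => a ∈ K → a.1 ∈ S → (a.1, F a.1) ∈ K → y ∈ uIcc a.2 (F a.1) → (a.1, y) ∈ K) hloc
  filter_upwards [this, hM] with a h1 h2 h3 h4 h5 y hy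
  refine h1 y ?_ h3 h4 h5 hy
  have h6 := abs_lt.1 (h2 h4).1
  have h7 := abs_lt.1 (h2 h4).2
  rw [mem_uIcc] at hy
  rcases hy with hy | hy <;> constructor <;> linarith [hy.1, hy.2]


/-- Near a vertical segment free of critical points, the vertical segments of `K` are parametrized
by their abscissa. -/
theorem exists_transversal (h : PlanarDomain K T) {p : ℝ × ℝ} (hp : p ∈ K)
    (hT : ∀ y, (∀ y' ∈ uIcc y p.2, (p.1, y') ∈ K) → (p.1, y) ∉ T) :
    ∃ δ > 0, ∃ F : ℝ → ℝ, ContinuousOn F (Ioo (p.1 - δ) (p.1 + δ)) ∧ F p.1 = p.2 ∧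
      (∀ x ∈ Ioo (p.1 - δ) (p.1 + δ), (x, F x) ∈ K) ∧
      ∀ a₀ : ℝ × ℝ, a₀.1 = p.1 → (∀ y ∈ uIcc a₀.2 p.2, (p.1, y) ∈ K) →
        ∀ᶠ a in 𝓝 a₀, a ∈ K → ∀ y ∈ uIcc a.2 (F a.1), (a.1, y) ∈ K := by
  obtain ⟨δ, hδ, F, hF, hF0, hFK⟩ : ∃ δ > 0, ∃ F : ℝ → ℝ,
      ContinuousOn F (Ioo (p.1 - δ) (p.1 + δ)) ∧ F p.1 = p.2 ∧
      ∀ x ∈ Ioo (p.1 - δ) (p.1 + δ), (x, F x) ∈ K := by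
    by_cases hfr : p ∈ frontier K
    · obtain ⟨δ, ε, s, G, hδ, hε, hs, hGc, hG0, hG⟩ := h.isGraphPoint hfr (hT p.2 (by simpa using hp))
      refine ⟨δ, hδ, G, hGc, hG0, fun x hx => ?_⟩
      have hx' : |x - p.1| < δ := by rw [abs_lt]; constructor <;> linarith [hx.1, hx.2]
      exact ((hG x (G x) hx').2 (hG x 0 hx').1).2 (by simp)
    · have hint : K ∈ 𝓝 p := by
        by_contra hne
        exact hfr ⟨_root_.subset_closure hp, fun hi => hne (mem_interior_iff_mem_nhds.1 hi)⟩
      have hc : Continuous fun x : ℝ => (x, p.2) := by fun_prop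
      obtain ⟨δ, hδ, hδK⟩ := Metric.mem_nhds_iff.1
        (hc.continuousAt.preimage_mem_nhds (x := p.1) hint)
      rw [Real.ball_eq_Ioo] at hδK
      exact ⟨δ, hδ, fun _ => p.2, continuousOn_const, rfl, fun x hx => hδK hx⟩
  refine ⟨δ, hδ, F, hF, hF0, hFK, fun a₀ ha₀ hseg => ?_⟩
  have hx₀ : p.1 ∈ Ioo (p.1 - δ) (p.1 + δ) := ⟨by linarith, by linarith⟩
  have := h.eventually_vertical_segment (a₀ := a₀) (F := F) (S := Ioo (p.1 - δ) (p.1 + δ))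
    (by rw [ha₀]; exact hF _ hx₀) (by rw [ha₀, hF0]; exact hseg) (fun y₀ hy₀ hyT => by
      rw [ha₀] at hyT hy₀
      rw [hF0] at hy₀
      exact absurd hyT (hT y₀ fun y' hy' => hseg y' (uIcc_subset_uIcc hy₀ right_mem_uIcc hy')))
  have hev : ∀ᶠ a in 𝓝 a₀, a.1 ∈ Ioo (p.1 - δ) (p.1 + δ) :=
    (isOpen_Ioo.preimage continuous_fst).mem_nhds (by rw [mem_preimage, ha₀]; exact hx₀)
  filter_upwards [this, hev] with a h1 h2 h3 using h1 h3 h2 (hFK _ h2)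

/-- The slice of `K` through `p` reduces to `p` nearby, so the whole critical segment is `{p}`. The
single arc is taken along the lower branch `f`; every point of `K` near `p` drops vertically onto
it. -/
theorem isPlanarStar_endPoint {p : ℝ × ℝ} (hp : IsEndPoint K p) :
    ∃ δ side φ, IsPlanarStar K p δ (n := 1) side φ := by
  obtain ⟨δ, ε, σ, f, g, hδ, hε, hσ, hf, -, hf0, hg0, hfg, hb, hK⟩ := hp
  have hσ2 : σ * σ = 1 := by rcases hσ with rfl | rfl <;> norm_num
  have hfgle : ∀ t ∈ Ico 0 δ, f t ≤ g t := fun t ht => by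
    rcases ht.1.eq_or_lt with rfl | h0
    · rw [hf0, hg0]
    · exact (hfg t ⟨h0, ht.2⟩).le
  refine ⟨δ, fun _ => σ, fun _ => f, hδ, fun _ => hσ, fun _ => hf, fun _ => hf0, fun _ t ht => ?_,
    fun i j hij => absurd (Subsingleton.elim i j) hij, fun a₀ ha₀ hseg => ?_⟩
  · exact (hK t (f t) (by rw [abs_of_nonneg ht.1]; exact ht.2) (hb t ht).1).2
      ⟨ht.1, le_rfl, hfgle t ht⟩
  · have hline : ∀ y, |y - p.2| < ε → (p.1, y) ∈ K → y = p.2 := fun y hy hyK => by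
      have := (hK 0 y (by simpa using hδ) hy).1 (by simpa using hyK)
      rw [hf0, hg0] at this
      exact le_antisymm this.2.2 this.2.1
    have ha : a₀ = p := by
      refine Prod.ext ha₀ ?_
      by_contra hne
      have hd : 0 < |a₀.2 - p.2| := abs_pos.2 (sub_ne_zero.2 hne)
      set θ := min 1 (ε / (2 * |a₀.2 - p.2|)) with hθ
      have hθ0 : 0 < θ := lt_min one_pos (by positivity)
      have hθd : θ * |a₀.2 - p.2| < ε := by
        have : θ ≤ ε / (2 * |a₀.2 - p.2|) := min_le_right _ _
        rw [le_div_iff₀ (by positivity)] at this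
        linarith
      have h1 := hline (p.2 + θ * (a₀.2 - p.2))
        (by rw [add_sub_cancel_left, abs_mul, abs_of_pos hθ0]; exact hθd) (hseg _ (by
          rw [uIcc_comm, ← segment_eq_uIcc, segment_eq_image']
          exact ⟨θ, ⟨hθ0.le, min_le_left _ _⟩, rfl⟩))
      have h2 : θ * (a₀.2 - p.2) ≠ 0 := mul_ne_zero hθ0.ne' (sub_ne_zero.2 hne)
      exact h2 (by linarith)
    rw [ha]
    filter_upwards [box_mem_nhds p hδ hε] with a h1 haK
    have h3 : |σ * (a.1 - p.1)| < δ := by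
      rw [abs_mul]; rcases hσ with rfl | rfl <;> simpa using h1.1
    have hxa : a.1 = p.1 + σ * (σ * (a.1 - p.1)) := by linear_combination (p.1 - a.1) * hσ2
    have h4 := (hK _ a.2 h3 h1.2).1 (hxa ▸ haK)
    have ht : σ * (a.1 - p.1) ∈ Ico 0 δ := ⟨h4.1, (abs_lt.1 h3).2⟩
    refine ⟨0, _, ht, hxa, fun y hy => ?_⟩
    rw [uIcc_of_ge h4.2.1] at hy
    have hb1 := abs_lt.1 (hb _ ht).1
    have hb2 := abs_lt.1 h1.2
    rw [hxa]
    exact (hK _ y h3 (abs_lt.2 ⟨by linarith [hy.1], by linarith [hy.2]⟩)).2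
      ⟨h4.1, hy.1, hy.2.trans h4.2.2⟩

/-- On the unfolded side the vertical segment persists, giving the horizontal arc through `p`. On
the folded side the gap between `f` and `g` cuts it in two, and the branches themselves serve as
arcs. -/
theorem isPlanarStar_splitPoint (h : PlanarDomain K T) {p : ℝ × ℝ} (hpT : p ∈ T)
    (hp : IsSplitPoint K p) : ∃ δ side φ, IsPlanarStar K p δ (n := 3) side φ := by
  obtain ⟨δ, ε, σ, f, g, hδ, hε, hσ, hf, hg, hf0, hg0, hfg, hb, hK⟩ := hp
  have hσ2 : σ * σ = 1 := by rcases hσ with rfl | rfl <;> norm_num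
  have hσabs : |σ| = 1 := by rcases hσ with rfl | rfl <;> norm_num
  have hfgle : ∀ t ∈ Ico 0 δ, f t ≤ g t := fun t ht => by
    rcases ht.1.eq_or_lt with rfl | h0
    · rw [hf0, hg0]
    · exact (hfg t ⟨h0, ht.2⟩).le
  have habs : ∀ {t}, t ∈ Ico 0 δ → |t| < δ := fun ht => by rw [abs_of_nonneg ht.1]; exact ht.2
  let τ : ℝ → ℝ := fun x => σ * (x - p.1)
  have hτ : Continuous τ := by fun_prop
  have hτx : ∀ x, x = p.1 + σ * τ x := fun x => by
    simp only [τ]; linear_combination (p.1 - x) * hσ2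
  have hτp : τ p.1 = 0 := by simp [τ]
  have hτabs : ∀ x, |τ x| = |x - p.1| := fun x => by simp only [τ]; rw [abs_mul, hσabs, one_mul]
  have hKx : ∀ x y, |x - p.1| < δ → |y - p.2| < ε →
      ((x, y) ∈ K ↔ ¬ (0 < τ x ∧ f (τ x) < y ∧ y < g (τ x))) := fun x y hx hy => by
    have := hK (τ x) y (by rwa [hτabs]) hy
    rwa [← hτx] at this
  have hpK : p ∈ K := h.isClosed.frontier_subset (h.subset hpT)
  have hfK : ∀ t ∈ Ico 0 δ, (p.1 + σ * t, f t) ∈ K := fun t ht =>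
    (hK t (f t) (habs ht) (hb t ht).1).2 fun h' => h'.2.1.false
  have hgK : ∀ t ∈ Ico 0 δ, (p.1 + σ * t, g t) ∈ K := fun t ht =>
    (hK t (g t) (habs ht) (hb t ht).2).2 fun h' => h'.2.2.false
  have hmid : ∀ t ∈ Ioo 0 δ, (f t + g t) / 2 ∈ Icc (f t) (g t) ∧
      (p.1 + σ * t, (f t + g t) / 2) ∉ K := fun t ht => by
    have h1 := hfg t ht
    have ht' : t ∈ Ico 0 δ := ⟨ht.1.le, ht.2⟩
    have h2 := abs_lt.1 (hb t ht').1
    have h3 := abs_lt.1 (hb t ht').2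
    refine ⟨⟨by linarith, by linarith⟩, fun hk => ?_⟩
    exact (hK t _ (habs ht') (abs_lt.2 ⟨by linarith, by linarith⟩)).1 hk
      ⟨ht.1, by linarith, by linarith⟩
  refine ⟨δ, ![-σ, σ, σ], ![fun _ => p.2, f, g], hδ, fun i => ?_, fun i => ?_, fun i => ?_,
    fun i t ht => ?_, fun i j hij hs t ht => ?_, fun a₀ ha₀ hseg => ?_⟩
  · fin_cases i <;> rcases hσ with rfl | rfl <;> simp
  · fin_cases i
    · exact continuousOn_const
    · exact hf
    · exact hg
  · fin_cases i
    · rfl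
    · exact hf0
    · exact hg0
  · fin_cases i
    · have h1 := (hK (-t) p.2 (by rw [abs_neg]; exact habs ht) (by simpa using hε)).2
        fun h' => by linarith [h'.1, ht.1]
      simpa using h1
    · exact hfK t ht
    · exact hgK t ht
  · have hσ0 : σ ≠ 0 := by rcases hσ with rfl | rfl <;> norm_num
    have hne : -σ ≠ σ := fun h' => hσ0 (by linarith)
    have h1 := hmid t ht
    have h2 := hfg t ht
    fin_cases i <;> fin_cases j <;> simp at hij hs ⊢ <;> first
      | exact absurd hs hne
      | exact absurd hs.symm hne
      | exact ⟨_, by rw [uIcc_of_le h2.le]; exact h1.1, h1.2⟩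
      | exact ⟨_, by rw [uIcc_of_ge h2.le]; exact h1.1, h1.2⟩
  -- Genericity: the only critical point to be examined on this vertical line is `p`.
  · have hTp : ∀ y₀, (a₀.1, y₀) ∈ T → y₀ = p.2 := fun y₀ hy => by
      have := h.injOn hy hpT ha₀
      rw [← this]
    have hbox : ∀ᶠ a in 𝓝 a₀, |a.1 - p.1| < δ := by
      rw [← ha₀]
      exact (isOpen_lt (by fun_prop) continuous_const :
        IsOpen {a : ℝ × ℝ | |a.1 - a₀.1| < δ}).mem_nhds (by simpa using hδ)
    have hboxw : ∀ᶠ w : (ℝ × ℝ) × ℝ in 𝓝 (a₀, p.2), |w.1.1 - p.1| < δ ∧ |w.2 - p.2| < ε := by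
      have h1 : IsOpen {w : (ℝ × ℝ) × ℝ | |w.1.1 - p.1| < δ} :=
        isOpen_lt (by fun_prop) continuous_const
      have h2 : IsOpen {w : (ℝ × ℝ) × ℝ | |w.2 - p.2| < ε} :=
        isOpen_lt (by fun_prop) continuous_const
      exact (h1.inter h2).mem_nhds ⟨by simpa [ha₀] using hδ, by simpa using hε⟩
    have hA : ∀ᶠ a in 𝓝 a₀, a ∈ K → τ a.1 ≤ 0 → ∀ y ∈ uIcc a.2 p.2, (a.1, y) ∈ K := by
      have := h.eventually_vertical_segment (a₀ := a₀) (F := fun _ => p.2) (S := {x | τ x ≤ 0})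
        continuousWithinAt_const (by rw [ha₀]; exact hseg) (fun y₀ _ hyT => by
          rw [hTp y₀ hyT]
          filter_upwards [hboxw] with w h1 _ h2 _
          exact (hKx _ _ h1.1 h1.2).2 fun h3 => (h3.1.trans_le h2).false)
      filter_upwards [this, hbox] with a h1 h2 h3 h4
      exact h1 h3 h4 ((hKx _ _ h2 (by simpa using hε)).2 fun h3 => (h3.1.trans_le h4).false)
    -- On the folded side, points near a point of the segment below `p` are joined to `f` and points
    -- near one above `p` to `g`. Near `p` itself the choice depends on the point.
    have hB : ∀ᶠ a in 𝓝 a₀, a ∈ K → τ a.1 ∈ Ico 0 δ →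
        (∀ y ∈ uIcc a.2 (f (τ a.1)), (a.1, y) ∈ K) ∨ ∀ y ∈ uIcc a.2 (g (τ a.1)), (a.1, y) ∈ K := by
      have hcont : ∀ k : ℝ → ℝ, ContinuousOn k (Ico 0 δ) →
          ContinuousWithinAt (fun x => k (τ x)) {x | τ x ∈ Ico 0 δ} a₀.1 := fun k hk => by
        have h0 : τ a₀.1 ∈ Ico 0 δ := by rw [ha₀, hτp]; exact ⟨le_rfl, hδ⟩
        exact (hk _ h0).comp hτ.continuousWithinAt fun x hx => hx
      rcases lt_trichotomy a₀.2 p.2 with hlt | heq | hlt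
      · have := h.eventually_vertical_segment (a₀ := a₀) (hcont f hf)
          (by rw [ha₀, hτp, hf0]; exact hseg) (fun y₀ _ hyT => by
            rw [hTp y₀ hyT]
            have hlt' : ∀ᶠ w : (ℝ × ℝ) × ℝ in 𝓝 (a₀, p.2), w.1.2 < w.2 :=
              (isOpen_lt (by fun_prop) (by fun_prop) :
                IsOpen {w : (ℝ × ℝ) × ℝ | w.1.2 < w.2}).mem_nhds hlt
            filter_upwards [hboxw, hlt'] with w h1 h2 _ h3 h4
            refine (hKx _ _ h1.1 h1.2).2 fun h5 => ?_
            rw [mem_uIcc] at h4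
            rcases h4 with h4 | h4 <;> linarith [h4.1, h4.2, h5.2.1])
        filter_upwards [this] with a h1 h2 h3
        exact Or.inl (h1 h2 h3 (by have := hfK _ h3; rwa [← hτx] at this))
      · have ha : a₀ = p := Prod.ext ha₀ heq
        rw [ha]
        filter_upwards [box_mem_nhds p hδ hε] with a h1 h2 h3
        have h4 := (hKx _ a.2 h1.1 h1.2).1 h2
        have hbf := abs_lt.1 (hb _ h3).1
        have hbg := abs_lt.1 (hb _ h3).2
        have hba := abs_lt.1 h1.2
        rcases h3.1.eq_or_lt with h0 | h0
        · left
          intro y hy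
          rw [mem_uIcc] at hy
          refine (hKx _ _ h1.1 (abs_lt.2 ?_)).2 fun h5 => (h0 ▸ h5.1).false
          rcases hy with hy | hy <;> constructor <;> linarith [hy.1, hy.2]
        · rcases le_or_gt a.2 (f (τ a.1)) with h5 | h5
          · left
            intro y hy
            rw [uIcc_of_le h5] at hy
            refine (hKx _ _ h1.1 (abs_lt.2 ?_)).2 fun h6 => (h6.2.1.trans_le hy.2).false
            constructor <;> linarith [hy.1, hy.2]
          · right
            have h6 : g (τ a.1) ≤ a.2 := by
              by_contra h7
              exact h4 ⟨h0, h5, not_le.1 h7⟩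
            intro y hy
            rw [uIcc_of_ge h6] at hy
            refine (hKx _ _ h1.1 (abs_lt.2 ?_)).2 fun h6 => (h6.2.2.trans_le hy.1).false
            constructor <;> linarith [hy.1, hy.2]
      · have := h.eventually_vertical_segment (a₀ := a₀) (hcont g hg)
          (by rw [ha₀, hτp, hg0]; exact hseg) (fun y₀ _ hyT => by
            rw [hTp y₀ hyT]
            have hlt' : ∀ᶠ w : (ℝ × ℝ) × ℝ in 𝓝 (a₀, p.2), w.2 < w.1.2 :=
              (isOpen_lt (by fun_prop) (by fun_prop) :
                IsOpen {w : (ℝ × ℝ) × ℝ | w.2 < w.1.2}).mem_nhds hlt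
            filter_upwards [hboxw, hlt'] with w h1 h2 _ h3 h4
            refine (hKx _ _ h1.1 h1.2).2 fun h5 => ?_
            rw [mem_uIcc] at h4
            rcases h4 with h4 | h4 <;> linarith [h4.1, h4.2, h5.2.2])
        filter_upwards [this] with a h1 h2 h3
        exact Or.inr (h1 h2 h3 (by have := hgK _ h3; rwa [← hτx] at this))
    filter_upwards [hA, hB, hbox] with a h1 h2 h3 h4
    rcases le_total (τ a.1) 0 with h5 | h5
    · refine ⟨0, -τ a.1, ⟨by linarith, ?_⟩, ?_, h1 h4 h5⟩
      · have := abs_lt.1 ((hτabs a.1).trans_lt h3); linarith [this.1]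
      · have := hτx a.1
        simpa using this
    · have h6 : τ a.1 ∈ Ico 0 δ := ⟨h5, (abs_lt.1 ((hτabs a.1).trans_lt h3)).2⟩
      rcases h2 h4 h6 with h7 | h7
      · exact ⟨1, _, h6, hτx a.1, h7⟩
      · exact ⟨2, _, h6, hτx a.1, h7⟩

theorem exists_isPlanarStar (h : PlanarDomain K T) {p : ℝ × ℝ} (hpT : p ∈ T) :
    ∃ n, (n = 1 ∨ n = 3) ∧ ∃ δ, ∃ (side : Fin n → ℝ) (φ : Fin n → ℝ → ℝ),
      IsPlanarStar K p δ side φ := by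
  rcases h.endPoint_or_splitPoint hpT with hp | hp
  · exact ⟨1, Or.inl rfl, isPlanarStar_endPoint hp⟩
  · exact ⟨3, Or.inr rfl, h.isPlanarStar_splitPoint hpT hp⟩

end PlanarDomain

/-! ### Branched lines -/

/-- Near `v` the space is a union of `n` arcs issued from `v`, disjoint elsewhere, which `q` maps
injectively to the line. -/
structure IsStar {X : Type*} [TopologicalSpace X] (q : X → ℝ) (v : X) (δ : ℝ) {n : ℕ}
    (side : Fin n → ℝ) (β : Fin n → ℝ → X) : Prop where
  pos : 0 < δ
  side_eq : ∀ i, side i = 1 ∨ side i = -1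
  continuousOn : ∀ i, ContinuousOn (β i) (Ico 0 δ)
  start : ∀ i, β i 0 = v
  proj : ∀ i, ∀ t ∈ Ico 0 δ, q (β i t) = q v + side i * t
  ne : ∀ i j, i ≠ j → side i = side j → ∀ t ∈ Ioo 0 δ, β i t ≠ β j t
  exhaust : ∀ᶠ w in 𝓝 v, ∃ i, ∃ t ∈ Ico 0 δ, w = β i t

/-- The space `X` is a one-dimensional complex with `V` as its set of singular points, and `q` is
locally injective in restriction to its strata. -/
structure IsBranchedLine {X : Type*} [TopologicalSpace X] (q : X → ℝ) (V : Set X) : Prop where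
  proper : IsProperMap q
  finite : V.Finite
  injOn : InjOn q V
  regular : ∀ z ∉ V, ∃ δ > 0, ∃ σ : ℝ → X, ContinuousOn σ (Ioo (q z - δ) (q z + δ)) ∧
    (∀ x ∈ Ioo (q z - δ) (q z + δ), q (σ x) = x) ∧ ∀ᶠ w in 𝓝 z, σ (q w) = w
  branch : ∀ v ∈ V, ∃ n, (n = 1 ∨ n = 3) ∧ ∃ δ, ∃ (side : Fin n → ℝ) (β : Fin n → ℝ → X),
    IsStar q v δ side β

/-! ### From planar stars to the quotient and its section -/

namespace IsVertCollapse

variable {K T : Set (ℝ × ℝ)} {X : Type*} [TopologicalSpace X] {r : ℝ × ℝ → X} {q : X → ℝ}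

/-- Transfers a property valid near every point of a class to the neighbouring classes: the closed
map from the skeleton makes a neighbourhood of a fibre contain all nearby fibres. -/
theorem eventually_exists (hr : IsVertCollapse K r q) (h : PlanarDomain K T) {z : X}
    {p : ℝ × ℝ → Prop} (hp : ∀ a ∈ K, r a = z → ∀ᶠ a' in 𝓝 a, a' ∈ K → p a') :
    ∀ᶠ w in 𝓝 z, ∃ a ∈ K, r a = w ∧ p a := by
  have := (hr.isClosedMap_skeleton h).eventually_nhds_fiber (p := fun a => p a) z
    fun a ha => by
      filter_upwards [continuousAt_subtype_val.eventually (hp a a.2.1 ha)] with b hb using hb b.2.1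
  filter_upwards [this] with w hw
  obtain ⟨b, hb, hbw⟩ := hr.exists_skeleton h w
  exact ⟨b, hb.1, hbw, hw ⟨b, hb⟩ hbw⟩

theorem segment_of_eq (hr : IsVertCollapse K r q) {a b : ℝ × ℝ} (ha : a ∈ K) (hb : b ∈ K)
    (hab : r a = r b) : a.1 = b.1 ∧ ∀ y ∈ uIcc a.2 b.2, (b.1, y) ∈ K := by
  have := (hr.eq_iff a ha b hb).1 hab
  exact ⟨this.1, this.1 ▸ this.2⟩

theorem exists_transversal (hr : IsVertCollapse K r q) (h : PlanarDomain K T) {z : X}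
    (hz : z ∉ r '' T) : ∃ δ > 0, ∃ F : ℝ → ℝ, ContinuousOn F (Ioo (q z - δ) (q z + δ)) ∧
      (∀ x ∈ Ioo (q z - δ) (q z + δ), (x, F x) ∈ K) ∧ ∀ᶠ w in 𝓝 z, r (q w, F (q w)) = w := by
  obtain ⟨p, hp, rfl⟩ := hr.surj z
  have hTK : T ⊆ K := h.subset.trans h.isClosed.frontier_subset
  obtain ⟨δ, hδ, F, hF, hF0, hFK, hFs⟩ := h.exists_transversal hp fun y hy hyT => hz
    ⟨_, hyT, (hr.eq_iff _ (hTK hyT) p hp).2 ⟨rfl, hy⟩⟩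
  rw [hr.proj p hp]
  refine ⟨δ, hδ, F, hF, hFK, ?_⟩
  have h1 := hr.eventually_exists h (z := r p) (p := fun a => ∀ y ∈ uIcc a.2 (F a.1), (a.1, y) ∈ K)
    fun a ha haz => hFs a (hr.segment_of_eq ha hp haz).1 (hr.segment_of_eq ha hp haz).2
  filter_upwards [h1] with w hw
  obtain ⟨a, ha, rfl, haF⟩ := hw
  rw [hr.proj a ha]
  exact ((hr.eq_iff a ha (a.1, F a.1) (haF _ right_mem_uIcc)).2 ⟨rfl, haF⟩).symm

theorem isStar (hr : IsVertCollapse K r q) (h : PlanarDomain K T) {p : ℝ × ℝ} (hp : p ∈ K) {δ : ℝ}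
    {n : ℕ} {side : Fin n → ℝ} {φ : Fin n → ℝ → ℝ} (hs : IsPlanarStar K p δ side φ) :
    IsStar q (r p) δ side fun i t => r (p.1 + side i * t, φ i t) where
  pos := hs.pos
  side_eq := hs.side_eq
  continuousOn i := hr.continuousOn.comp
    ((by fun_prop : ContinuousOn (fun t => p.1 + side i * t) (Ico 0 δ)).prodMk (hs.continuousOn i))
    (hs.mem i)
  start i := by rw [hs.start i]; simp
  proj i t ht := by rw [hr.proj _ (hs.mem i t ht), hr.proj _ hp]
  ne i j hij hsij t ht heq := by
    have ht' : t ∈ Ico 0 δ := ⟨ht.1.le, ht.2⟩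
    obtain ⟨y, hy, hyK⟩ := hs.sep i j hij hsij t ht
    exact hyK (((hr.eq_iff _ (hs.mem i t ht') _ (hs.mem j t ht')).1 heq).2 y hy)
  exhaust := by
    have h1 := hr.eventually_exists h (z := r p) (p := fun a => ∃ i, ∃ t ∈ Ico 0 δ,
        a.1 = p.1 + side i * t ∧ ∀ y ∈ uIcc a.2 (φ i t), (a.1, y) ∈ K)
      fun a ha haz => hs.exhaust a (hr.segment_of_eq ha hp haz).1 (hr.segment_of_eq ha hp haz).2
    filter_upwards [h1] with w hw
    obtain ⟨a, ha, rfl, i, t, ht, hat, hy⟩ := hw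
    exact ⟨i, t, ht, (hr.eq_iff _ ha _ (hs.mem i t ht)).2 ⟨hat, hy⟩⟩

theorem isBranchedLine (hr : IsVertCollapse K r q) (h : PlanarDomain K T) :
    IsBranchedLine q (r '' T) where
  proper := hr.isProperMap_proj h
  finite := h.finite.image r
  injOn := by
    have hTK : T ⊆ K := h.subset.trans h.isClosed.frontier_subset
    rintro _ ⟨a, ha, rfl⟩ _ ⟨b, hb, rfl⟩ hab
    rw [hr.proj a (hTK ha), hr.proj b (hTK hb)] at hab
    rw [h.injOn ha hb hab]
  regular z hz := by
    obtain ⟨δ, hδ, F, hF, hFK, hFz⟩ := hr.exists_transversal h hz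
    exact ⟨δ, hδ, fun x => r (x, F x), hr.continuousOn.comp (continuousOn_id.prodMk hF) hFK,
      fun x hx => hr.proj _ (hFK x hx), hFz⟩
  branch := by
    rintro _ ⟨p, hp, rfl⟩
    obtain ⟨n, hn, δ, side, φ, hs⟩ := h.exists_isPlanarStar hp
    exact ⟨n, hn, δ, side, _, hr.isStar h (h.isClosed.frontier_subset (h.subset hp)) hs⟩

/-- A planar star provides a continuous choice of ordinates near the class of its center. -/
theorem exists_continuousOn_of_star (hr : IsVertCollapse K r q) (h : PlanarDomain K T)
    {p : ℝ × ℝ} (hp : p ∈ K) {δ : ℝ} {n : ℕ} {side : Fin n → ℝ} {φ : Fin n → ℝ → ℝ}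
    (hs : IsPlanarStar K p δ side φ) :
    ∃ U ∈ 𝓝 (r p), ∃ g : X → ℝ, ContinuousOn g U ∧ ∀ w ∈ U, (q w, g w) ∈ K ∧ r (q w, g w) = w := by
  classical
  have hst := hr.isStar h hp hs
  set β : Fin n → ℝ → X := fun i t => r (p.1 + side i * t, φ i t)
  have := hr.t2Space h
  have hqc := hr.continuous_proj h
  have hss : ∀ i, side i * side i = 1 := fun i => by rcases hs.side_eq i with h' | h' <;> simp [h']
  have hδ := hs.pos
  have hI : Icc 0 (δ / 2) ⊆ Ico 0 δ := Icc_subset_Ico_right (by linarith)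
  let τ : Fin n → X → ℝ := fun i w => side i * (q w - q (r p))
  have hτ : ∀ i, ∀ t ∈ Ico 0 δ, τ i (β i t) = t := fun i t ht => by
    simp only [τ]
    rw [hst.proj i t ht]
    linear_combination t * hss i
  -- Half-length closed arcs, so that functions defined on them glue continuously over a finite
  -- closed cover.
  let A : Fin n → Set X := fun i => β i '' Icc 0 (δ / 2)
  have hA : ∀ i, IsClosed (A i) := fun i =>
    (isCompact_Icc.image_of_continuousOn ((hst.continuousOn i).mono hI)).isClosed
  -- Distinct arcs meet only at the centre, where all the ordinates are `p.2`.
  have key : ∀ i j, ∀ w ∈ A i, w ∈ A j → φ i (τ i w) = φ j (τ j w) := by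
    rintro i j _ ⟨t, ht, rfl⟩ ⟨s, hs', hst'⟩
    have hq := congrArg q hst'
    rw [hst.proj i t (hI ht), hst.proj j s (hI hs'), add_right_inj] at hq
    rw [hτ i t (hI ht), ← hst', hτ j s (hI hs')]
    by_cases hij : i = j
    · subst hij
      have : side i ≠ 0 := by rcases hs.side_eq i with h' | h' <;> simp [h']
      rw [mul_left_cancel₀ this hq]
    have hs0 := hs'.1
    have ht0 := ht.1
    rcases ht.1.eq_or_lt with h0 | h0
    · have : s = 0 := by
        rw [← h0, mul_zero] at hq
        rcases hs.side_eq j with h' | h' <;> rw [h'] at hq <;> linarith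
      rw [← h0, this, hs.start i, hs.start j]
    · exfalso
      have hsij : side i = side j := by
        rcases hs.side_eq i with h1 | h1 <;> rcases hs.side_eq j with h2 | h2 <;>
          rw [h1, h2] at hq ⊢ <;> linarith
      have hts : s = t := by
        rw [hsij] at hq
        rcases hs.side_eq j with h' | h' <;> rw [h'] at hq <;> linarith
      subst hts
      exact hst.ne i j hij hsij s ⟨h0, (hI hs').2⟩ hst'.symm
  let g : X → ℝ := fun w => if hw : ∃ i, w ∈ A i then φ hw.choose (τ hw.choose w) else 0
  have hg : ∀ i, ∀ w ∈ A i, g w = φ i (τ i w) := fun i w hw => by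
    have hex : ∃ i, w ∈ A i := ⟨i, hw⟩
    simp only [g, hex, dif_pos]
    exact key _ _ _ hex.choose_spec hw
  refine ⟨⋃ i, A i, ?_, g, ?_, ?_⟩
  · have hq : ∀ᶠ w in 𝓝 (r p), |q w - q (r p)| < δ / 2 :=
      (isOpen_lt (by fun_prop) continuous_const : IsOpen {w | |q w - q (r p)| < δ / 2}).mem_nhds
        (by simpa using hδ)
    filter_upwards [hst.exhaust, hq] with w h1 h2
    obtain ⟨i, t, ht, rfl⟩ := h1
    rw [hst.proj i t ht, add_sub_cancel_left, abs_lt] at h2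
    refine mem_iUnion.2 ⟨i, t, ⟨ht.1, ?_⟩, rfl⟩
    rcases hs.side_eq i with h' | h' <;> rw [h'] at h2 <;> linarith [h2.1, h2.2]
  · refine (locallyFinite_of_finite A).continuousOn_iUnion hA fun i => ?_
    refine ContinuousOn.congr ?_ (hg i)
    refine (hs.continuousOn i).comp (by fun_prop) ?_
    rintro _ ⟨t, ht, rfl⟩
    rw [hτ i t (hI ht)]
    exact hI ht
  · intro w hw
    obtain ⟨i, hi⟩ := mem_iUnion.1 hw
    rw [hg i w hi]
    obtain ⟨t, ht, rfl⟩ := hi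
    rw [hτ i t (hI ht), hst.proj i t (hI ht), hr.proj p hp]
    exact ⟨hs.mem i t (hI ht), rfl⟩

/-- The quotient map of a planar domain has a continuous section. -/
theorem exists_section (hr : IsVertCollapse K r q) (h : PlanarDomain K T) :
    ∃ g : X → ℝ, Continuous g ∧ ∀ w, (q w, g w) ∈ K ∧ r (q w, g w) = w := by
  have := hr.t2Space h
  have := hr.weaklyLocallyCompactSpace h
  have := hr.sigmaCompactSpace h
  -- A class is a vertical interval, so averages of admissible ordinates are admissible, and local
  -- choices can be merged by a partition of unity.
  have hconv : ∀ w, Convex ℝ {y | (q w, y) ∈ K ∧ r (q w, y) = w} := fun w => by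
    rw [convex_iff_ordConnected, ordConnected_iff_uIcc_subset]
    intro y hy y' hy' y'' hy''
    have hseg := ((hr.eq_iff _ hy.1 _ hy'.1).1 (hy.2.trans hy'.2.symm)).2
    refine ⟨hseg _ hy'', ?_⟩
    exact ((hr.eq_iff _ hy.1 _ (hseg _ hy'')).2
      ⟨rfl, fun y₀ hy₀ => hseg _ (uIcc_subset_uIcc left_mem_uIcc hy'' hy₀)⟩).symm.trans hy.2
  suffices hloc : ∀ z, ∃ U ∈ 𝓝 z, ∃ g : X → ℝ, ContinuousOn g U ∧
      ∀ w ∈ U, g w ∈ {y | (q w, y) ∈ K ∧ r (q w, y) = w} by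
    obtain ⟨g, hg⟩ := exists_continuous_forall_mem_convex_of_local hconv hloc
    exact ⟨g, g.continuous, hg⟩
  intro z
  by_cases hz : z ∈ r '' T
  · obtain ⟨p, hp, rfl⟩ := hz
    obtain ⟨n, -, δ, side, φ, hs⟩ := h.exists_isPlanarStar hp
    exact hr.exists_continuousOn_of_star h (h.isClosed.frontier_subset (h.subset hp)) hs
  · obtain ⟨δ, hδ, F, hF, hFK, hFz⟩ := hr.exists_transversal h hz
    have hI : ∀ᶠ w in 𝓝 z, q w ∈ Ioo (q z - δ) (q z + δ) :=
      (hr.continuous_proj h).continuousAt (Ioo_mem_nhds (by linarith) (by linarith))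
    refine ⟨_, inter_mem hI hFz, fun w => F (q w), ?_, fun w hw => ⟨hFK _ hw.1, hw.2⟩⟩
    exact hF.comp (hr.continuous_proj h).continuousOn fun w hw => hw.1

end IsVertCollapse

/-! ### The sheets of a branched line -/

section Sheets

variable {X : Type*} [TopologicalSpace X] {q : X → ℝ} {V : Set X}

/-- The points `z` and `w` lie on a common section of `q` over an open interval that avoids `V`. -/
def SameSheet (q : X → ℝ) (V : Set X) (z w : X) : Prop :=
  ∃ (I : Set ℝ) (σ : ℝ → X), IsOpen I ∧ I.OrdConnected ∧ ContinuousOn σ I ∧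
    (∀ x ∈ I, q (σ x) = x ∧ σ x ∉ V) ∧ (q z ∈ I ∧ σ (q z) = z) ∧ q w ∈ I ∧ σ (q w) = w

theorem SameSheet.symm {z w : X} (h : SameSheet q V z w) : SameSheet q V w z := by
  obtain ⟨I, σ, h1, h2, h3, h4, h5, h6⟩ := h
  exact ⟨I, σ, h1, h2, h3, h4, h6, h5⟩

theorem SameSheet.eq {z w : X} (h : SameSheet q V z w) (hq : q z = q w) : z = w := by
  obtain ⟨I, σ, -, -, -, -, h5, h6⟩ := h
  rw [← h5.2, hq, h6.2]

theorem SameSheet.mem_component {z w : X} (h : SameSheet q V z w) :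
    w ∈ connectedComponentIn Vᶜ z := by
  obtain ⟨I, σ, -, h2, h3, h4, h5, h6⟩ := h
  exact (h2.isPreconnected.image σ h3).subset_connectedComponentIn
    ⟨_, h5⟩ (by rintro _ ⟨x, hx, rfl⟩; exact (h4 x hx).2) ⟨_, h6⟩

namespace IsBranchedLine

variable (h : IsBranchedLine q V)
include h

theorem continuous : Continuous q := h.proper.continuous

theorem exists_injOn {z : X} (hz : z ∉ V) : ∃ U ∈ 𝓝 z, InjOn q U := by
  obtain ⟨δ, hδ, σ, -, -, hσ⟩ := h.regular z hz
  exact ⟨_, hσ, fun w (hw : σ (q w) = w) w' (hw' : σ (q w') = w') he => by rw [← hw, he, hw']⟩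

theorem ordConnected_image_component (z : X) : (q '' connectedComponentIn Vᶜ z).OrdConnected :=
  (isPreconnected_connectedComponentIn.image q h.continuous.continuousOn).ordConnected

variable [T2Space X]

theorem isClosed_vertices : IsClosed V := h.finite.isClosed

/-- The coincidence set is closed because `X` is Hausdorff, and open because `q` is injective near
each value of `σ`, which avoids `V`. -/
theorem eqOn_sections {I : Set ℝ} (hI : IsPreconnected I) {σ τ : ℝ → X} (hσ : ContinuousOn σ I)
    (hτ : ContinuousOn τ I) (hσq : ∀ x ∈ I, q (σ x) = x ∧ σ x ∉ V) (hτq : ∀ x ∈ I, q (τ x) = x)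
    {x₀ : ℝ} (hx₀ : x₀ ∈ I) (heq : σ x₀ = τ x₀) : EqOn σ τ I := by
  have : PreconnectedSpace I := isPreconnected_iff_preconnectedSpace.1 hI
  have hσ' := continuousOn_iff_continuous_domRestrict.1 hσ
  have hτ' := continuousOn_iff_continuous_domRestrict.1 hτ
  have hclopen : IsClopen {x : I | I.domRestrict σ x = I.domRestrict τ x} := by
    refine ⟨isClosed_eq hσ' hτ', isOpen_iff_mem_nhds.2 fun x hx => ?_⟩
    obtain ⟨U, hU, hUi⟩ := h.exists_injOn (hσq x x.2).2
    have h2 : U ∈ 𝓝 (I.domRestrict τ x) := (mem_ofPred_eq ▸ hx : _ = _) ▸ hU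
    filter_upwards [hσ'.continuousAt.preimage_mem_nhds (x := x) hU,
      hτ'.continuousAt.preimage_mem_nhds h2] with y h3 h4
    exact hUi h3 h4 ((hσq y y.2).1.trans (hτq y y.2).symm)
  have huniv := hclopen.eq_univ ⟨⟨x₀, hx₀⟩, heq⟩
  intro x hx
  exact (huniv ▸ mem_univ (⟨x, hx⟩ : I) : (⟨x, hx⟩ : I) ∈ {x : I | I.domRestrict σ x = _})

/-- The two sections agree at `q w`, hence on the whole overlap of their intervals, and can be
glued. -/
theorem trans_sheet {z w u : X} (h1 : SameSheet q V z w) (h2 : SameSheet q V w u) :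
    SameSheet q V z u := by
  classical
  obtain ⟨I, σ, hI, hIc, hσ, hσq, hz, hw⟩ := h1
  obtain ⟨J, τ, hJ, hJc, hτ, hτq, hw', hu⟩ := h2
  have heq : EqOn σ τ (I ∩ J) := h.eqOn_sections (hIc.inter hJc).isPreconnected
    (hσ.mono inter_subset_left) (hτ.mono inter_subset_right) (fun x hx => hσq x hx.1)
    (fun x hx => (hτq x hx.2).1) ⟨hw.1, hw'.1⟩ (hw.2.trans hw'.2.symm)
  let ρ : ℝ → X := fun x => if x ∈ I then σ x else τ x
  have hρσ : EqOn ρ σ I := fun x hx => if_pos hx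
  have hρτ : EqOn ρ τ J := fun x hx => by
    by_cases hxI : x ∈ I
    · exact (hρσ hxI).trans (heq ⟨hxI, hx⟩)
    · exact if_neg hxI
  refine ⟨I ∪ J, ρ, hI.union hJ, (IsPreconnected.union (q w) hw.1 hw'.1 hIc.isPreconnected
    hJc.isPreconnected).ordConnected, ?_, ?_, ⟨Or.inl hz.1, (hρσ hz.1).trans hz.2⟩, Or.inr hu.1,
    (hρτ hu.1).trans hu.2⟩
  · exact (hσ.congr hρσ).union_of_isOpen (hτ.congr hρτ) hI hJ
  · rintro x (hx | hx)
    · rw [hρσ hx]; exact hσq x hx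
    · rw [hρτ hx]; exact hτq x hx

theorem eventually_sameSheet {z : X} (hz : z ∉ V) : ∀ᶠ w in 𝓝 z, SameSheet q V z w := by
  obtain ⟨δ, hδ, σ, hσ, hσq, hσz⟩ := h.regular z hz
  have hmem : q z ∈ Ioo (q z - δ) (q z + δ) := ⟨by linarith, by linarith⟩
  have hz' : σ (q z) = z := hσz.self_of_nhds
  have h1 : σ ⁻¹' Vᶜ ∈ 𝓝 (q z) :=
    (hσ.continuousAt (Ioo_mem_nhds hmem.1 hmem.2)).preimage_mem_nhds
      (h.isClosed_vertices.isOpen_compl.mem_nhds (by rw [hz']; exact hz))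
  obtain ⟨ε, hε, hεI⟩ := Metric.mem_nhds_iff.1 (inter_mem h1 (Ioo_mem_nhds hmem.1 hmem.2))
  filter_upwards [hσz, h.continuous.continuousAt.preimage_mem_nhds (ball_mem_nhds (q z) hε)]
    with w h2 h3
  exact ⟨ball (q z) ε, σ, isOpen_ball, (convex_ball _ _).ordConnected,
    hσ.mono fun x hx => (hεI hx).2, fun x hx => ⟨hσq x (hεI hx).2, (hεI hx).1⟩,
    ⟨mem_ball_self hε, hz'⟩, h3, h2⟩

/-- Nearby points off `V` share a sheet, and the relation is symmetric and transitive, so it holds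
throughout a connected component. Consequently `q` is injective on components. -/
theorem sameSheet_of_mem {z w w' : X} (hw : w ∈ connectedComponentIn Vᶜ z)
    (hw' : w' ∈ connectedComponentIn Vᶜ z) : SameSheet q V w w' :=
  isPreconnected_connectedComponentIn.induction₂ (SameSheet q V)
    (fun _ hx => (h.eventually_sameSheet (connectedComponentIn_subset _ _ hx)).filter_mono
      nhdsWithin_le_nhds)
    (fun _ _ _ _ _ _ => h.trans_sheet) (fun _ _ _ _ => SameSheet.symm) hw hw'

theorem injOn_component (z : X) : InjOn q (connectedComponentIn Vᶜ z) :=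
  fun _ hw _ hw' => (h.sameSheet_of_mem hw hw').eq

theorem isOpen_component (z : X) : IsOpen (connectedComponentIn Vᶜ z) :=
  isOpen_iff_mem_nhds.2 fun w hw => by
    filter_upwards [h.eventually_sameSheet (connectedComponentIn_subset _ _ hw)] with w' hw'
    rw [connectedComponentIn_eq hw]
    exact hw'.mem_component

theorem exists_section_component {z w : X} (hw : w ∈ connectedComponentIn Vᶜ z) :
    ∃ (I : Set ℝ) (σ : ℝ → X), IsOpen I ∧ q w ∈ I ∧ ContinuousOn σ I ∧ σ (q w) = w ∧
      ∀ x ∈ I, q (σ x) = x ∧ σ x ∈ connectedComponentIn Vᶜ z := by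
  obtain ⟨I, σ, hI, hIc, hσ, hσq, hz, hw'⟩ := h.sameSheet_of_mem hw hw
  refine ⟨I, σ, hI, hz.1, hσ, hz.2, fun x hx => ⟨(hσq x hx).1, ?_⟩⟩
  rw [connectedComponentIn_eq hw]
  exact SameSheet.mem_component ⟨I, σ, hI, hIc, hσ, hσq, hz, by rwa [(hσq x hx).1],
    by rw [(hσq x hx).1]⟩

theorem isOpen_image_component (z : X) : IsOpen (q '' connectedComponentIn Vᶜ z) := by
  refine isOpen_iff_mem_nhds.2 ?_
  rintro _ ⟨w, hw, rfl⟩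
  obtain ⟨I, σ, hI, hwI, -, -, hσ⟩ := h.exists_section_component hw
  exact mem_of_superset (hI.mem_nhds hwI) fun x hx => ⟨σ x, (hσ x hx).2, (hσ x hx).1⟩

/-- Points of the component close to `w'` have abscissa close to `q w`, so they lie on the local
section through `w` and tend to `w`. Limits in `X` are unique. -/
theorem eq_of_mem_closure {z w w' : X} (hw : w ∈ connectedComponentIn Vᶜ z)
    (hw' : w' ∈ closure (connectedComponentIn Vᶜ z)) (hq : q w = q w') : w = w' := by
  obtain ⟨I, σ, hI, hwI, hσ, hσw, hσq⟩ := h.exists_section_component hw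
  have : (𝓝[connectedComponentIn Vᶜ z] w').NeBot := mem_closure_iff_nhdsWithin_neBot.1 hw'
  have hσc : Tendsto (fun x => σ (q x)) (𝓝[connectedComponentIn Vᶜ z] w') (𝓝 w) := by
    have h1 : Tendsto σ (𝓝 (q w')) (𝓝 w) := by
      have := hσ.continuousAt (hI.mem_nhds hwI)
      rw [← hq]
      rwa [ContinuousAt, hσw] at this
    exact h1.comp (h.continuous.continuousAt.mono_left nhdsWithin_le_nhds)
  have hid : Tendsto (fun x : X => x) (𝓝[connectedComponentIn Vᶜ z] w') (𝓝 w') :=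
    tendsto_id'.2 nhdsWithin_le_nhds
  refine tendsto_nhds_unique (hσc.congr' ?_) hid
  have hev : ∀ᶠ x in 𝓝[connectedComponentIn Vᶜ z] w', q x ∈ I :=
    (h.continuous.continuousAt.mono_left nhdsWithin_le_nhds : Tendsto q _ (𝓝 (q w'))).eventually
      (hI.mem_nhds (hq ▸ hwI))
  filter_upwards [hev, self_mem_nhdsWithin] with x hx hxJ
  exact h.injOn_component z (hσq _ hx).2 hxJ (hσq _ hx).1

theorem mem_vertices_of_mem_closure {z w : X} (hw : w ∈ closure (connectedComponentIn Vᶜ z))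
    (hwJ : w ∉ connectedComponentIn Vᶜ z) : w ∈ V := by
  by_contra hwV
  obtain ⟨u, hu, huz⟩ := mem_closure_iff.1 hw _ (h.isOpen_component w)
    (mem_connectedComponentIn hwV)
  rw [connectedComponentIn_eq huz, ← connectedComponentIn_eq hu] at hwJ
  exact hwJ (mem_connectedComponentIn hwV)

/-- The closure adds only vertices, which `q` separates from the component by the previous
uniqueness and from each other by genericity. -/
theorem injOn_closure_component (z : X) : InjOn q (closure (connectedComponentIn Vᶜ z)) := by
  intro w hw w' hw' hq
  by_cases h1 : w ∈ connectedComponentIn Vᶜ z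
  · exact h.eq_of_mem_closure h1 hw' hq
  by_cases h2 : w' ∈ connectedComponentIn Vᶜ z
  · exact (h.eq_of_mem_closure h2 hw hq.symm).symm
  exact h.injOn (h.mem_vertices_of_mem_closure hw h1) (h.mem_vertices_of_mem_closure hw' h2) hq

theorem closure_component_diff (z : X) :
    closure (connectedComponentIn Vᶜ z) \ V = connectedComponentIn Vᶜ z := by
  refine Subset.antisymm (fun w hw => ?_) fun w hw =>
    ⟨subset_closure hw, connectedComponentIn_subset _ _ hw⟩
  by_contra hwJ
  exact hw.2 (h.mem_vertices_of_mem_closure hw.1 hwJ)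

theorem isClosedEmbedding_closure_component (z : X) :
    IsClosedEmbedding ((closure (connectedComponentIn Vᶜ z)).domRestrict q) :=
  .of_continuous_injective_isClosedMap (h.continuous.comp continuous_subtype_val)
    (injOn_iff_injective.1 (h.injOn_closure_component z))
    (h.proper.restrict isClosed_closure).isClosedMap

theorem nonempty_homeomorph_component {z : X} (hz : z ∉ V) :
    Nonempty (connectedComponentIn Vᶜ z ≃ₜ ℝ) := by
  obtain ⟨e⟩ := nonempty_homeomorph_real_of_isOpen (h.isOpen_image_component z)
    (h.ordConnected_image_component z) ⟨_, z, mem_connectedComponentIn hz, rfl⟩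
  have hemb : IsEmbedding ((connectedComponentIn Vᶜ z).domRestrict q) :=
    (h.isClosedEmbedding_closure_component z).isEmbedding.comp (IsEmbedding.inclusion subset_closure)
  exact ⟨hemb.toHomeomorph.trans ((Homeomorph.setCongr (range_domRestrict _ _)).trans e)⟩

theorem exists_homeomorph_closure_component (z : X) : ∃ I : Set ℝ, IsClosed I ∧ I.OrdConnected ∧
    Nonempty (closure (connectedComponentIn Vᶜ z) ≃ₜ I) := by
  refine ⟨_, (h.isClosedEmbedding_closure_component z).isClosed_range, ?_,
    ⟨(h.isClosedEmbedding_closure_component z).isEmbedding.toHomeomorph⟩⟩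
  rw [range_domRestrict]
  exact (isPreconnected_connectedComponentIn.closure.image q h.continuous.continuousOn).ordConnected

/-- The end vertices project into the closure of the interval `q '' J` but outside it, so there is
at most one on each side of `q z`. -/
theorem encard_closure_component_inter_le {z : X} (hz : z ∉ V) :
    (closure (connectedComponentIn Vᶜ z) ∩ V).encard ≤ 2 := by
  set J := connectedComponentIn Vᶜ z
  have hJ := h.isOpen_image_component z
  have hJc := h.ordConnected_image_component z
  have hnot : ∀ w ∈ closure J ∩ V, q w ∉ q '' J := by
    rintro w hw ⟨u, hu, huw⟩
    have := h.eq_of_mem_closure hu hw.1 huw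
    exact connectedComponentIn_subset _ _ hu (this ▸ hw.2)
  have hcl : ∀ w ∈ closure J, q w ∈ closure (q '' J) := fun w hw =>
    image_closure_subset_closure_image h.continuous ⟨w, hw, rfl⟩
  have hzJ : q z ∈ q '' J := ⟨z, mem_connectedComponentIn hz, rfl⟩
  have hsub : closure J ∩ V ⊆ {w ∈ closure J ∩ V | q w < q z} ∪ {w ∈ closure J ∩ V | q z < q w} :=
    fun w hw => (lt_or_gt_of_ne fun heq : q w = q z => hnot w hw (heq ▸ hzJ)).imp (⟨hw, ·⟩) (⟨hw, ·⟩)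
  have h1 : {w ∈ closure J ∩ V | q w < q z}.Subsingleton := by
    have key : ∀ w ∈ closure J ∩ V, ∀ w' ∈ closure J ∩ V, q w' < q z → ¬ q w < q w' := by
      intro w hw w' hw' hz' hlt
      obtain ⟨x, hx, hxJ⟩ := mem_closure_iff.1 (hcl w hw.1) _ isOpen_Iio hlt
      exact hnot w' hw' (hJc.out hxJ hzJ ⟨le_of_lt hx, hz'.le⟩)
    intro w hw w' hw'
    exact h.injOn hw.1.2 hw'.1.2 (le_antisymm (not_lt.1 (key w' hw'.1 w hw.1 hw.2))
      (not_lt.1 (key w hw.1 w' hw'.1 hw'.2)))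
  have h2 : {w ∈ closure J ∩ V | q z < q w}.Subsingleton := by
    have key : ∀ w ∈ closure J ∩ V, ∀ w' ∈ closure J ∩ V, q z < q w' → ¬ q w' < q w := by
      intro w hw w' hw' hz' hlt
      obtain ⟨x, hx, hxJ⟩ := mem_closure_iff.1 (hcl w hw.1) _ isOpen_Ioi hlt
      exact hnot w' hw' (hJc.out hzJ hxJ ⟨hz'.le, le_of_lt hx⟩)
    intro w hw w' hw'
    exact h.injOn hw.1.2 hw'.1.2 (le_antisymm (not_lt.1 (key w hw.1 w' hw'.1 hw'.2))
      (not_lt.1 (key w' hw'.1 w hw.1 hw.2)))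
  calc (closure J ∩ V).encard ≤ _ := encard_le_encard hsub
    _ ≤ _ := encard_union_le _ _
    _ ≤ 1 + 1 := add_le_add (encard_le_one_iff_subsingleton.2 h1) (encard_le_one_iff_subsingleton.2 h2)
    _ = 2 := by norm_num

end IsBranchedLine
end Sheets

/-! ### Edges at a vertex, and the transversal graph -/

section Star

variable {X : Type*} [TopologicalSpace X] {q : X → ℝ} {V : Set X}

/-- The closures of the connected components of the complement of `V`. -/
def sheets (V : Set X) : Set (Set X) :=
  {e | ∃ z ∉ V, e = closure (connectedComponentIn Vᶜ z)}

theorem IsStar.mono {v : X} {δ δ' : ℝ} {n : ℕ} {side : Fin n → ℝ} {β : Fin n → ℝ → X}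
    (hs : IsStar q v δ side β) (hq : Continuous q) (hδ' : 0 < δ') (hle : δ' ≤ δ) :
    IsStar q v δ' side β where
  pos := hδ'
  side_eq := hs.side_eq
  continuousOn i := (hs.continuousOn i).mono (Ico_subset_Ico_right hle)
  start := hs.start
  proj i t ht := hs.proj i t (Ico_subset_Ico_right hle ht)
  ne i j hij hsij t ht := hs.ne i j hij hsij t (Ioo_subset_Ioo_right hle ht)
  exhaust := by
    have hev : ∀ᶠ w in 𝓝 v, |q w - q v| < δ' :=
      (isOpen_lt (by fun_prop) continuous_const : IsOpen {w | |q w - q v| < δ'}).mem_nhds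
        (by simpa using hδ')
    filter_upwards [hs.exhaust, hev] with w h1 h2
    obtain ⟨i, t, ht, rfl⟩ := h1
    rw [hs.proj i t ht, add_sub_cancel_left, abs_lt] at h2
    refine ⟨i, t, ⟨ht.1, ?_⟩, rfl⟩
    rcases hs.side_eq i with h' | h' <;> rw [h'] at h2 <;> linarith [h2.1, h2.2]

theorem IsStar.mem_component {v : X} {δ : ℝ} {n : ℕ} {side : Fin n → ℝ} {β : Fin n → ℝ → X}
    (hs : IsStar q v δ side β) (hV : ∀ i, ∀ t ∈ Ioo 0 δ, β i t ∉ V) (i : Fin n) {t : ℝ}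
    (ht : t ∈ Ioo 0 δ) : β i t ∈ connectedComponentIn Vᶜ (β i (δ / 2)) := by
  have hδ := hs.pos
  refine (isPreconnected_Ioo.image (β i) ((hs.continuousOn i).mono Ioo_subset_Ico_self)
    ).subset_connectedComponentIn ⟨δ / 2, ⟨by linarith, by linarith⟩, rfl⟩ ?_ ⟨t, ht, rfl⟩
  rintro _ ⟨s, hs', rfl⟩
  exact hV i s hs'

theorem IsStar.mem_closure {v : X} {δ : ℝ} {n : ℕ} {side : Fin n → ℝ} {β : Fin n → ℝ → X}
    (hs : IsStar q v δ side β) (hV : ∀ i, ∀ t ∈ Ioo 0 δ, β i t ∉ V) (i : Fin n) :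
    v ∈ closure (connectedComponentIn Vᶜ (β i (δ / 2))) := by
  have hδ := hs.pos
  have h1 : (0 : ℝ) ∈ closure (Ioo 0 δ) := by rw [closure_Ioo hδ.ne]; exact ⟨le_rfl, hδ.le⟩
  have h2 := (hs.continuousOn i 0 ⟨le_rfl, hδ⟩).mono Ioo_subset_Ico_self
  rw [← hs.start i]
  exact h2.mem_closure h1 fun t ht => hs.mem_component hV i ht

/-- A component that accumulates at `v` must meet the star, at a point other than `v`, hence on one
of the open arcs. -/
theorem IsStar.exists_of_mem_closure {v : X} (hv : v ∈ V) {δ : ℝ} {n : ℕ} {side : Fin n → ℝ}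
    {β : Fin n → ℝ → X} (hs : IsStar q v δ side β) (hV : ∀ i, ∀ t ∈ Ioo 0 δ, β i t ∉ V) {z : X}
    (hz : v ∈ closure (connectedComponentIn Vᶜ z)) :
    ∃ i, connectedComponentIn Vᶜ z = connectedComponentIn Vᶜ (β i (δ / 2)) := by
  obtain ⟨w, ⟨i, t, ht, rfl⟩, hw⟩ := mem_closure_iff_nhds.1 hz _ hs.exhaust
  refine ⟨i, ?_⟩
  have h0 : 0 < t := by
    refine lt_of_le_of_ne ht.1 ?_
    rintro rfl
    rw [hs.start i] at hw
    exact connectedComponentIn_subset _ _ hw hv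
  rw [connectedComponentIn_eq hw, ← connectedComponentIn_eq (hs.mem_component hV i ⟨h0, ht.2⟩)]

theorem IsStar.sheets_at_eq_range {v : X} (hv : v ∈ V) {δ : ℝ} {n : ℕ} {side : Fin n → ℝ}
    {β : Fin n → ℝ → X} (hs : IsStar q v δ side β) (hV : ∀ i, ∀ t ∈ Ioo 0 δ, β i t ∉ V) :
    {e ∈ sheets V | v ∈ e} = range fun i => closure (connectedComponentIn Vᶜ (β i (δ / 2))) := by
  have hδ := hs.pos
  ext e
  constructor
  · rintro ⟨⟨z, hz, rfl⟩, hvz⟩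
    obtain ⟨i, hi⟩ := hs.exists_of_mem_closure hv hV hvz
    exact ⟨i, by rw [hi]⟩
  · rintro ⟨i, rfl⟩
    exact ⟨⟨_, hV i _ ⟨by linarith, by linarith⟩, rfl⟩, hs.mem_closure hV i⟩

namespace IsBranchedLine

variable (h : IsBranchedLine q V)
include h

/-- The star is shortened until its projection avoids the finitely many abscissas of the other
vertices. -/
theorem exists_star {v : X} (hv : v ∈ V) : ∃ n, (n = 1 ∨ n = 3) ∧ ∃ δ, ∃ (side : Fin n → ℝ)
    (β : Fin n → ℝ → X), IsStar q v δ side β ∧ ∀ i, ∀ t ∈ Ioo 0 δ, β i t ∉ V := by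
  obtain ⟨n, hn, δ, side, β, hs⟩ := h.branch v hv
  have hfin : (q '' (V \ {v})).Finite := (h.finite.sdiff).image q
  have hnot : q v ∉ q '' (V \ {v}) := by
    rintro ⟨w, hw, hwv⟩
    exact hw.2 (h.injOn hw.1 hv hwv)
  obtain ⟨ε, hε, hεV⟩ := Metric.isOpen_iff.1 hfin.isClosed.isOpen_compl (q v) hnot
  have hs' := hs.mono h.continuous (lt_min hs.pos hε) (min_le_left _ _)
  refine ⟨n, hn, min δ ε, side, β, hs', fun i t ht hV => ?_⟩
  have hq := hs'.proj i t ⟨ht.1.le, ht.2⟩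
  have htε : t < ε := ht.2.trans_le (min_le_right _ _)
  refine hεV ?_ ⟨β i t, ⟨hV, fun heq => ?_⟩, rfl⟩
  · rw [mem_ball, Real.dist_eq, hq, add_sub_cancel_left, abs_mul, abs_of_pos ht.1]
    rcases hs.side_eq i with h' | h' <;> simpa [h'] using htε
  · rw [mem_singleton_iff.1 heq] at hq
    rcases hs.side_eq i with h' | h' <;> rw [h'] at hq <;> linarith [ht.1]

variable [T2Space X]

/-- No edge is a loop. Two arcs on one side contradict injectivity of `q` on a component; on
opposite sides, the interval covered by the component would contain `q v`, and the component would
then contain the vertex `v`. -/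
theorem star_injective {v : X} (hv : v ∈ V) {δ : ℝ} {n : ℕ} {side : Fin n → ℝ}
    {β : Fin n → ℝ → X} (hs : IsStar q v δ side β) (hV : ∀ i, ∀ t ∈ Ioo 0 δ, β i t ∉ V) :
    Function.Injective fun i => closure (connectedComponentIn Vᶜ (β i (δ / 2))) := by
  intro i j hij
  by_contra hne
  have hδ := hs.pos
  have hcomp : connectedComponentIn Vᶜ (β i (δ / 2)) = connectedComponentIn Vᶜ (β j (δ / 2)) := by
    rw [← h.closure_component_diff, ← h.closure_component_diff (β j (δ / 2))]
    exact congrArg (· \ V) hij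
  have hm : δ / 2 ∈ Ioo 0 δ := ⟨by linarith, by linarith⟩
  have hm' := Ioo_subset_Ico_self hm
  have hi := hs.mem_component hV i hm
  have hj := hs.mem_component hV j hm
  rw [← hcomp] at hj
  by_cases hsij : side i = side j
  · refine hs.ne i j hne hsij _ hm (h.injOn_component _ hi hj ?_)
    rw [hs.proj i _ hm', hs.proj j _ hm', hsij]
  · have hmem : q v ∈ q '' connectedComponentIn Vᶜ (β i (δ / 2)) := by
      have hqi : q v + side i * (δ / 2) ∈ q '' connectedComponentIn Vᶜ (β i (δ / 2)) :=
        ⟨_, hi, hs.proj i _ hm'⟩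
      have hqj : q v + side j * (δ / 2) ∈ q '' connectedComponentIn Vᶜ (β i (δ / 2)) :=
        ⟨_, hj, hs.proj j _ hm'⟩
      have hoc := h.ordConnected_image_component (β i (δ / 2))
      rcases hs.side_eq i with h1 | h1 <;> rcases hs.side_eq j with h2 | h2 <;>
        rw [h1] at hqi <;> rw [h2] at hqj
      · exact absurd (h1.trans h2.symm) hsij
      · exact hoc.out hqj hqi ⟨by linarith, by linarith⟩
      · exact hoc.out hqi hqj ⟨by linarith, by linarith⟩
      · exact absurd (h1.trans h2.symm) hsij
    obtain ⟨w, hw, hwv⟩ := hmem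
    have := h.eq_of_mem_closure hw (hs.mem_closure hV i) hwv
    exact connectedComponentIn_subset _ _ hw (this ▸ hv)

theorem valency_eq {v : X} (hv : v ∈ V) : valency (sheets V) v = 1 ∨ valency (sheets V) v = 3 := by
  obtain ⟨n, hn, δ, side, β, hs, hV⟩ := h.exists_star hv
  have : valency (sheets V) v = n := by
    rw [valency, hs.sheets_at_eq_range hv hV, ← image_univ,
      ncard_image_of_injective _ (h.star_injective hv hs hV), ncard_univ, Nat.card_fin]
  rwa [this]

/-- A sheet through a vertex is one of finitely many there. A sheet without vertices is open and
closed, so it is all of `X`. -/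
theorem finite_sheets [ConnectedSpace X] : (sheets V).Finite := by
  refine ((finite_singleton (univ : Set X)).union
    (h.finite.biUnion (t := fun v => {e ∈ sheets V | v ∈ e}) fun v hv => ?_)).subset ?_
  · obtain ⟨n, hn, δ, side, β, hs, hV⟩ := h.exists_star hv
    rw [hs.sheets_at_eq_range hv hV]
    exact finite_range _
  · rintro e ⟨z, hz, rfl⟩
    by_cases hne : ∃ v ∈ V, v ∈ closure (connectedComponentIn Vᶜ z)
    · obtain ⟨v, hv, hvz⟩ := hne
      exact Or.inr (mem_biUnion hv ⟨⟨z, hz, rfl⟩, hvz⟩)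
    · push Not at hne
      left
      have h1 := h.closure_component_diff z
      rw [sdiff_eq_self_iff_disjoint.2 (disjoint_left.2 hne)] at h1
      have hcl : IsClopen (connectedComponentIn Vᶜ z) :=
        ⟨by rw [← h1]; exact isClosed_closure, h.isOpen_component z⟩
      rw [mem_singleton_iff, h1]
      exact hcl.eq_univ ⟨z, mem_connectedComponentIn hz⟩

theorem sheet_diff {e : Set X} (he : e ∈ sheets V) : ∃ z ∉ V, e \ V = connectedComponentIn Vᶜ z ∧
    e = closure (connectedComponentIn Vᶜ z) := by
  obtain ⟨z, hz, rfl⟩ := he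
  exact ⟨z, hz, h.closure_component_diff z, rfl⟩

theorem disjoint_sheets {e e' : Set X} (he : e ∈ sheets V) (he' : e' ∈ sheets V) (hne : e ≠ e') :
    Disjoint (e \ V) (e' \ V) := by
  obtain ⟨z, hz, h1, rfl⟩ := h.sheet_diff he
  obtain ⟨z', hz', h2, rfl⟩ := h.sheet_diff he'
  rw [h1, h2, disjoint_left]
  intro w hw hw'
  exact hne (by rw [connectedComponentIn_eq hw, connectedComponentIn_eq hw'])

/-- A branched line is a generic transversal graph. -/
theorem isGenericTransversalGraph [ConnectedSpace X] :
    IsGenericTransversalGraph q univ V (sheets V) where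
  isClosed := isClosed_univ
  finite_vertices := h.finite
  finite_edges := h.finite_sheets
  union_eq := by
    refine (eq_univ_of_forall fun z => ?_).symm
    by_cases hz : z ∈ V
    · exact Or.inl hz
    · exact Or.inr (mem_biUnion ⟨z, hz, rfl⟩ ⟨subset_closure (mem_connectedComponentIn hz), hz⟩)
  disjoint_openEdges e he e' he' hne := h.disjoint_sheets he he' hne
  openEdge_homeomorph e he := by
    obtain ⟨z, hz, h1, -⟩ := h.sheet_diff he
    rw [h1]
    exact h.nonempty_homeomorph_component hz
  closure_openEdge e he := by
    obtain ⟨z, hz, h1, h2⟩ := h.sheet_diff he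
    rw [h1, ← h2]
  edge_homeomorph := by
    rintro e ⟨z, hz, rfl⟩
    exact h.exists_homeomorph_closure_component z
  edge_endpoints := by
    rintro e ⟨z, hz, rfl⟩
    exact h.encard_closure_component_inter_le hz
  transversal := by
    rintro e ⟨z, hz, rfl⟩
    exact (h.isClosedEmbedding_closure_component z).isEmbedding
  proper := h.proper.restrict isClosed_univ
  valency_eq v hv := h.valency_eq hv
  injOn_vertices := h.injOn

end IsBranchedLine
end Star

/-! ### The incidence graph of a branched line -/

theorem incidenceGraph_adj_inl_inr {X : Type*} {V : Set X} {E : Set (Set X)} {v : V} {e : E} :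
    (incidenceGraph V E).Adj (Sum.inl v) (Sum.inr e) ↔ (v : X) ∈ (e : Set X) := by
  simp [incidenceGraph, SimpleGraph.fromRel_adj]

theorem incidenceGraph_adj {X : Type*} {V : Set X} {E : Set (Set X)} {a b : V ⊕ E}
    (hab : (incidenceGraph V E).Adj a b) : ∃ (v : V) (e : E), (v : X) ∈ (e : Set X) ∧
      (a = Sum.inl v ∧ b = Sum.inr e ∨ a = Sum.inr e ∧ b = Sum.inl v) := by
  rcases a with v | e <;> rcases b with v' | e' <;>
    simp [incidenceGraph, SimpleGraph.fromRel_adj] at hab ⊢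
  · exact hab
  · exact hab

theorem eq_of_reachable {N α : Type*} {G : SimpleGraph N} {Φ : N → α}
    (hΦ : ∀ a b, G.Adj a b → Φ a = Φ b) {a b : N} (hab : G.Reachable a b) : Φ a = Φ b := by
  obtain ⟨p⟩ := hab
  induction p with
  | nil => rfl
  | cons hadj _ ih => exact (hΦ _ _ hadj).trans ih

namespace IsBranchedLine

variable {X : Type*} [TopologicalSpace X] {q : X → ℝ} {V : Set X}

/-- The part of the space carried by a node of the incidence graph. -/
def nodeSet (V : Set X) : V ⊕ sheets V → Set X := Sum.elim (fun v => {(v : X)}) fun e => e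

theorem nodeSet_nonempty (a : V ⊕ sheets V) : (nodeSet V a).Nonempty := by
  rcases a with v | ⟨e, z, hz, rfl⟩
  · exact singleton_nonempty _
  · exact ⟨z, subset_closure (mem_connectedComponentIn hz)⟩

variable (h : IsBranchedLine q V) [T2Space X]
include h

theorem reachable_of_mem_nodeSet {a b : V ⊕ sheets V} {x : X} (ha : x ∈ nodeSet V a)
    (hb : x ∈ nodeSet V b) : (incidenceGraph V (sheets V)).Reachable a b := by
  by_cases hx : x ∈ V
  · have key : ∀ c, x ∈ nodeSet V c →
        (incidenceGraph V (sheets V)).Reachable (Sum.inl ⟨x, hx⟩) c := by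
      rintro (⟨v, hv⟩ | e) hc
      · obtain rfl : x = v := hc
        exact .rfl
      · exact (incidenceGraph_adj_inl_inr.2 hc).reachable
    exact (key a ha).symm.trans (key b hb)
  · rcases a with v | e
    · exact absurd ((show x = v from ha) ▸ v.2) hx
    rcases b with v | e'
    · exact absurd ((show x = v from hb) ▸ v.2) hx
    have : e = e' := by
      by_contra hne
      exact disjoint_left.1 (h.disjoint_sheets e.2 e'.2 fun h' => hne (Subtype.ext h'))
        ⟨ha, hx⟩ ⟨hb, hx⟩
    rw [this]

/-- The nodes carry a finite closed cover of `X`, and nodes whose sets meet are reachable from each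
other. A proper reachability class would therefore split `X` into two disjoint nonempty closed sets.
-/
theorem connected_incidenceGraph [ConnectedSpace X] :
    (incidenceGraph V (sheets V)).Connected := by
  have := h.finite.to_subtype
  have := h.finite_sheets.to_subtype
  have hcov : ∀ x : X, ∃ a, x ∈ nodeSet V a := fun x => by
    by_cases hx : x ∈ V
    · exact ⟨Sum.inl ⟨x, hx⟩, rfl⟩
    · exact ⟨Sum.inr ⟨_, x, hx, rfl⟩, subset_closure (mem_connectedComponentIn hx)⟩
  have hclosed : ∀ a, IsClosed (nodeSet V a) := by
    rintro (v | ⟨e, z, hz, rfl⟩)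
    · exact isClosed_singleton
    · exact isClosed_closure
  refine (SimpleGraph.connected_iff _).2 ⟨fun a b => ?_, ?_⟩
  · set A := ⋃ c : {c // (incidenceGraph V (sheets V)).Reachable a c}, nodeSet V c
    set B := ⋃ c : {c // ¬ (incidenceGraph V (sheets V)).Reachable a c}, nodeSet V c
    have hA : IsClosed A := isClosed_iUnion_of_finite fun c => hclosed c
    have hB : IsClosed B := isClosed_iUnion_of_finite fun c => hclosed c
    have hAB : Aᶜ = B := by
      ext x
      constructor
      · intro hx
        obtain ⟨c, hc⟩ := hcov x
        refine mem_iUnion.2 ⟨⟨c, fun hr => hx (mem_iUnion.2 ⟨⟨c, hr⟩, hc⟩)⟩, hc⟩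
      · rintro hx hx'
        obtain ⟨⟨c, hc⟩, hxc⟩ := mem_iUnion.1 hx
        obtain ⟨⟨d, hd⟩, hxd⟩ := mem_iUnion.1 hx'
        exact hc (hd.trans (h.reachable_of_mem_nodeSet hxd hxc))
    have hclop : IsClopen A := ⟨hA, isClosed_compl_iff.1 (hAB ▸ hB)⟩
    have huniv : A = univ := hclop.eq_univ <| by
      obtain ⟨x, hx⟩ := nodeSet_nonempty a
      exact ⟨x, mem_iUnion.2 ⟨⟨a, .rfl⟩, hx⟩⟩
    obtain ⟨x, hx⟩ := nodeSet_nonempty b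
    obtain ⟨⟨c, hc⟩, hxc⟩ := mem_iUnion.1 (huniv ▸ mem_univ x : x ∈ A)
    exact hc.trans (h.reachable_of_mem_nodeSet hxc hx)
  · obtain ⟨a, -⟩ := hcov (Classical.arbitrary X)
    exact ⟨a⟩

end IsBranchedLine

/-! ### Absence of cycles -/

namespace IsBranchedLine

variable {X : Type*} [TopologicalSpace X] {q : X → ℝ} {V : Set X} (h : IsBranchedLine q V)
  [T2Space X]
include h

/-- A function with values in `[0, 1]` that climbs from `0` to `1` along the edge `e` from its
end `v`. -/
theorem exists_height {v : X} (hv : v ∈ V) {e : Set X} (he : e ∈ sheets V) (hve : v ∈ e) :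
    ∃ u : X → ℝ, Continuous u ∧ u v = 0 ∧ ∀ v' ∈ e ∩ V, v' ≠ v → u v' = 1 := by
  obtain ⟨z, hz, rfl⟩ := he
  obtain ⟨n, -, δ, side, β, hs, hV⟩ := h.exists_star hv
  obtain ⟨i, hi⟩ := hs.exists_of_mem_closure hv hV hve
  have hδ := hs.pos
  have hβ : ∀ t ∈ Ioo 0 δ, β i t ∈ connectedComponentIn Vᶜ z := fun t ht =>
    hi ▸ hs.mem_component hV i ht
  have hqβ : ∀ t ∈ Ioo 0 δ, q v + side i * t ∈ q '' connectedComponentIn Vᶜ z := fun t ht =>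
    ⟨_, hβ t ht, hs.proj i t ⟨ht.1.le, ht.2⟩⟩
  have hnot : ∀ w ∈ closure (connectedComponentIn Vᶜ z), w ∈ V →
      q w ∉ q '' connectedComponentIn Vᶜ z := by
    rintro w hw hwV ⟨w', hw', hq⟩
    exact connectedComponentIn_subset _ _ hw' ((h.eq_of_mem_closure hw' hw hq).symm ▸ hwV)
  have hss : side i * side i = 1 := by rcases hs.side_eq i with h' | h' <;> simp [h']
  have hpos : ∀ w ∈ connectedComponentIn Vᶜ z, 0 ≤ side i * (q w - q v) := by
    intro w hw
    by_contra hneg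
    have h1 := hqβ (δ / 2) ⟨by linarith, by linarith⟩
    have hoc := h.ordConnected_image_component z
    refine hnot v hve hv ?_
    rcases hs.side_eq i with h' | h' <;> rw [h'] at h1 hneg
    · exact hoc.out ⟨w, hw, rfl⟩ h1 ⟨by linarith, by linarith⟩
    · exact hoc.out h1 ⟨w, hw, rfl⟩ ⟨by linarith, by linarith⟩
  have hqc := h.continuous
  refine ⟨fun w => max 0 (min 1 (side i * (q w - q v) / δ)), by fun_prop, by simp, ?_⟩
  rintro v' ⟨hv', hv'V⟩ hne
  have h0 : 0 ≤ side i * (q v' - q v) :=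
    closure_minimal hpos (isClosed_le continuous_const (by fun_prop) :
      IsClosed {w | 0 ≤ side i * (q w - q v)}) hv'
  have h1 : side i * (q v' - q v) ≠ 0 := fun h' => hne <| h.injOn hv'V hv <| by
    rcases hs.side_eq i with h2 | h2 <;> rw [h2] at h' <;> linarith
  -- The arc of length `δ` issued from `v` lies in the open edge, so the other end is at least `δ`
  -- away and the truncated function has reached 1 there.
  have h2 : δ ≤ side i * (q v' - q v) := by
    by_contra hlt
    refine hnot v' hv' hv'V ?_
    have := hqβ _ ⟨lt_of_le_of_ne h0 h1.symm, not_le.1 hlt⟩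
    rwa [← mul_assoc, hss, one_mul, add_sub_cancel] at this
  have h3 : 1 ≤ side i * (q v' - q v) / δ := by rwa [one_le_div hδ]
  simp only
  rw [min_eq_left h3, max_eq_right zero_le_one]

/-- If every nonvanishing function has a logarithm, then an edge of a branched line is separated
from its ends by a function that is constant along the other edges. -/
theorem exists_separating (hlog : ∀ f : X → ℂ, Continuous f → (∀ x, f x ≠ 0) → HasLog f)
    {v : V} {e : sheets V} (hve : (v : X) ∈ (e : Set X)) :
    ∃ Φ : V ⊕ sheets V → ℂ, Φ (Sum.inl v) ≠ Φ (Sum.inr e) ∧ ∀ (v' : V) (e' : sheets V),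
      (v' : X) ∈ (e' : Set X) → ¬ (v' = v ∧ e' = e) → Φ (Sum.inl v') = Φ (Sum.inr e') := by
  classical
  obtain ⟨u, hu, huv, hu1⟩ := h.exists_height v.2 e.2 hve
  obtain ⟨z, hz, heJ, hecl⟩ := h.sheet_diff e.2
  set J := connectedComponentIn Vᶜ z
  have hJ : IsOpen J := h.isOpen_component z
  set c : ℂ := 2 * Real.pi * Complex.I
  have hcexp : Complex.exp c = 1 := Complex.exp_two_pi_mul_I
  have hc0 : c ≠ 0 := Complex.two_pi_I_ne_zero
  -- The open edge is wound around the circle as `u` goes from 0 to 1. The rest of the space goes to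
  -- 1, which is continuous because `u` is 0 or 1 at the ends.
  let f : X → ℂ := fun w => if w ∈ J then Complex.exp (c * u w) else 1
  have hbd : ∀ w ∈ closure J, w ∉ J → Complex.exp (c * u w) = 1 := by
    intro w hw hwJ
    rw [← hecl] at hw
    have hwV : w ∈ V := by
      by_contra hwV
      exact hwJ (heJ ▸ ⟨hw, hwV⟩)
    by_cases hwv : w = v
    · rw [hwv, huv]; simp
    · rw [hu1 w ⟨hw, hwV⟩ hwv]; simpa using hcexp
  have hf : Continuous f := by
    refine continuous_if (fun w hw => ?_) (by fun_prop) continuousOn_const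
    have : frontier J = closure J \ J := hJ.frontier_eq
    rw [show {x | x ∈ J} = J from rfl, this] at hw
    exact hbd w hw.1 hw.2
  obtain ⟨g, hg, hgf⟩ := hlog f hf fun w => by
    simp only [f]; split_ifs
    · exact Complex.exp_ne_zero _
    · exact one_ne_zero
  -- Both `g` and `c * u` are logarithms of `f` along `e`, so the increment of `g` along the edge is
  -- that of `c * u`.
  have hconst : ∀ w ∈ (e : Set X), g w - c * u w = g v - c * u v := fun w hw => by
    have hpre : IsPreconnected (e : Set X) := hecl ▸ isPreconnected_connectedComponentIn.closure
    refine eq_of_exp_eq hpre (g := fun w => g w - c * u w) (by fun_prop) (c := 1) ?_ hw hve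
    intro a ha
    rw [Complex.exp_sub, hgf]
    by_cases haJ : a ∈ J
    · simp only [f, if_pos haJ]
      exact div_self (Complex.exp_ne_zero _)
    · simp only [f, if_neg haJ]
      rw [hbd a (hecl ▸ ha) haJ, div_one]
  have hne : ∀ e' : sheets V, (e'.2.choose ∈ (e' : Set X)) := fun e' => by
    have := e'.2.choose_spec
    have h1 := subset_closure (mem_connectedComponentIn (F := Vᶜ) this.1)
    rwa [← this.2] at h1
  -- The node `e` receives the value of `g` at the other end, if there is one, so that only its
  -- incidence with `v` sees the jump `c`. On any other edge `g` is constant, and a chosen point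
  -- gives its value.
  refine ⟨Sum.elim (fun v' => g v') fun e' => if e' = e then g v + c else g e'.2.choose, ?_, ?_⟩
  · simpa using hc0
  · intro v' e' hve' hnot
    by_cases hee : e' = e
    · subst hee
      have hv'v : (v' : X) ≠ v := fun h' => hnot ⟨Subtype.ext h', rfl⟩
      have := hconst v' hve'
      rw [hu1 v' ⟨hve', v'.2⟩ hv'v, huv] at this
      simp only [Sum.elim_inl, Sum.elim_inr, if_true]
      push_cast at this
      linear_combination this
    · simp only [Sum.elim_inl, Sum.elim_inr, if_neg hee]
      obtain ⟨z', hz', heJ', hecl'⟩ := h.sheet_diff e'.2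
      have hdis : Disjoint (e' : Set X) J := by
        have := h.disjoint_sheets e'.2 e.2 fun h' => hee (Subtype.ext h')
        rw [heJ, heJ'] at this
        rw [hecl']
        exact this.closure_left hJ
      have hpre : IsPreconnected (e' : Set X) := hecl' ▸ isPreconnected_connectedComponentIn.closure
      refine eq_of_exp_eq hpre hg.continuousOn (c := 1) (fun a ha => ?_) hve' (hne e')
      rw [hgf]
      exact if_neg (disjoint_left.1 hdis ha)

theorem isTree_incidenceGraph [ConnectedSpace X]
    (hlog : ∀ f : X → ℂ, Continuous f → (∀ x, f x ≠ 0) → HasLog f) :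
    (incidenceGraph V (sheets V)).IsTree := by
  refine ⟨h.connected_incidenceGraph, SimpleGraph.isAcyclic_iff_forall_adj_isBridge.2 ?_⟩
  have key : ∀ (v : V) (e : sheets V), (v : X) ∈ (e : Set X) →
      (incidenceGraph V (sheets V)).IsBridge s(Sum.inl v, Sum.inr e) := by
    intro v e hve
    obtain ⟨Φ, hne, hΦ⟩ := h.exists_separating hlog hve
    refine SimpleGraph.isBridge_iff.2 fun hr => hne (eq_of_reachable ?_ hr)
    intro a b hab
    rw [SimpleGraph.deleteEdges_adj, mem_singleton_iff] at hab
    obtain ⟨v', e', hve', ⟨rfl, rfl⟩ | ⟨rfl, rfl⟩⟩ := incidenceGraph_adj hab.1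
    · exact hΦ v' e' hve' fun h' => hab.2 (by rw [h'.1, h'.2])
    · exact (hΦ v' e' hve' fun h' => hab.2 (by rw [h'.1, h'.2, Sym2.eq_swap])).symm
  intro a b hab
  obtain ⟨v, e, hve, ⟨rfl, rfl⟩ | ⟨rfl, rfl⟩⟩ := incidenceGraph_adj hab
  · exact key v e hve
  · rw [Sym2.eq_swap]; exact key v e hve

/-- A branched line in which every nonvanishing function has a logarithm is a generic transversal
binary tree. -/
theorem isGenericTransversalBinaryTree [ConnectedSpace X]
    (hlog : ∀ f : X → ℂ, Continuous f → (∀ x, f x ≠ 0) → HasLog f) :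
    IsGenericTransversalBinaryTree q univ V (sheets V) where
  __ := h.isGenericTransversalGraph
  isTree := h.isTree_incidenceGraph hlog

end IsBranchedLine

/-! ### Transport of transversal graphs along closed embeddings -/

theorem valency_map {X P : Type*} {E : Set (Set X)} {s : X → P} (hs : Function.Injective s) (v : X) :
    valency (image s '' E) (s v) = valency E v := by
  have : {e ∈ image s '' E | s v ∈ e} = image s '' {e ∈ E | v ∈ e} := by
    ext e
    constructor
    · rintro ⟨⟨e, he, rfl⟩, hve⟩
      exact ⟨e, ⟨he, (hs.mem_set_image).1 hve⟩, rfl⟩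
    · rintro ⟨e, ⟨he, hve⟩, rfl⟩
      exact ⟨⟨e, he, rfl⟩, mem_image_of_mem s hve⟩
  rw [valency, valency, this, ncard_image_of_injective _ hs.image_injective]

section Transport

variable {X P : Type*} [TopologicalSpace X] [TopologicalSpace P] {q : X → ℝ} {π : P → ℝ}
  {V : Set X} {E : Set (Set X)} {s : X → P}

theorem isProperMap_domRestrict_image (hs : IsEmbedding s) (hπ : ∀ x, π (s x) = q x) {A : Set X}
    (hA : IsProperMap (A.domRestrict q)) : IsProperMap ((s '' A).domRestrict π) := by
  have := hA.comp (hs.homeomorphImage A).symm.isProperMap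
  convert this using 1
  ext ⟨_, x, hx, rfl⟩
  have : (hs.homeomorphImage A).symm ⟨s x, x, hx, rfl⟩ = ⟨x, hx⟩ :=
    (hs.homeomorphImage A).symm_apply_eq.2 rfl
  rw [Function.comp, this]
  exact hπ x

theorem isEmbedding_domRestrict_image (hs : IsEmbedding s) (hπ : ∀ x, π (s x) = q x) {A : Set X}
    (hA : IsEmbedding (A.domRestrict q)) : IsEmbedding ((s '' A).domRestrict π) := by
  have := hA.comp (hs.homeomorphImage A).symm.isEmbedding
  convert this using 1
  ext ⟨_, x, hx, rfl⟩
  have : (hs.homeomorphImage A).symm ⟨s x, x, hx, rfl⟩ = ⟨x, hx⟩ :=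
    (hs.homeomorphImage A).symm_apply_eq.2 rfl
  rw [Function.comp, this]
  exact hπ x

theorem IsTransversalGraph.map (h : IsTransversalGraph q univ V E) (hs : IsClosedEmbedding s)
    (hπ : ∀ x, π (s x) = q x) :
    IsTransversalGraph π (range s) (s '' V) (image s '' E) where
  isClosed := hs.isClosed_range
  finite_vertices := h.finite_vertices.image s
  finite_edges := h.finite_edges.image _
  union_eq := by
    rw [← image_univ, h.union_eq, image_union, image_iUnion₂, biUnion_image]
    simp only [image_sdiff hs.injective]
  disjoint_openEdges := by
    rintro _ ⟨e, he, rfl⟩ _ ⟨e', he', rfl⟩ hne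
    simp only [Function.onFun]
    rw [← image_sdiff hs.injective, ← image_sdiff hs.injective]
    exact (disjoint_image_iff hs.injective).2
      (h.disjoint_openEdges he he' fun h' => hne (by rw [h']))
  openEdge_homeomorph := by
    rintro _ ⟨e, he, rfl⟩
    obtain ⟨φ⟩ := h.openEdge_homeomorph e he
    rw [← image_sdiff hs.injective]
    exact ⟨(hs.isEmbedding.homeomorphImage _).symm.trans φ⟩
  closure_openEdge := by
    rintro _ ⟨e, he, rfl⟩
    rw [← image_sdiff hs.injective, hs.closure_image_eq, h.closure_openEdge e he]
  edge_homeomorph := by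
    rintro _ ⟨e, he, rfl⟩
    obtain ⟨I, hI, hIc, ⟨φ⟩⟩ := h.edge_homeomorph e he
    exact ⟨I, hI, hIc, ⟨(hs.isEmbedding.homeomorphImage _).symm.trans φ⟩⟩
  edge_endpoints := by
    rintro _ ⟨e, he, rfl⟩
    rw [← image_inter hs.injective, hs.injective.encard_image]
    exact h.edge_endpoints e he
  transversal := by
    rintro _ ⟨e, he, rfl⟩
    exact isEmbedding_domRestrict_image hs.isEmbedding hπ (h.transversal e he)
  proper := by
    rw [← image_univ]
    exact isProperMap_domRestrict_image hs.isEmbedding hπ h.proper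

/-- An injective map induces an isomorphism of incidence graphs. -/
noncomputable def incidenceGraphIso (hs : Function.Injective s) (V : Set X) (E : Set (Set X)) :
    incidenceGraph V E ≃g incidenceGraph (s '' V) (image s '' E) where
  toEquiv := Equiv.sumCongr (Equiv.Set.image s V hs) (Equiv.Set.image (image s) E hs.image_injective)
  map_rel_iff' := by
    rintro (v | e) (v' | e') <;>
      simp [incidenceGraph, SimpleGraph.fromRel_adj, hs.eq_iff]

theorem IsGenericTransversalBinaryTree.map (h : IsGenericTransversalBinaryTree q univ V E)
    (hs : IsClosedEmbedding s) (hπ : ∀ x, π (s x) = q x) :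
    IsGenericTransversalBinaryTree π (range s) (s '' V) (image s '' E) where
  __ := h.toIsTransversalGraph.map hs hπ
  valency_eq := by
    rintro _ ⟨v, hv, rfl⟩
    rw [valency_map hs.injective]
    exact h.valency_eq v hv
  injOn_vertices := by
    rintro _ ⟨v, hv, rfl⟩ _ ⟨w, hw, rfl⟩ hvw
    rw [hπ, hπ] at hvw
    rw [h.injOn_vertices hv hw hvw]
  isTree := (incidenceGraphIso hs.injective V E).isTree_iff.1 h.isTree

end Transport

/-! ### The collapse of a domain of weakly finite type -/

theorem IsLocallyArc.preimage {P Q : Type*} [TopologicalSpace P] [TopologicalSpace Q] {C : Set P}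
    (hC : IsLocallyArc C) (e : Q ≃ₜ P) : IsLocallyArc (e ⁻¹' C) := by
  intro p hp
  obtain ⟨r, γ, hr, h0, hγc, hγi, hγo⟩ := hC (e p) hp
  refine ⟨r, e.symm ∘ γ, hr, by simp [h0], e.symm.continuous.comp_continuousOn hγc,
    e.symm.injective.comp_injOn hγi, fun V hV hVo => ?_⟩
  obtain ⟨O, hO, hOe⟩ := hγo V hV hVo
  refine ⟨e ⁻¹' O, hO.preimage e.continuous, ?_⟩
  rw [image_comp, hOe, ← preimage_inter]
  exact e.symm.image_eq_preimage_symm _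

section Collapse

variable {P : Type*} [TopologicalSpace P] {π : P → ℝ} {D : Set P}

/-- A domain of weakly finite type, seen in coordinates. -/
theorem IsWeaklyFiniteType.planarDomain (hD : IsWeaklyFiniteType π D) (hgen : IsGenericDomain π D)
    (Ψ : P ≃ₜ ℝ × ℝ) (hΨ : ∀ p, (Ψ p).1 = π p) :
    PlanarDomain (Ψ.symm ⁻¹' D) (Ψ.symm ⁻¹' topCrit π (surfaceBoundary D)) := by
  have hπ' : ∀ a, π (Ψ.symm a) = a.1 := fun a => by rw [← hΨ, Ψ.apply_symm_apply]
  have hπ : Continuous π := (continuous_fst.comp Ψ.continuous).congr hΨ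
  let A : P ≃ₜ ℂ := Ψ.trans Complex.equivRealProdCLM.symm.toHomeomorph
  have hbd := surfaceBoundary_eq_frontier A hD.isClosed hD.isSurface
  have harc := isLocallyArc_frontier A hD.isClosed hD.isSurface
  have hfr : frontier (Ψ.symm ⁻¹' D) = Ψ.symm ⁻¹' frontier D := (Ψ.symm.preimage_frontier D).symm
  have hproper := hD.proper_boundary
  have hfin := hD.finite_topCrit
  rw [IsGenericDomain, hbd] at hgen
  rw [hbd] at hproper hfin ⊢
  refine ⟨hD.isClosed.preimage Ψ.symm.continuous, ?_, ?_, hfr ▸ harc.preimage Ψ.symm,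
    hfin.preimage Ψ.symm.injective.injOn, ?_, ?_, ?_⟩
  · rw [← Ψ.symm.preimage_interior, ← Ψ.symm.preimage_closure]
    exact preimage_mono (subset_closure_interior A hD.isSurface)
  · rw [hfr, ← Ψ.image_eq_preimage_symm]
    exact isProperMap_domRestrict_image Ψ.isEmbedding hΨ hproper
  · rw [hfr]
    exact preimage_mono fun p hp => hp.1
  · intro a ha
    rw [hfr] at ha ⊢
    rw [mem_preimage, notMem_topCrit_iff hπ harc ha]
    constructor
    · rintro ⟨U, hU, hUi⟩
      refine ⟨Ψ.symm ⁻¹' U, Ψ.symm.continuous.continuousAt.preimage_mem_nhds hU, ?_⟩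
      intro b hb c hc hbc
      exact Ψ.symm.injective (hUi hb hc (by rw [hπ', hπ', hbc]))
    · rintro ⟨U, hU, hUi⟩
      refine ⟨Ψ ⁻¹' U, Ψ.continuous.continuousAt.preimage_mem_nhds (by simpa using hU), ?_⟩
      intro b hb c hc hbc
      exact Ψ.injective (hUi ⟨by simpa using hb.1, hb.2⟩ ⟨by simpa using hc.1, hc.2⟩
        (by rw [hΨ, hΨ, hbc]))
  · intro a ha b hb hab
    exact Ψ.symm.injective (hgen ha hb (by rw [hπ', hπ', hab]))

theorem collapseMap_eq_iff {p p' : P} (hp : p ∈ D) :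
    collapseMap π D p = collapseMap π D p' ↔ p' ∈ fiberComponent π D p := by
  rw [collapseMap, Quotient.eq]
  change vertRel π D p p' ↔ _
  constructor
  · rintro ⟨-, h | h⟩
    · exact h
    · exact absurd hp h.2
  · intro h
    exact ⟨((connectedComponentIn_subset _ _ h).2 : π p' = π p).symm, Or.inl h⟩

/-- In coordinates a fibre lies on a vertical line, where connected sets are order convex. -/
theorem mem_fiberComponent_iff (Ψ : P ≃ₜ ℝ × ℝ) (hΨ : ∀ p, (Ψ p).1 = π p) {p p' : P}
    (hp : p ∈ D) : p' ∈ fiberComponent π D p ↔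
      (Ψ p).1 = (Ψ p').1 ∧ ∀ y ∈ uIcc (Ψ p).2 (Ψ p').2, Ψ.symm ((Ψ p).1, y) ∈ D := by
  constructor
  · intro h
    have hsub := connectedComponentIn_subset _ _ h
    refine ⟨by rw [hΨ, hΨ]; exact hsub.2.symm, fun y hy => ?_⟩
    have hpre : IsPreconnected ((fun x => (Ψ x).2) '' fiberComponent π D p) :=
      isPreconnected_connectedComponentIn.image _ (by fun_prop)
    obtain ⟨x, hx, rfl⟩ := hpre.ordConnected.uIcc_subset
      ⟨p, self_mem_fiberComponent hp, rfl⟩ ⟨p', h, rfl⟩ hy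
    have hx' := connectedComponentIn_subset _ _ hx
    have : Ψ x = ((Ψ p).1, (Ψ x).2) := Prod.ext (by rw [hΨ x, hΨ p]; exact hx'.2) rfl
    rw [← this, Ψ.symm_apply_apply]
    exact hx'.1
  · rintro ⟨h1, h2⟩
    have hpre : IsPreconnected ((fun y => Ψ.symm ((Ψ p).1, y)) '' uIcc (Ψ p).2 (Ψ p').2) :=
      isPreconnected_uIcc.image _ (by fun_prop)
    refine hpre.subset_connectedComponentIn ⟨_, left_mem_uIcc, Ψ.symm_apply_apply p⟩ ?_
      ⟨_, right_mem_uIcc, ?_⟩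
    · rintro _ ⟨y, hy, rfl⟩
      refine ⟨h2 y hy, ?_⟩
      rw [mem_preimage, mem_singleton_iff, ← hΨ, Ψ.apply_symm_apply, hΨ]
    · rw [h1]; exact Ψ.symm_apply_apply p'

/-- The map that `π` induces on the Poincaré–Reeb set. -/
def prProj (π : P → ℝ) (D : Set P) (x : prSet π D) : ℝ :=
  Quotient.lift π (fun a b (h : vertRel π D a b) => h.1) (x : Collapse π D)

/-- The collapsing map from the domain to its Poincaré–Reeb set. -/
def toPRSet (π : P → ℝ) (D : Set P) (p : D) : prSet π D := ⟨collapseMap π D p, p, p.2, rfl⟩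

theorem continuous_toPRSet : Continuous (toPRSet π D) :=
  (continuous_quotient_mk'.comp continuous_subtype_val).subtype_mk _

theorem toPRSet_surjective : Function.Surjective (toPRSet π D) := by
  rintro ⟨_, p, hp, rfl⟩
  exact ⟨⟨p, hp⟩, rfl⟩

theorem prProj_toPRSet (p : D) : prProj π D (toPRSet π D p) = π p := rfl

theorem toPRSet_eq_iff {p p' : D} :
    toPRSet π D p = toPRSet π D p' ↔ (p' : P) ∈ fiberComponent π D p := by
  rw [← collapseMap_eq_iff p.2, Subtype.ext_iff]
  rfl

/-- The topology induced from the collapse of the whole plane is the quotient topology of `D`,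
because `D` is closed and saturated. -/
theorem isClosed_of_preimage_toPRSet (hD : IsClosed D) {S : Set (prSet π D)}
    (hS : IsClosed (toPRSet π D ⁻¹' S)) : IsClosed S := by
  have h1 : IsClosed (Subtype.val '' S : Set (Collapse π D)) := by
    rw [← isQuotientMap_quotient_mk'.isClosed_preimage]
    convert hD.isClosedEmbedding_subtypeVal.isClosedMap _ hS using 1
    ext p
    constructor
    · rintro ⟨⟨_, p', hp', rfl⟩, hpS, hpp'⟩
      have hpD : p ∈ D := (mem_of_mem_fiberComponent ((collapseMap_eq_iff hp').1 hpp')).2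
      refine ⟨⟨p, hpD⟩, ?_, rfl⟩
      rw [mem_preimage]
      convert hpS using 1
      exact Subtype.ext hpp'.symm
    · rintro ⟨p', hp', rfl⟩
      exact ⟨_, hp', rfl⟩
  have := h1.preimage (continuous_subtype_val (p := (· ∈ prSet π D)))
  rwa [preimage_image_eq _ Subtype.val_injective] at this

open Classical in
/-- The collapsing map, in coordinates. -/
noncomputable def planarCollapse (π : P → ℝ) (D : Set P) (Ψ : P ≃ₜ ℝ × ℝ) (p₀ : D) (a : ℝ × ℝ) :
    prSet π D :=
  -- The value off the domain is arbitrary; it only makes the map total.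
  if h : Ψ.symm a ∈ D then toPRSet π D ⟨Ψ.symm a, h⟩ else toPRSet π D p₀

theorem planarCollapse_eq {Ψ : P ≃ₜ ℝ × ℝ} {p₀ : D} {a : ℝ × ℝ} (h : Ψ.symm a ∈ D) :
    planarCollapse π D Ψ p₀ a = toPRSet π D ⟨Ψ.symm a, h⟩ := dif_pos h

theorem isVertCollapse_planarCollapse (hD : IsClosed D) (Ψ : P ≃ₜ ℝ × ℝ)
    (hΨ : ∀ p, (Ψ p).1 = π p) (p₀ : D) :
    IsVertCollapse (Ψ.symm ⁻¹' D) (planarCollapse π D Ψ p₀) (prProj π D) where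
  continuousOn := by
    rw [continuousOn_iff_continuous_domRestrict]
    have : (Ψ.symm ⁻¹' D).domRestrict (planarCollapse π D Ψ p₀) =
        fun a : Ψ.symm ⁻¹' D => toPRSet π D ⟨Ψ.symm a, a.2⟩ := funext fun a => planarCollapse_eq a.2
    rw [this]
    exact continuous_toPRSet.comp (by fun_prop)
  surj z := by
    obtain ⟨p, rfl⟩ := toPRSet_surjective z
    have hp : Ψ.symm (Ψ p) ∈ D := by simp
    refine ⟨Ψ p, hp, ?_⟩
    rw [planarCollapse_eq hp]
    congr 1
    exact Subtype.ext (Ψ.symm_apply_apply _)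
  eq_iff a ha b hb := by
    rw [planarCollapse_eq (D := D) ha, planarCollapse_eq (D := D) hb, toPRSet_eq_iff, mem_fiberComponent_iff (D := D) Ψ hΨ ha]
    simp only [Ψ.apply_symm_apply]
    rfl
  isClosed_of S hS := by
    refine isClosed_of_preimage_toPRSet hD ?_
    convert hS.preimage (Ψ.continuous.comp continuous_subtype_val : Continuous fun p : D => Ψ p)
      using 1
    ext p
    have hp : Ψ.symm (Ψ p) ∈ D := by simp
    have hpp : (⟨Ψ.symm (Ψ p), hp⟩ : D) = p := Subtype.ext (Ψ.symm_apply_apply _)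
    change toPRSet π D p ∈ S ↔ Ψ.symm (Ψ p) ∈ D ∧ planarCollapse π D Ψ p₀ (Ψ p) ∈ S
    rw [planarCollapse_eq hp, hpp]
    exact (and_iff_right hp).symm
  proj a ha := by
    rw [planarCollapse_eq (D := D) ha, prProj_toPRSet, ← hΨ, Ψ.apply_symm_apply]

/-- Needed for the lifting criterion on `D`; it is inherited from the half-plane through the charts.
-/
theorem IsSurface.locallyPathConnectedSpace (hD : IsSurface D) : LocallyPathConnectedSpace D := by
  choose e he using hD
  let _ : ChartedSpace (EuclideanHalfSpace 2) D :=
    { atlas := range e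
      chartAt := e
      mem_chart_source := he
      chart_mem_atlas := mem_range_self }
  exact ChartedSpace.locallyPathConnectedSpace (EuclideanHalfSpace 2) D

namespace IsPRSection

variable {s : prSet π D → P} (hs : IsPRSection π D s)
include hs

theorem toPRSet_apply (x : prSet π D) : toPRSet π D ⟨s x, hs.mem x⟩ = x :=
  Subtype.ext (hs.section_eq x)

theorem proj_apply (x : prSet π D) : π (s x) = prProj π D x := by
  conv_rhs => rw [← hs.toPRSet_apply x]
  rw [prProj_toPRSet]

theorem injective : Function.Injective s := fun x y hxy =>
  Subtype.ext (by rw [← hs.section_eq x, hxy, hs.section_eq])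

/-- The composite `π ∘ s` is the proper projection of the Poincaré–Reeb set, which forces `s` to be
proper. -/
theorem isClosedEmbedding [T2Space P] (hπ : Continuous π) (hq : IsProperMap (prProj π D)) :
    IsClosedEmbedding s := by
  have : IsProperMap (π ∘ s) := by rwa [show π ∘ s = prProj π D from funext hs.proj_apply]
  exact .of_continuous_injective_isClosedMap hs.continuous hs.injective
    (isProperMap_of_comp_of_t2 hs.continuous hπ this).isClosedMap

/-- The Poincaré–Reeb set of a simply connected domain is a retract of it, so that nonvanishing
functions on it have logarithms. -/
theorem hasLog (hD : IsSurface D) [SimplyConnectedSpace D] {f : prSet π D → ℂ}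
    (hf : Continuous f) (h0 : ∀ x, f x ≠ 0) : HasLog f := by
  have := hD.locallyPathConnectedSpace
  obtain ⟨g, hg, hgf⟩ := hasLog_of_simplyConnected (hf.comp continuous_toPRSet) fun p => h0 _
  refine ⟨fun x => g ⟨s x, hs.mem x⟩, hg.comp (hs.continuous.subtype_mk _), fun x => ?_⟩
  rw [hgf, Function.comp, hs.toPRSet_apply]

end IsPRSection

/-- The vertices of the Poincaré–Reeb set, as a subset of it. -/
def prVertexSet (π : P → ℝ) (D : Set P) : Set (prSet π D) := Subtype.val ⁻¹' prVertices π D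

theorem mem_sUnion_criticalSegments_iff (hD : surfaceBoundary D ⊆ D) {p : P} (hp : p ∈ D) :
    p ∈ ⋃₀ criticalSegments π D ↔ toPRSet π D ⟨p, hp⟩ ∈ prVertexSet π D := by
  constructor
  · rintro ⟨_, ⟨t, ht, rfl⟩, hpt⟩
    exact ⟨t, ht, (collapseMap_eq_iff (hD ht.1)).2 hpt⟩
  · rintro ⟨t, ht, hpt⟩
    exact ⟨_, ⟨t, ht, rfl⟩, (collapseMap_eq_iff (hD ht.1)).1 hpt⟩

/-- The components of the complement of the critical segments are the inverse images of the
components of the complement of the vertices. -/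
theorem mem_component_iff (hD : surfaceBoundary D ⊆ D) {s : prSet π D → P}
    (hs : IsPRSection π D s) {p : P} (hp : p ∈ D \ ⋃₀ criticalSegments π D) {p' : P} :
    p' ∈ connectedComponentIn (D \ ⋃₀ criticalSegments π D) p ↔
      ∃ hp' : p' ∈ D, toPRSet π D ⟨p', hp'⟩ ∈
        connectedComponentIn (prVertexSet π D)ᶜ (toPRSet π D ⟨p, hp.1⟩) := by
  set J := connectedComponentIn (prVertexSet π D)ᶜ (toPRSet π D ⟨p, hp.1⟩)
  have hpV : toPRSet π D ⟨p, hp.1⟩ ∈ (prVertexSet π D)ᶜ := fun h' =>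
    hp.2 ((mem_sUnion_criticalSegments_iff hD hp.1).2 h')
  have hpJ : toPRSet π D ⟨p, hp.1⟩ ∈ J := mem_connectedComponentIn hpV
  constructor
  · intro hp'
    have hsub := connectedComponentIn_subset _ _ hp'
    refine ⟨hsub.1, ?_⟩
    have hpre : IsPreconnected
        (Subtype.val ⁻¹' connectedComponentIn (D \ ⋃₀ criticalSegments π D) p : Set D) := by
      rw [← IsInducing.subtypeVal.isPreconnected_image, Subtype.image_preimage_val,
        inter_eq_right.2 fun x hx => (connectedComponentIn_subset _ _ hx).1]
      exact isPreconnected_connectedComponentIn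
    refine (hpre.image _ continuous_toPRSet.continuousOn).subset_connectedComponentIn
      ⟨⟨p, hp.1⟩, mem_connectedComponentIn hp, rfl⟩ ?_ ⟨⟨p', hsub.1⟩, hp', rfl⟩
    rintro _ ⟨x, hx, rfl⟩ hxV
    exact (connectedComponentIn_subset _ _ hx).2 ((mem_sUnion_criticalSegments_iff hD x.2).2 hxV)
  · rintro ⟨hp'D, hp'J⟩
    have hfib : ∀ x (hx : x ∈ D), toPRSet π D ⟨x, hx⟩ ∈ J →
        fiberComponent π D x ⊆ {y | ∃ hy : y ∈ D, toPRSet π D ⟨y, hy⟩ ∈ J} := by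
      intro x hx hxJ y hy
      have hyD := (mem_of_mem_fiberComponent hy).2
      refine ⟨hyD, ?_⟩
      rwa [← (toPRSet_eq_iff (p := ⟨x, hx⟩) (p' := ⟨y, hyD⟩)).2 hy]
    have hsfib : ∀ x (hx : x ∈ D), s (toPRSet π D ⟨x, hx⟩) ∈ fiberComponent π D x := fun x hx =>
      (toPRSet_eq_iff (p := ⟨x, hx⟩) (p' := ⟨_, hs.mem _⟩)).1 (hs.toPRSet_apply _).symm
    -- Connect `p` to `p'` by moving vertically to the section, along the section over `J`, and
    -- vertically again.
    have hpre : IsPreconnected ((fiberComponent π D p ∪ s '' J) ∪ fiberComponent π D p') := by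
      refine IsPreconnected.union (s (toPRSet π D ⟨p', hp'D⟩))
        (Or.inr ⟨_, hp'J, rfl⟩) (hsfib p' hp'D) ?_ isPreconnected_connectedComponentIn
      exact IsPreconnected.union (s (toPRSet π D ⟨p, hp.1⟩)) (hsfib p hp.1) ⟨_, hpJ, rfl⟩
        isPreconnected_connectedComponentIn
        (isPreconnected_connectedComponentIn.image s hs.continuous.continuousOn)
    refine hpre.subset_connectedComponentIn (Or.inl (Or.inl (self_mem_fiberComponent hp.1))) ?_
      (Or.inr (self_mem_fiberComponent hp'D))
    have hW : (fiberComponent π D p ∪ s '' J) ∪ fiberComponent π D p' ⊆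
        {y | ∃ hy : y ∈ D, toPRSet π D ⟨y, hy⟩ ∈ J} := by
      refine union_subset (union_subset (hfib p hp.1 hpJ) ?_) (hfib p' hp'D hp'J)
      rintro _ ⟨x, hx, rfl⟩
      exact ⟨hs.mem x, by rwa [hs.toPRSet_apply]⟩
    intro y hy
    obtain ⟨hyD, hyJ⟩ := hW hy
    exact ⟨hyD, fun h' => connectedComponentIn_subset _ _ hyJ
      ((mem_sUnion_criticalSegments_iff hD hyD).1 h')⟩

/-- The image in the Poincaré–Reeb set of the closure of a component of the complement of the
critical segments. -/
theorem preimage_collapseMap_image_closure (hDc : IsClosed D) (hD : surfaceBoundary D ⊆ D)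
    {s : prSet π D → P} (hs : IsPRSection π D s) {p : P}
    (hp : p ∈ D \ ⋃₀ criticalSegments π D) :
    (Subtype.val ⁻¹' (collapseMap π D ''
      closure (connectedComponentIn (D \ ⋃₀ criticalSegments π D) p)) : Set (prSet π D)) =
    closure (connectedComponentIn (prVertexSet π D)ᶜ (toPRSet π D ⟨p, hp.1⟩)) := by
  set W := connectedComponentIn (D \ ⋃₀ criticalSegments π D) p
  set J := connectedComponentIn (prVertexSet π D)ᶜ (toPRSet π D ⟨p, hp.1⟩)
  have hWD : closure W ⊆ D :=
    closure_minimal (fun x hx => (connectedComponentIn_subset _ _ hx).1) hDc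
  apply Subset.antisymm
  · rintro x ⟨p', hp', hx⟩
    have hx' : x = toPRSet π D ⟨p', hWD hp'⟩ := Subtype.ext hx.symm
    have hcl : (⟨p', hWD hp'⟩ : D) ∈ closure (Subtype.val ⁻¹' W : Set D) := by
      rw [closure_subtype, Subtype.image_preimage_val, inter_eq_right.2 (subset_closure.trans hWD)]
      exact hp'
    rw [hx']
    exact map_mem_closure continuous_toPRSet hcl fun y hy =>
      ((mem_component_iff hD hs hp).1 hy).choose_spec
  · intro x hx
    refine ⟨s x, map_mem_closure hs.continuous hx fun y hy => ?_, hs.section_eq x⟩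
    exact (mem_component_iff hD hs hp).2 ⟨hs.mem y, by rwa [hs.toPRSet_apply]⟩

/-- Identifies the edges defined through bands of the domain with the intrinsic edges of the
branched line. -/
theorem sheets_prVertexSet (hDc : IsClosed D) (hD : surfaceBoundary D ⊆ D)
    {s : prSet π D → P} (hs : IsPRSection π D s) :
    sheets (prVertexSet π D) = (fun A => Subtype.val ⁻¹' A) '' prEdges π D := by
  ext e
  constructor
  · rintro ⟨z, hz, rfl⟩
    obtain ⟨⟨p, hpD⟩, rfl⟩ := toPRSet_surjective z
    have hp : p ∈ D \ ⋃₀ criticalSegments π D :=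
      ⟨hpD, fun h' => hz ((mem_sUnion_criticalSegments_iff hD hpD).1 h')⟩
    exact ⟨_, ⟨_, ⟨p, hp, rfl⟩, rfl⟩, preimage_collapseMap_image_closure hDc hD hs hp⟩
  · rintro ⟨_, ⟨_, ⟨p, hp, rfl⟩, rfl⟩, rfl⟩
    exact ⟨toPRSet π D ⟨p, hp.1⟩,
      fun h' => hp.2 ((mem_sUnion_criticalSegments_iff hD hp.1).2 h'),
      preimage_collapseMap_image_closure hDc hD hs hp⟩

end Collapse
end PoincareReeb

/-! ### The proposition -/

theorem mainTheorem11 {P : Type*} [TopologicalSpace P] (π : P → ℝ)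
    (hP : PoincareReeb.IsVerticalPlane π) (D : Set P)
    (hD : PoincareReeb.IsWeaklyFiniteType π D)
    (hgen : PoincareReeb.IsGenericDomain π D)
    (hsc : SimplyConnectedSpace D) :
    (∃ s : PoincareReeb.prSet π D → P, PoincareReeb.IsPRSection π D s) ∧
    ∀ s : PoincareReeb.prSet π D → P, PoincareReeb.IsPRSection π D s →
      PoincareReeb.IsGenericTransversalBinaryTree π (Set.range s)
        (PoincareReeb.sourceVertices s) (PoincareReeb.sourceEdges s) := by
  open PoincareReeb in
  obtain ⟨Ψ, hΨ⟩ := hP.exists_homeomorph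
  have hπ : Continuous π := (continuous_fst.comp Ψ.continuous).congr hΨ
  have hT2 : T2Space P := Ψ.symm.t2Space
  have hbdD : surfaceBoundary D ⊆ D := fun p hp => hp.1
  have p₀ : D := ⟨_, hbdD hD.boundary_nonempty.some_mem⟩
  have hK := hD.planarDomain hgen Ψ hΨ
  have hr := isVertCollapse_planarCollapse hD.isClosed Ψ hΨ p₀
  refine ⟨?_, fun s hs => ?_⟩
  · obtain ⟨g, hg, hgK⟩ := hr.exists_section hK
    refine ⟨fun x => Ψ.symm (prProj π D x, g x),
      Ψ.symm.continuous.comp ((hr.continuous_proj hK).prodMk hg), fun x => (hgK x).1, fun x => ?_⟩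
    have h1 := (hgK x).2
    rw [planarCollapse_eq (D := D) (hgK x).1] at h1
    exact congrArg Subtype.val h1
  · have hX2 := hr.t2Space hK
    have hXc : ConnectedSpace (prSet π D) :=
      toPRSet_surjective.connectedSpace continuous_toPRSet
    -- The vertices found in coordinates are those of the Poincaré–Reeb set.
    have hV : planarCollapse π D Ψ p₀ '' (Ψ.symm ⁻¹' topCrit π (surfaceBoundary D)) =
        prVertexSet π D := by
      ext x
      constructor
      · rintro ⟨a, ha, rfl⟩
        rw [planarCollapse_eq (hbdD ha.1)]
        exact ⟨_, ha, rfl⟩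
      · rintro ⟨t, ht, htx⟩
        have htD : Ψ.symm (Ψ t) ∈ D := by rw [Ψ.symm_apply_apply]; exact hbdD ht.1
        refine ⟨Ψ t, by simpa using ht, ?_⟩
        rw [planarCollapse_eq htD]
        refine Subtype.ext ?_
        exact (congrArg (collapseMap π D) (Ψ.symm_apply_apply t)).trans htx
    have hb := hr.isBranchedLine hK
    rw [hV] at hb
    have htree := (hb.isGenericTransversalBinaryTree fun f hf h0 => hs.hasLog hD.isSurface hf h0).map
      (hs.isClosedEmbedding hπ hb.proper) hs.proj_apply
    rw [sheets_prVertexSet hD.isClosed hbdD hs, Set.image_image] at htree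
    exact htree
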